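/- **Theorem.** There are a polynomial $p$ and an integer $k$ such that for every degree bound $d$ and every constant $\gamma>0$ there is an $\alpha\ge 1$ with $$\alpha\le\Big(\frac{d}{\ln 2}\Big)^{d}p(d)$$ such that for every constant $c\in\mathbb N$ an $\alpha$-approximate pure Nash equilibrium of Shapley value weighted congestion games of degree at most $d$ can be computed in randomized polynomial time with probability at least $1-n^{-c}$ ($n$ the number of players). Precisely, there are a randomized program and a constant $K$ (both may depend on $d,\gamma,c$) such that on every explicitly given game of input length $L$ bits the program halts after at most $K\cdot L^{k}$ steps for all outcomes of its coin tosses and, with probability at least $1-n^{-c}$ over its coin tosses, outputs an $\alpha$-approximate pure Nash equilibrium of the game. (For $n=0$ and $c\geq 1$, read $n^{-c}$ as $0$.) *Games.* A game consists of finitely many players $i$ with weights $w_i>0$, a finite set $E$ of resources, a non-empty set $\mathcal P_i\subseteq 2^E$ of strategies for each player, and cost functions $c_e$ ($e\in E$) that are polynomials of degree at most $d$ with non-negative coefficients. It is given explicitly: weights and coefficients are rational numbers written in binary, and all strategies of every player are listed. An outcome $P$ chooses $P_i\in\mathcal P_i$ for each player. Let $S_e(P)=\{i: e\in P_i\}$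 and $C_e(x)=x\,c_e(x)$. The Shapley cost share of $i\in A$ on $e$ is $$\chi_e(i,A)=\mathbb E_{\pi}\Big[C_e\Big(w_i+\sum_{j\in A,\ \pi(j)<\pi(i)}w_j\Big)-C_e\Big(\sum_{j\in A,\ \pi(j)<\pi(i)}w_j\Big)\Big],$$ where $\pi$ is a uniformly random ordering of $A$, and the cost of player $i$ is $X_i(P)=\sum_{e\in P_i}\chi_e(i,S_e(P))$. The outcome $P$ is an $\alpha$-approximate pure Nash equilibrium if $X_i(P)\le\alpha\,X_i(P_{-i},P_i')$ for every player $i$ and every $P_i'\in\mathcal P_i$. *Machine.* Programs run on a random access machine over the integers with addition, subtraction, multiplication, division, comparison, indirect addressing and fair coin tosses; time is measured by the logarithmic cost criterion (every operation costs the number of bits of the numbers and addresses it involves). -/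

import Mathlib

/-! ### Weighted congestion games with Shapley cost sharing -/

/-- A weighted congestion game with player set `N` and resource set `E`: positive weights, a
non-empty set of strategies (sets of resources) for every player, and resource cost functions that
are polynomials of degree at most `d` with non-negative coefficients. -/
structure CongestionGame (N E : Type) (d : ℕ) where
  weight : N → ℝ
  strategies : N → Finset (Finset E)
  cost : E → Polynomial ℝ
  weight_pos : ∀ i, 0 < weight i
  strategies_nonempty : ∀ i, (strategies i).Nonempty
  cost_degree : ∀ e, (cost e).natDegree ≤ d
  cost_coeff_nonneg : ∀ e k, 0 ≤ (cost e).coeff k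

namespace CongestionGame

variable {N E : Type} {d : ℕ} [Fintype N] [DecidableEq N] [DecidableEq E]

/-- The joint cost `C_e(x) = x * c_e(x)` of a resource carrying total weight `x`. -/
noncomputable def jointCost (G : CongestionGame N E d) (e : E) (x : ℝ) : ℝ :=
  x * (G.cost e).eval x

/-- `W_A^{<i,π}`: the total weight of the players of `A` that precede `i` in the ordering `π`. -/
noncomputable def precedingWeight (G : CongestionGame N E d) (A : Finset N)
    (π : {j // j ∈ A} ≃ Fin A.card) (i : {j // j ∈ A}) : ℝ :=
  ∑ j : {j // j ∈ A} with π j < π i, G.weight j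

/-- The Shapley cost share `χ_e(i, A)` of `i ∈ A` on the resource `e` used by the players in `A`:
the average, over all `|A|!` orderings of `A`, of the marginal joint cost of `i`. (It is only ever
used for `i ∈ A`.) -/
noncomputable def shapleyShare (G : CongestionGame N E d) (e : E) (i : N) (A : Finset N) : ℝ :=
  if hi : i ∈ A then
    (∑ π : {j // j ∈ A} ≃ Fin A.card,
      (G.jointCost e (G.precedingWeight A π ⟨i, hi⟩ + G.weight i)
        - G.jointCost e (G.precedingWeight A π ⟨i, hi⟩))) / (A.card.factorial : ℝ)
  else 0

/-- `S_e(P)`: the players using resource `e` in `P`. -/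
def users (P : N → Finset E) (e : E) : Finset N :=
  Finset.univ.filter fun i => e ∈ P i

/-- `X_i(P)`: the total cost of player `i`. -/
noncomputable def playerCost (G : CongestionGame N E d) (P : N → Finset E) (i : N) : ℝ :=
  ∑ e ∈ P i, G.shapleyShare e i (users P e)

/-- `P` is a `ρ`-approximate pure Nash equilibrium: an outcome in which no player can decrease her
cost by more than a factor `ρ` through a unilateral deviation. -/
def IsApproxPNE (G : CongestionGame N E d) (ρ : ℝ) (P : N → Finset E) : Prop :=
  (∀ i, P i ∈ G.strategies i) ∧
    ∀ i, ∀ Q ∈ G.strategies i, G.playerCost P i ≤ ρ * G.playerCost (Function.update P i Q) i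

end CongestionGame

/-! ### A randomized random access machine with logarithmic cost -/

/-- Number of binary digits of `z`, plus one for the sign. -/
def bitLength (z : ℤ) : ℕ := Nat.size z.natAbs + 1

/-- The memory: arrays, numbered by `ℕ` (a program mentions only finitely many of them), whose cells
are numbered by integers and hold integers. -/
abbrev Mem : Type := ℕ → ℤ → ℤ

/-- Integer expressions; `read a i` is cell number `i` of array `a`. -/
inductive Expr : Type where
  | const (z : ℤ)
  | read (a : ℕ) (i : Expr)
  | add (e f : Expr)
  | sub (e f : Expr)
  | mul (e f : Expr)
  | div (e f : Expr)

namespace Expr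

/-- Value of an expression. Division is Euclidean, and division by zero gives zero. -/
def eval (σ : Mem) : Expr → ℤ
  | const z => z
  | read a i => σ a (i.eval σ)
  | add e f => e.eval σ + f.eval σ
  | sub e f => e.eval σ - f.eval σ
  | mul e f => e.eval σ * f.eval σ
  | div e f => e.eval σ / f.eval σ

/-- Logarithmic cost of evaluating an expression: each operation costs the number of bits of its
operands, each memory access the number of bits of the address and of the content. -/
def evalCost (σ : Mem) : Expr → ℕ
  | const z => bitLength z
  | read a i => i.evalCost σ + bitLength (i.eval σ) + bitLength (σ a (i.eval σ))
  | add e f => e.evalCost σ + f.evalCost σ + bitLength (e.eval σ) + bitLength (f.eval σ)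
  | sub e f => e.evalCost σ + f.evalCost σ + bitLength (e.eval σ) + bitLength (f.eval σ)
  | mul e f => e.evalCost σ + f.evalCost σ + bitLength (e.eval σ) + bitLength (f.eval σ)
  | div e f => e.evalCost σ + f.evalCost σ + bitLength (e.eval σ) + bitLength (f.eval σ)

end Expr

/-- Programs. `assign a i e` stores `e` in cell `i` of array `a`, `flip a i` stores a fair random bit
there, and the tests of `ite` and `loop` are `0 < e`. -/
inductive Program : Type where
  | skip
  | assign (a : ℕ) (i e : Expr)
  | flip (a : ℕ) (i : Expr)
  | seq (p q : Program)
  | ite (e : Expr) (p q : Program)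
  | loop (e : Expr) (p : Program)

/-- `σ` with cell `i` of array `a` set to `z`. -/
def Mem.write (σ : Mem) (a : ℕ) (i z : ℤ) : Mem :=
  Function.update σ a (Function.update (σ a) i z)

/-- `Exec p σ r t σ' r'`: the program `p`, started in memory `σ` with the sequence `r` of coin
tosses at its disposal, halts after time `t` in memory `σ'`, and `r'` are the unused coin tosses. -/
inductive Exec : Program → Mem → List Bool → ℕ → Mem → List Bool → Prop where
  | skip (σ : Mem) (r : List Bool) : Exec .skip σ r 1 σ r
  | assign (a : ℕ) (i e : Expr) (σ : Mem) (r : List Bool) :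
      Exec (.assign a i e) σ r
        (1 + i.evalCost σ + e.evalCost σ + bitLength (i.eval σ) + bitLength (e.eval σ))
        (σ.write a (i.eval σ) (e.eval σ)) r
  | flip (a : ℕ) (i : Expr) (σ : Mem) (b : Bool) (r : List Bool) :
      Exec (.flip a i) σ (b :: r) (1 + i.evalCost σ + bitLength (i.eval σ))
        (σ.write a (i.eval σ) (if b then 1 else 0)) r
  | seq {p q : Program} {σ σ' σ'' : Mem} {r r' r'' : List Bool} {t t' : ℕ}
      (hp : Exec p σ r t σ' r') (hq : Exec q σ' r' t' σ'' r'') :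
      Exec (.seq p q) σ r (t + t') σ'' r''
  | ite_true {e : Expr} {p q : Program} {σ σ' : Mem} {r r' : List Bool} {t : ℕ}
      (he : 0 < e.eval σ) (hp : Exec p σ r t σ' r') :
      Exec (.ite e p q) σ r (1 + e.evalCost σ + bitLength (e.eval σ) + t) σ' r'
  | ite_false {e : Expr} {p q : Program} {σ σ' : Mem} {r r' : List Bool} {t : ℕ}
      (he : ¬ 0 < e.eval σ) (hq : Exec q σ r t σ' r') :
      Exec (.ite e p q) σ r (1 + e.evalCost σ + bitLength (e.eval σ) + t) σ' r'
  | loop_true {e : Expr} {p : Program} {σ σ' σ'' : Mem} {r r' r'' : List Bool} {t t' : ℕ}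
      (he : 0 < e.eval σ) (hp : Exec p σ r t σ' r') (hl : Exec (.loop e p) σ' r' t' σ'' r'') :
      Exec (.loop e p) σ r (1 + e.evalCost σ + bitLength (e.eval σ) + t + t') σ'' r''
  | loop_false {e : Expr} {p : Program} {σ : Mem} {r : List Bool} (he : ¬ 0 < e.eval σ) :
      Exec (.loop e p) σ r (1 + e.evalCost σ + bitLength (e.eval σ)) σ r

/-- The result of a run, its running time and the coins it uses are determined by the program, the
initial memory and the coin tosses. -/
theorem Exec.deterministic {p : Program} {σ σ₁ σ₂ : Mem} {r r₁ r₂ : List Bool} {t₁ t₂ : ℕ}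
    (h₁ : Exec p σ r t₁ σ₁ r₁) (h₂ : Exec p σ r t₂ σ₂ r₂) : t₁ = t₂ ∧ σ₁ = σ₂ ∧ r₁ = r₂ := by
  induction h₁ generalizing t₂ σ₂ r₂ with
  | skip | assign | flip => cases h₂; exact ⟨rfl, rfl, rfl⟩
  | seq _ _ ihp ihq =>
    cases h₂ with
    | seq hp hq =>
      obtain ⟨rfl, rfl, rfl⟩ := ihp hp
      obtain ⟨rfl, rfl, rfl⟩ := ihq hq
      exact ⟨rfl, rfl, rfl⟩
  | ite_true he _ ih =>
    cases h₂ with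
    | ite_true _ hp => obtain ⟨rfl, rfl, rfl⟩ := ih hp; exact ⟨rfl, rfl, rfl⟩
    | ite_false he' _ => exact absurd he he'
  | ite_false he _ ih =>
    cases h₂ with
    | ite_true he' _ => exact absurd he' he
    | ite_false _ hp => obtain ⟨rfl, rfl, rfl⟩ := ih hp; exact ⟨rfl, rfl, rfl⟩
  | loop_true he _ _ ihp ihl =>
    cases h₂ with
    | loop_true _ hp hl =>
      obtain ⟨rfl, rfl, rfl⟩ := ihp hp
      obtain ⟨rfl, rfl, rfl⟩ := ihl hl
      exact ⟨rfl, rfl, rfl⟩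
    | loop_false he' => exact absurd he he'
  | loop_false he =>
    cases h₂ with
    | loop_true he' _ _ => exact absurd he' he
    | loop_false _ => exact ⟨rfl, rfl, rfl⟩

/-- The memory at the start: the input in cells `0, 1, 2, …` of array `0`, zero elsewhere. -/
def inputMem (x : List ℤ) : Mem := fun a i =>
  if a = 0 ∧ 0 ≤ i then x.getD i.toNat 0 else 0

/-- On input `x` with coin tosses `r`, the program `p` halts within time `T` with a memory that
satisfies `Good`. -/
def HaltsWith (p : Program) (x : List ℤ) (r : List Bool) (T : ℕ) (Good : Mem → Prop) : Prop :=
  ∃ t ≤ T, ∃ (σ : Mem) (r' : List Bool), Exec p (inputMem x) r t σ r' ∧ Good σ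

open scoped Classical in
/-- The probability, over `T` independent fair coin tosses, that `p` halts on input `x` within time
`T` with a memory that satisfies `Good`. (Within time `T` at most `T` coins are tossed.) -/
noncomputable def successProb (p : Program) (x : List ℤ) (T : ℕ) (Good : Mem → Prop) : ℝ :=
  ((Finset.univ.filter fun r : Fin T → Bool => HaltsWith p x (List.ofFn r) T Good).card : ℝ) / 2 ^ T

/-! ### Explicitly given games as inputs of programs -/

/-- An explicitly given game: `n` players, `m` resources, rational weights and coefficients, and for
every player the list of her strategies. -/
structure GameInstance (d : ℕ) where
  n : ℕ
  m : ℕ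
  weight : Fin n → ℚ
  numStrategies : Fin n → ℕ
  strategy : (i : Fin n) → Fin (numStrategies i) → Finset (Fin m)
  coeff : Fin m → Fin (d + 1) → ℚ
  weight_pos : ∀ i, 0 < weight i
  numStrategies_pos : ∀ i, 0 < numStrategies i
  coeff_nonneg : ∀ e k, 0 ≤ coeff e k

namespace GameInstance

variable {d : ℕ}

/-- The game described by `G`; the cost function of `e` is `x ↦ ∑ k ≤ d, coeff e k * x ^ k`. -/
noncomputable def toGame (G : GameInstance d) : CongestionGame (Fin G.n) (Fin G.m) d where
  weight i := (G.weight i : ℝ)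
  strategies i := Finset.univ.image (G.strategy i)
  cost e := ∑ k : Fin (d + 1), Polynomial.monomial (k : ℕ) (G.coeff e k : ℝ)
  weight_pos i := by exact_mod_cast G.weight_pos i
  strategies_nonempty i := by
    have : Nonempty (Fin (G.numStrategies i)) := ⟨⟨0, G.numStrategies_pos i⟩⟩
    exact Finset.univ_nonempty.image _
  cost_degree e := by
    refine Polynomial.natDegree_sum_le_of_forall_le _ _ fun k _ => ?_
    exact (Polynomial.natDegree_monomial_le _).trans (Nat.lt_succ_iff.mp k.2)
  cost_coeff_nonneg e k := by
    rw [Polynomial.finsetSum_coeff]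
    refine Finset.sum_nonneg fun j _ => ?_
    rw [Polynomial.coeff_monomial]
    split_ifs
    · exact_mod_cast G.coeff_nonneg e j
    · exact le_rfl

/-- The input: `n`, `m`; for each player numerator and denominator of her weight, her number of
strategies and the characteristic vectors of her strategies; for each resource numerators and
denominators of the coefficients of its cost function. -/
def encode (G : GameInstance d) : List ℤ :=
  [(G.n : ℤ), (G.m : ℤ)]
  ++ (List.finRange G.n).flatMap (fun i =>
      [(G.weight i).num, ((G.weight i).den : ℤ), (G.numStrategies i : ℤ)]
      ++ (List.finRange (G.numStrategies i)).flatMap (fun s =>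
          (List.finRange G.m).map (fun e => if e ∈ G.strategy i s then (1 : ℤ) else 0)))
  ++ (List.finRange G.m).flatMap (fun e =>
      (List.finRange (d + 1)).flatMap (fun k =>
        [(G.coeff e k).num, ((G.coeff e k).den : ℤ)]))

/-- The length of the input in bits. -/
def size (G : GameInstance d) : ℕ := (G.encode.map bitLength).sum

/-- The memory `σ` holds an `α`-approximate pure Nash equilibrium of `G` as output: cell `i` of
array `1` is the position, in the list of strategies of player `i`, of the strategy she plays. -/
def OutputsApproxPNE (G : GameInstance d) (α : ℝ) (σ : Mem) : Prop :=
  ∃ s : (i : Fin G.n) → Fin (G.numStrategies i),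
    (∀ i : Fin G.n, σ 1 ((i : ℕ) : ℤ) = ((s i : ℕ) : ℤ)) ∧
      G.toGame.IsApproxPNE α (fun i => G.strategy i (s i))

end GameInstance

/-! The program behind the proof tosses no coins and succeeds with probability one. It never
evaluates a Shapley share. The share of a player on a resource is at most her marginal cost there,
the increase of `C_e` when she joins last, and at least `1 / (d + 1)` of it (`shapleyShare_le`,
`le_shapleyShare`). So it suffices to find an approximate equilibrium for marginal costs, at the
price of a factor `d + 1`. For marginal costs the total cost `pot` is an exact potential
(`pot_update`), and convexity makes it supermodular in the set of players present.

The program works in phases with thresholds `b` that fall by a factor of at least `g = K n + 2`. In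
a phase, players not yet fixed make moves that improve by about `b / g`; those whose cost is at
least `b` must also improve by a factor `p`. When no such move is left, the players of cost at least
`b` are fixed for good. Costs are scaled to integers and thresholds are integral, so `b = 0` is
reached after logarithmically many phases, and then the players who are still free have no improving
deviation at all.

Everything rests on one inequality (`IsCost.smooth`), with factors `κ = a ^ (-d) < 2` and `λ = (1 -
a) ^ (-d)`. Let `Φ₀` and `Φ₁` be the part of the potential due to the players who move in a phase,
before and after it. Before it they are within `b` of best replies, so smoothness gives `(2 - κ) Φ₀
≤ λ Φ₁ + n b`. Charging each mover for her last move (`Moves.ledger`) gives `p Φ₁ ≤ p n b + Φ₀`. For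
`p ≥ 2 λ / (2 - κ)` these yield `Φ₀ ≤ τ n b` (`Moves.pot_start_le`). This has two consequences. A
phase has at most `τ n g` moves (`Moves.count_le`). And the players who move after `i` was fixed at
threshold `b₀` carry a potential of at most about `τ n b₀ / g`, which is small compared with the
cost of `i`; so her near-optimality survives up to constants (`PhaseInv.next`, `PhaseInv.approx`),
with final factor `8 p`.

The choice `a = 2 ^ (-1 / (d + 1))` makes `p` of order `(d + 1) (d / ln 2) ^ d`. The remaining work
is a small program logic that bounds running times through the loop depth and the size of the stored
numbers. -/

/-! ### Cost functions of polynomial growth -/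

/-- The properties of polynomials of degree at most `d + 1` with non-negative coefficients and
without constant term which the analysis needs. -/
structure IsCost (d : ℕ) (C : ℝ → ℝ) : Prop where
  zero : C 0 = 0
  convex : ConvexOn ℝ (Set.Ici 0) C
  mono : MonotoneOn C (Set.Ici 0)
  scale : ∀ {t x y : ℝ}, 1 ≤ t → 0 ≤ x → x ≤ y →
    C (t * y) - C (t * x) ≤ t ^ (d + 1) * (C y - C x)

namespace IsCost

variable {d : ℕ} {C : ℝ → ℝ}

theorem le (h : IsCost d C) {x y : ℝ} (hx : 0 ≤ x) (hxy : x ≤ y) : C x ≤ C y :=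
  h.mono hx (hx.trans hxy) hxy

/-- The points `x + z` and `y` are mirror-image convex combinations of `x` and `y + z`; the two
convexity inequalities are added. -/
theorem diff_mono (h : IsCost d C) {x y z : ℝ} (hx : 0 ≤ x) (hxy : x ≤ y) (hz : 0 ≤ z) :
    C (x + z) - C x ≤ C (y + z) - C y := by
  rcases hz.eq_or_lt with rfl | hz
  · simp
  have hl : 0 < y + z - x := by linarith
  have h1 := h.convex.2 (show x ∈ Set.Ici 0 from hx)
    (show y + z ∈ Set.Ici 0 from (show (0 : ℝ) ≤ y + z by linarith))
    (show 0 ≤ (y - x) / (y + z - x) from div_nonneg (by linarith) hl.le)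
    (show 0 ≤ z / (y + z - x) from div_nonneg hz.le hl.le) (by field_simp; ring)
  have h2 := h.convex.2 (show x ∈ Set.Ici 0 from hx)
    (show y + z ∈ Set.Ici 0 from (show (0 : ℝ) ≤ y + z by linarith))
    (show 0 ≤ z / (y + z - x) from div_nonneg hz.le hl.le)
    (show 0 ≤ (y - x) / (y + z - x) from div_nonneg (by linarith) hl.le) (by field_simp; ring)
  have e1 : ((y - x) / (y + z - x)) • x + (z / (y + z - x)) • (y + z) = x + z := by
    simp only [smul_eq_mul]; field_simp; ring
  have e2 : (z / (y + z - x)) • x + ((y - x) / (y + z - x)) • (y + z) = y := by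
    simp only [smul_eq_mul]; field_simp; ring
  rw [e1] at h1
  rw [e2] at h2
  have e3 : (y - x) / (y + z - x) + z / (y + z - x) = 1 := by field_simp; ring
  simp only [smul_eq_mul] at h1 h2
  have : (y - x) / (y + z - x) * C x + z / (y + z - x) * C (y + z)
      + (z / (y + z - x) * C x + (y - x) / (y + z - x) * C (y + z)) = C x + C (y + z) := by
    calc _ = ((y - x) / (y + z - x) + z / (y + z - x)) * (C x + C (y + z)) := by ring
      _ = _ := by rw [e3, one_mul]
  linarith

/-- By convexity, an increment of length `t * x` only grows when its start moves from `f` to `t *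
f`; there `scale` applies. -/
theorem growth (h : IsCost d C) {t f x : ℝ} (ht : 1 ≤ t) (hf : 0 ≤ f) (hx : 0 ≤ x) :
    C (f + t * x) - C f ≤ t ^ (d + 1) * (C (f + x) - C f) := by
  have h1 := h.diff_mono hf (show f ≤ t * f by nlinarith) (show 0 ≤ t * x by positivity)
  have h2 := h.scale ht hf (show f ≤ f + x by linarith)
  rw [mul_add] at h2
  linarith

/-- The point `f + x + y` is the convex combination of `f + x / a` and `f + y / (1 - a)` with
weights `a` and `1 - a`. Each application of `growth` costs a power `d + 1`, and the weight gives
one power back. -/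
theorem smooth (h : IsCost d C) {a f x y : ℝ} (ha : 0 < a) (ha1 : a < 1) (hf : 0 ≤ f)
    (hx : 0 ≤ x) (hy : 0 ≤ y) :
    C (f + x + y) - C f
      ≤ (a ^ d)⁻¹ * (C (f + x) - C f) + ((1 - a) ^ d)⁻¹ * (C (f + y) - C f) := by
  have hb : 0 < 1 - a := by linarith
  have hc := h.convex.2 (show f + a⁻¹ * x ∈ Set.Ici 0 from (show (0 : ℝ) ≤ _ by positivity))
    (show f + (1 - a)⁻¹ * y ∈ Set.Ici 0 from (show (0 : ℝ) ≤ _ by positivity)) ha.le hb.le (by ring)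
  have e : a • (f + a⁻¹ * x) + (1 - a) • (f + (1 - a)⁻¹ * y) = f + x + y := by
    simp only [smul_eq_mul]; field_simp; ring
  rw [e] at hc
  simp only [smul_eq_mul] at hc
  have g1 := mul_le_mul_of_nonneg_left (h.growth (one_le_inv₀ ha |>.2 ha1.le) hf hx) ha.le
  have g2 := mul_le_mul_of_nonneg_left
    (h.growth (one_le_inv₀ hb |>.2 (by linarith)) hf hy) hb.le
  have e1 : a * (a⁻¹ ^ (d + 1) * (C (f + x) - C f)) = (a ^ d)⁻¹ * (C (f + x) - C f) := by
    rw [pow_succ, inv_pow]; field_simp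
  have e2 : (1 - a) * ((1 - a)⁻¹ ^ (d + 1) * (C (f + y) - C f))
      = ((1 - a) ^ d)⁻¹ * (C (f + y) - C f) := by
    rw [pow_succ, inv_pow]; field_simp
  rw [e1] at g1
  rw [e2] at g2
  linarith

/-- For `t > 0` the point `t * (x + w)` divides the interval from `t * x` to `t * x + w` in the
ratio `t`, so convexity bounds the increment up to it by `t` times the whole; `scale` with factor `1
/ t` compares it with the increment from `x` to `x + w`. -/
theorem marginal_scale (h : IsCost d C) {t x w : ℝ} (ht : 0 ≤ t) (ht1 : t ≤ 1) (hx : 0 ≤ x)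
    (hw : 0 ≤ w) : t ^ d * (C (x + w) - C x) ≤ C (t * x + w) - C (t * x) := by
  rcases ht.eq_or_lt with rfl | ht
  · rcases Nat.eq_zero_or_pos d with rfl | hd
    · simp only [pow_zero, one_mul, zero_mul, zero_add, h.zero, sub_zero]
      rcases hx.eq_or_lt with rfl | hx
      · simp [h.zero]
      rcases hw.eq_or_lt with rfl | hw
      · simp [h.zero]
      -- Since `0 ^ 0 = 1`, the claim here is subadditivity. For `d = 0` growth is linear, so `C (x
      -- + w)` can be compared with both `C w` and `C x`.
      have h1 := h.scale (t := (x + w) / w) (x := 0) (y := w)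
        ((one_le_div hw).2 (by linarith)) le_rfl hw.le
      have h2 := h.scale (t := (x + w) / x) (x := 0) (y := x)
        ((one_le_div hx).2 (by linarith)) le_rfl hx.le
      simp only [mul_zero, h.zero, sub_zero, zero_add, pow_one] at h1 h2
      rw [div_mul_cancel₀ _ hw.ne', div_mul_eq_mul_div, le_div_iff₀ hw] at h1
      rw [div_mul_cancel₀ _ hx.ne', div_mul_eq_mul_div, le_div_iff₀ hx] at h2
      have : (x + w) * (C (x + w) - C x - C w) ≤ 0 := by linarith
      by_contra hc
      push Not at hc
      nlinarith
    · rw [zero_pow hd.ne', zero_mul]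
      exact sub_nonneg.2 (h.le (by simp) (by linarith))
  · have ht' : 1 ≤ t⁻¹ := (one_le_inv₀ ht).2 ht1
    have hc := h.convex.2 (show t * x ∈ Set.Ici 0 from (show (0 : ℝ) ≤ _ by positivity))
      (show t * x + w ∈ Set.Ici 0 from (show (0 : ℝ) ≤ _ by positivity))
      (show 0 ≤ 1 - t by linarith) ht.le (by ring)
    have e : (1 - t) • (t * x) + t • (t * x + w) = t * (x + w) := by
      simp only [smul_eq_mul]; ring
    rw [e] at hc
    simp only [smul_eq_mul] at hc
    have hs := h.scale (t := t⁻¹) (x := t * x) (y := t * (x + w)) ht' (by positivity)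
      (by nlinarith)
    rw [inv_mul_cancel_left₀ ht.ne', inv_mul_cancel_left₀ ht.ne', inv_pow, inv_mul_eq_div,
      le_div_iff₀ (by positivity)] at hs
    have : t * (t ^ d * (C (x + w) - C x)) ≤ t * (C (t * x + w) - C (t * x)) := by
      rw [pow_succ] at hs
      nlinarith
    exact le_of_mul_le_mul_left this ht

theorem sum {ι : Type*} (s : Finset ι) {c : ι → ℝ → ℝ} (h : ∀ i ∈ s, IsCost d (c i)) :
    IsCost d fun x => ∑ i ∈ s, c i x where
  zero := Finset.sum_eq_zero fun i hi => (h i hi).zero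
  convex := by
    refine ⟨convex_Ici 0, fun x hx y hy a b ha hb hab => ?_⟩
    simp only [Finset.smul_sum, ← Finset.sum_add_distrib]
    exact Finset.sum_le_sum fun i hi => (h i hi).convex.2 hx hy ha hb hab
  mono := fun x hx y hy hxy => Finset.sum_le_sum fun i hi => (h i hi).mono hx hy hxy
  scale := fun ht hx hxy => by
    simp only [← Finset.sum_sub_distrib, Finset.mul_sum]
    exact Finset.sum_le_sum fun i hi => (h i hi).scale ht hx hxy

theorem monomial {k : ℕ} (hk : k ≤ d) {a : ℝ} (ha : 0 ≤ a) :
    IsCost d fun x => a * x ^ (k + 1) where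
  zero := by simp
  convex := by simpa using (convexOn_pow (k + 1)).smul ha
  mono := fun x hx y hy hxy => by
    have : (0 : ℝ) ≤ x := hx
    dsimp only
    gcongr
  scale := fun {t x y} ht hx hxy => by
    have h1 : 0 ≤ a * (y ^ (k + 1) - x ^ (k + 1)) :=
      mul_nonneg ha (sub_nonneg.2 (pow_le_pow_left₀ hx hxy _))
    have h2 : t ^ (k + 1) ≤ t ^ (d + 1) := pow_le_pow_right₀ ht (by omega)
    have := mul_le_mul_of_nonneg_right h2 h1
    rw [mul_pow, mul_pow]
    linarith

theorem polynomial (a : ℕ → ℝ) (ha : ∀ k, 0 ≤ a k) :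
    IsCost d fun x => ∑ k ∈ Finset.range (d + 1), a k * x ^ (k + 1) :=
  sum _ fun k hk => monomial (Nat.lt_succ_iff.1 (Finset.mem_range.1 hk)) (ha k)

end IsCost

/-! ### The potential of marginal cost sharing -/

section Potential

variable {N E : Type} [DecidableEq E]

/-- The load of the resource `e` in the outcome `P`, counting only the players in `S`. -/
def load (w : N → ℝ) (P : N → Finset E) (S : Finset N) (e : E) : ℝ :=
  ∑ i ∈ S, if e ∈ P i then w i else 0

variable {w : N → ℝ} {P P' : N → Finset E}

theorem load_nonneg (hw : ∀ i, 0 ≤ w i) (S : Finset N) (e : E) : 0 ≤ load w P S e :=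
  Finset.sum_nonneg fun i _ => by split_ifs <;> simp [hw]

theorem load_mono (hw : ∀ i, 0 ≤ w i) {S T : Finset N} (h : S ⊆ T) (e : E) :
    load w P S e ≤ load w P T e :=
  Finset.sum_le_sum_of_subset_of_nonneg h fun i _ _ => by split_ifs <;> simp [hw]

theorem load_congr {S : Finset N} (h : ∀ i ∈ S, P i = P' i) (e : E) :
    load w P S e = load w P' S e :=
  Finset.sum_congr rfl fun i hi => by rw [h i hi]

variable [Fintype E]

/-- The total cost of the outcome `P` when only the players in `S` are present. -/
def pot (w : N → ℝ) (C : E → ℝ → ℝ) (P : N → Finset E) (S : Finset N) : ℝ :=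
  ∑ e, C e (load w P S e)

variable {C : E → ℝ → ℝ} {d : ℕ}

theorem pot_congr {S : Finset N} (h : ∀ i ∈ S, P i = P' i) : pot w C P S = pot w C P' S := by
  simp only [pot, load_congr h]

theorem pot_mono (hw : ∀ i, 0 ≤ w i) (hC : ∀ e, IsCost d (C e)) {S T : Finset N} (h : S ⊆ T) :
    pot w C P S ≤ pot w C P T :=
  Finset.sum_le_sum fun e _ => (hC e).le (load_nonneg hw S e) (load_mono hw h e)

variable [DecidableEq N]

omit [Fintype E] in
theorem load_union {S J : Finset N} (h : Disjoint S J) (e : E) :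
    load w P (S ∪ J) e = load w P S e + load w P J e :=
  Finset.sum_union h

omit [Fintype E] in
theorem load_insert {S : Finset N} {i : N} (h : i ∉ S) (e : E) :
    load w P (insert i S) e = load w P S e + if e ∈ P i then w i else 0 := by
  rw [load, Finset.sum_insert h, add_comm, load]

/-- Convexity on each resource: the load of `J` costs more on top of a larger load. -/
theorem pot_supermodular (hw : ∀ i, 0 ≤ w i) (hC : ∀ e, IsCost d (C e)) {S T J : Finset N}
    (h : S ⊆ T) (hJ : Disjoint T J) :
    pot w C P (S ∪ J) - pot w C P S ≤ pot w C P (T ∪ J) - pot w C P T := by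
  simp only [pot, ← Finset.sum_sub_distrib, load_union hJ, load_union (hJ.mono_left h)]
  exact Finset.sum_le_sum fun e _ =>
    (hC e).diff_mono (load_nonneg hw S e) (load_mono hw h e) (load_nonneg hw J e)

theorem pot_supermodular_insert (hw : ∀ i, 0 ≤ w i) (hC : ∀ e, IsCost d (C e)) {S T : Finset N}
    {i : N} (h : S ⊆ T) (hi : i ∉ T) :
    pot w C P (insert i S) - pot w C P S ≤ pot w C P (insert i T) - pot w C P T := by
  have := pot_supermodular (P := P) hw hC h (Finset.disjoint_singleton_right.2 hi)
  rwa [Finset.union_comm S, Finset.union_comm T, ← Finset.insert_eq, ← Finset.insert_eq] at this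

theorem pot_update_insert {S : Finset N} {i : N} (hi : i ∉ S)
    (Q : Finset E) :
    pot w C (Function.update P i Q) (insert i S) - pot w C P S
      = ∑ e ∈ Q, (C e (load w P S e + w i) - C e (load w P S e)) := by
  have hc : ∀ e, load w (Function.update P i Q) S e = load w P S e := fun e =>
    load_congr (fun j hj => Function.update_of_ne (ne_of_mem_of_not_mem hj hi) _ _) e
  simp only [pot, ← Finset.sum_sub_distrib, load_insert hi, hc, Function.update_self]
  rw [← Finset.sum_subset (Finset.subset_univ Q)]
  · exact Finset.sum_congr rfl fun e he => by rw [if_pos he]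
  · intro e _ he
    rw [if_neg he, add_zero, sub_self]

variable [Fintype N]

/-- The marginal cost of player `i` if she plays `Q` against `P`. -/
def devCost (w : N → ℝ) (C : E → ℝ → ℝ) (P : N → Finset E) (i : N) (Q : Finset E) : ℝ :=
  pot w C (Function.update P i Q) Finset.univ - pot w C P (Finset.univ.erase i)

theorem devCost_eq_sum (i : N) (Q : Finset E) :
    devCost w C P i Q = ∑ e ∈ Q, (C e (load w P (Finset.univ.erase i) e + w i)
      - C e (load w P (Finset.univ.erase i) e)) := by
  rw [← pot_update_insert (Finset.notMem_erase i _), Finset.insert_erase (Finset.mem_univ i),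
    devCost]

theorem devCost_self (i : N) : devCost w C P i (P i)
    = pot w C P Finset.univ - pot w C P (Finset.univ.erase i) := by
  rw [devCost, Function.update_eq_self]

theorem devCost_nonneg (hw : ∀ i, 0 ≤ w i) (hC : ∀ e, IsCost d (C e)) (i : N) (Q : Finset E) :
    0 ≤ devCost w C P i Q := by
  rw [devCost_eq_sum]
  exact Finset.sum_nonneg fun e _ => sub_nonneg.2
    ((hC e).le (load_nonneg hw _ e) (by linarith [hw i]))

/-- Exactness of the potential: both marginal costs subtract the same total cost without player `i`.
-/
theorem pot_update (i : N) (Q : Finset E) : pot w C (Function.update P i Q) Finset.univ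
    = pot w C P Finset.univ - (devCost w C P i (P i) - devCost w C P i Q) := by
  rw [devCost_self, devCost]; ring

/-- When the players of `R` join the others one at a time, each adds at most her marginal cost
against everybody else. -/
theorem pot_sub_compl_le_sum (hw : ∀ i, 0 ≤ w i) (hC : ∀ e, IsCost d (C e)) (R : Finset N) :
    pot w C P Finset.univ - pot w C P Rᶜ ≤ ∑ i ∈ R, devCost w C P i (P i) := by
  induction R using Finset.induction_on with
  | empty => simp
  | insert i R hi ih =>
    rw [Finset.sum_insert hi, devCost_self]
    have := pot_supermodular_insert (P := P) (i := i) hw hC (S := (insert i R)ᶜ)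
      (T := Finset.univ.erase i) (fun j hj => by simp_all) (by simp)
    rw [Finset.insert_erase (Finset.mem_univ i)] at this
    have e : insert i (insert i R)ᶜ = Rᶜ := by
      ext j; by_cases hj : j = i <;> simp_all
    rw [e] at this
    linarith

omit [Fintype N] in
theorem IsCost.sum_diff_le {c : ℝ → ℝ} (h : IsCost d c) {x : ℝ} (hx : 0 ≤ x) {u : N → ℝ}
    (hu : ∀ i, 0 ≤ u i) (R : Finset N) :
    ∑ i ∈ R, (c (x + u i) - c x) ≤ c (x + ∑ i ∈ R, u i) - c x := by
  induction R using Finset.induction_on with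
  | empty => simp
  | insert i R hi ih =>
    have hs : 0 ≤ ∑ i ∈ R, u i := Finset.sum_nonneg fun i _ => hu i
    rw [Finset.sum_insert hi, Finset.sum_insert hi]
    have := h.diff_mono hx (show x ≤ x + ∑ i ∈ R, u i by linarith) (hu i)
    rw [add_assoc x, add_comm (∑ i ∈ R, u i) (u i)] at this
    linarith

/-- Marginal costs only grow when measured on top of the full load of `P`, and separate increments
over one base sum to at most the joint increment. -/
theorem sum_devCost_le (hw : ∀ i, 0 ≤ w i) (hC : ∀ e, IsCost d (C e)) (R : Finset N) :
    ∑ i ∈ R, devCost w C P i (P' i)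
      ≤ ∑ e, (C e (load w P Finset.univ e + load w P' R e) - C e (load w P Finset.univ e)) := by
  have h1 : ∀ i, devCost w C P i (P' i) ≤ ∑ e, (C e (load w P Finset.univ e
      + if e ∈ P' i then w i else 0) - C e (load w P Finset.univ e)) := by
    intro i
    rw [devCost_eq_sum, ← Finset.sum_subset (Finset.subset_univ (P' i))
      (fun e _ he => by rw [if_neg he, add_zero, sub_self])]
    refine Finset.sum_le_sum fun e he => ?_
    rw [if_pos he]
    exact (hC e).diff_mono (load_nonneg hw _ e) (load_mono hw (Finset.erase_subset _ _) e) (hw i)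
  refine (Finset.sum_le_sum fun i _ => h1 i).trans ?_
  rw [Finset.sum_comm]
  refine Finset.sum_le_sum fun e _ => ?_
  exact (hC e).sum_diff_le (load_nonneg hw _ e)
    (u := fun i => if e ∈ P' i then w i else 0) (fun i => by split_ifs <;> simp [hw]) R

/-- The smoothness inequality for the subgame of the players in `R`. -/
theorem sum_devCost_le_smooth (hw : ∀ i, 0 ≤ w i) (hC : ∀ e, IsCost d (C e)) {a : ℝ}
    (ha : 0 < a) (ha1 : a < 1) {R : Finset N} (h : ∀ i ∉ R, P' i = P i) :
    ∑ i ∈ R, devCost w C P i (P' i)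
      ≤ ((a ^ d)⁻¹ - 1) * (pot w C P Finset.univ - pot w C P Rᶜ)
        + ((1 - a) ^ d)⁻¹ * (pot w C P' Finset.univ - pot w C P' Rᶜ) := by
  refine (sum_devCost_le hw hC R).trans ?_
  have hu : ∀ (P : N → Finset E) e, load w P Finset.univ e = load w P Rᶜ e + load w P R e := by
    intro P e
    rw [← load_union (by exact disjoint_compl_left), Finset.union_comm, Finset.union_compl]
  have hc : ∀ e, load w P' Rᶜ e = load w P Rᶜ e := fun e =>
    load_congr (fun i hi => h i (by simpa using hi)) e
  simp only [pot, ← Finset.sum_sub_distrib, Finset.mul_sum, ← Finset.sum_add_distrib, hu, hc]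
  refine Finset.sum_le_sum fun e _ => ?_
  -- Subtracting the increment of `R` under `P` from both sides of `smooth` turns the factor `(a ^
  -- d)⁻¹` into `(a ^ d)⁻¹ - 1`.
  have := (hC e).smooth ha ha1 (load_nonneg (P := P) hw Rᶜ e) (load_nonneg (P := P) hw R e)
    (load_nonneg (P := P') hw R e)
  linarith

end Potential

/-! ### Sequences of moves -/

section Moves

variable {N E : Type} [DecidableEq N] [DecidableEq E] [Fintype N] [Fintype E]

/-- The parameters of a phase: the players in `F` are fixed, players whose cost is below `b` make
moves that improve by `β`, the others only if they also improve by a factor `p`. -/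
def Allowed (w : N → ℝ) (C : E → ℝ → ℝ) (F : Finset N) (p b β : ℝ) (P : N → Finset E) (i : N)
    (Q : Finset E) : Prop :=
  i ∉ F ∧ devCost w C P i Q + β ≤ devCost w C P i (P i) ∧
    (devCost w C P i (P i) < b ∨ p * devCost w C P i Q < devCost w C P i (P i))

/-- `Moves … P₀ P R c`: the outcome `P` arises from `P₀` by `c` allowed moves of players in `R`. -/
inductive Moves (w : N → ℝ) (C : E → ℝ → ℝ) (𝒮 : N → Set (Finset E)) (F : Finset N) (p b β : ℝ)
    (P₀ : N → Finset E) : (N → Finset E) → Finset N → ℕ → Prop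
  | refl : Moves w C 𝒮 F p b β P₀ P₀ ∅ 0
  | step {P R c i Q} (h : Moves w C 𝒮 F p b β P₀ P R c) (hQ : Q ∈ 𝒮 i)
      (ha : Allowed w C F p b β P i Q) :
      Moves w C 𝒮 F p b β P₀ (Function.update P i Q) (insert i R) (c + 1)

variable {w : N → ℝ} {C : E → ℝ → ℝ} {𝒮 : N → Set (Finset E)} {F : Finset N} {p b β : ℝ}
  {P₀ P : N → Finset E} {R : Finset N} {c d : ℕ}

namespace Moves

theorem agree (h : Moves w C 𝒮 F p b β P₀ P R c) : ∀ i ∉ R, P i = P₀ i := by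
  induction h with
  | refl => simp
  | @step P R c i Q h hQ ha ih =>
    intro j hj
    rw [Finset.mem_insert, not_or] at hj
    rw [Function.update_of_ne hj.1, ih j hj.2]

theorem disjoint (h : Moves w C 𝒮 F p b β P₀ P R c) : Disjoint R F := by
  induction h with
  | refl => simp
  | step h hQ ha ih => exact Finset.disjoint_insert_left.2 ⟨ha.1, ih⟩

theorem mem (h : Moves w C 𝒮 F p b β P₀ P R c) : ∀ i ∈ R, P i ∈ 𝒮 i := by
  induction h with
  | refl => simp
  | @step P R c i Q h hQ ha ih =>
    intro j hj
    rcases eq_or_ne j i with rfl | hne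
    · rwa [Function.update_self]
    · rw [Function.update_of_ne hne]
      exact ih j ((Finset.mem_insert.1 hj).resolve_left hne)

theorem mem_all (h : Moves w C 𝒮 F p b β P₀ P R c) (h0 : ∀ i, P₀ i ∈ 𝒮 i) (i : N) :
    P i ∈ 𝒮 i := by
  by_cases hi : i ∈ R
  · exact h.mem i hi
  · rw [h.agree i hi]; exact h0 i

theorem pot_le (h : Moves w C 𝒮 F p b β P₀ P R c) :
    pot w C P Finset.univ + c * β ≤ pot w C P₀ Finset.univ := by
  induction h with
  | refl => simp
  | step h hQ ha ih =>
    rw [pot_update]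
    push_cast
    linarith [ha.2.1]

/-- The potential of the moving players is at most the sum of their costs after their last moves,
and these are small compared to `b` or to the improvements. -/
theorem ledger (hw : ∀ i, 0 ≤ w i) (hC : ∀ e, IsCost d (C e)) (hp : 1 ≤ p) (hβ : 0 ≤ β)
    (hb : 0 ≤ b)     (h : Moves w C 𝒮 F p b β P₀ P R c) :
    ∀ J ⊆ R, (p - 1) * (pot w C P (Rᶜ ∪ J) - pot w C P Rᶜ)
      ≤ (p - 1) * (J.card * b) + (pot w C P₀ Finset.univ - pot w C P Finset.univ) := by
  induction h with
  | refl =>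
    intro J hJ
    simp [Finset.subset_empty.1 hJ]
  | @step P R c i Q h hQ ha ih =>
    have hp' : 0 ≤ p - 1 := by linarith
    have hdrop : 0 ≤ devCost w C P i (P i) - devCost w C P i Q := by linarith [ha.2.1]
    -- A further mover shrinks the base `Rᶜ`, and over a smaller base the increment of `J` is
    -- smaller. Taking `J` without `i` discards the entry of an earlier move of `i`; this is why the
    -- statement ranges over all subsets `J`.
    have key : ∀ J ⊆ R.erase i, (p - 1) * (pot w C P ((insert i R)ᶜ ∪ J) - pot w C P (insert i R)ᶜ)
        ≤ (p - 1) * (J.card * b) + (pot w C P₀ Finset.univ - pot w C P Finset.univ) := by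
      intro J hJ
      refine le_trans (mul_le_mul_of_nonneg_left ?_ hp') (ih J (hJ.trans (Finset.erase_subset _ _)))
      refine pot_supermodular hw hC (fun j hj => by simp_all) ?_
      rw [Finset.disjoint_left]
      intro j hj hj'
      exact (Finset.mem_compl.1 hj) (Finset.mem_of_mem_erase (hJ hj'))
    have hcongr : ∀ J ⊆ R.erase i, pot w C (Function.update P i Q) ((insert i R)ᶜ ∪ J)
        = pot w C P ((insert i R)ᶜ ∪ J) := by
      intro J hJ
      refine pot_congr fun j hj => Function.update_of_ne ?_ _ _
      rintro rfl
      rcases Finset.mem_union.1 hj with hj | hj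
      · simp at hj
      · exact Finset.notMem_erase j R (hJ hj)
    have hcongr0 := hcongr ∅ (Finset.empty_subset _)
    rw [Finset.union_empty] at hcongr0
    intro J hJ
    rw [pot_update]
    by_cases hi : i ∈ J
    · have hJ' : J.erase i ⊆ R.erase i := fun j hj => by
        rw [Finset.mem_erase] at hj ⊢
        exact ⟨hj.1, (Finset.mem_insert.1 (hJ hj.2)).resolve_left hj.1⟩
      have k1 := key _ hJ'
      have hle : pot w C (Function.update P i Q) ((insert i R)ᶜ ∪ J)
          - pot w C (Function.update P i Q) ((insert i R)ᶜ ∪ J.erase i) ≤ devCost w C P i Q := by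
        have e1 : (insert i R)ᶜ ∪ J = insert i ((insert i R)ᶜ ∪ J.erase i) := by
          rw [← Finset.union_insert, Finset.insert_erase hi]
        have h1 := pot_supermodular_insert (P := Function.update P i Q) (i := i) hw hC
          (S := (insert i R)ᶜ ∪ J.erase i) (T := Finset.univ.erase i)
          (fun j hj => by
            rcases Finset.mem_union.1 hj with hj | hj
            · simp_all
            · simpa using Finset.ne_of_mem_erase hj) (by simp)
        rw [Finset.insert_erase (Finset.mem_univ i), ← e1] at h1
        have e2 : pot w C (Function.update P i Q) (Finset.univ.erase i)
            = pot w C P (Finset.univ.erase i) :=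
          pot_congr fun j hj => Function.update_of_ne (Finset.ne_of_mem_erase hj) _ _
        rw [e2] at h1
        exact h1
      rw [hcongr _ hJ'] at hle
      rw [hcongr0]
      -- Either the cost was below `b` before the move and so is afterwards, or the factor `p`
      -- bounds `p - 1` times the new cost by the improvement, which is the drop of the potential.
      have hcost : (p - 1) * devCost w C P i Q
          ≤ (p - 1) * b + (devCost w C P i (P i) - devCost w C P i Q) := by
        rcases ha.2.2 with hX | hX
        · have : (p - 1) * devCost w C P i Q ≤ (p - 1) * b :=
            mul_le_mul_of_nonneg_left (by linarith) hp'
          linarith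
        · have : 0 ≤ (p - 1) * b := mul_nonneg hp' hb
          linarith
      have hc : ((J.erase i).card : ℝ) = J.card - 1 := by
        rw [Finset.card_erase_of_mem hi, Nat.cast_sub (Finset.card_pos.2 ⟨i, hi⟩), Nat.cast_one]
      rw [hc] at k1
      have := mul_le_mul_of_nonneg_left hle hp'
      linarith
    · have hJ' : J ⊆ R.erase i := fun j hj =>
        Finset.mem_erase.2 ⟨fun h => hi (h ▸ hj),
          (Finset.mem_insert.1 (hJ hj)).resolve_left fun h => hi (h ▸ hj)⟩
      rw [hcongr _ hJ', hcongr0]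
      linarith [key _ hJ']

end Moves

/-- The constants of the algorithm: the smoothness inequality holds with the factors `(a ^ d)⁻¹` and
`((1 - a) ^ d)⁻¹`, and `p`, `τ`, `K` are large enough in terms of these. -/
structure Params (d : ℕ) where
  a : ℝ
  p : ℕ
  τ : ℕ
  K : ℕ
  a_pos : 0 < a
  a_lt_one : a < 1
  lt_two : (a ^ d)⁻¹ < 2
  one_le_p : 1 ≤ p
  le_p : 2 * ((1 - a) ^ d)⁻¹ ≤ (2 - (a ^ d)⁻¹) * p
  le_τ : 2 * (((1 - a) ^ d)⁻¹ + 1) ≤ (2 - (a ^ d)⁻¹) * τ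
  le_K : 4 * ((1 - a) ^ d)⁻¹ * p * τ ≤ K

namespace Params

theorem one_le_lam (pr : Params d) : 1 ≤ ((1 - pr.a) ^ d)⁻¹ := by
  have h1 := pr.a_lt_one
  have h2 := pr.a_pos
  exact one_le_inv₀ (pow_pos (by linarith) d) |>.2 (pow_le_one₀ (by linarith) (by linarith))

/-- The ratio of consecutive thresholds. -/
def ratio (pr : Params d) (n : ℕ) : ℕ := pr.K * n + 2

end Params

/-- Two linear inequalities link the potentials `Φ₀`, `Φ₁` of the movers before and after the phase:
near-optimality at the start with smoothness bounds `Φ₀` by `Φ₁`, and the ledger bounds `Φ₁` by `Φ₀`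
with a factor `1 / p`. For large `p` the loop contracts. -/
theorem Moves.pot_start_le (hw : ∀ i, 0 ≤ w i) (hC : ∀ e, IsCost d (C e)) (pr : Params d)
    (hβ : 0 ≤ β) (hb : 0 ≤ b) (h : Moves w C 𝒮 F pr.p b β P₀ P R c)
    (h0 : ∀ i ∉ F, ∀ Q ∈ 𝒮 i, devCost w C P₀ i (P₀ i) ≤ devCost w C P₀ i Q + b) :
    pot w C P₀ Finset.univ - pot w C P₀ Rᶜ ≤ pr.τ * Fintype.card N * b := by
  have hp : (1 : ℝ) ≤ pr.p := by exact_mod_cast pr.one_le_p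
  have hlam := pr.one_le_lam
  have h2 := pr.lt_two
  have hlp := pr.le_p
  have hlτ := pr.le_τ
  set lam := ((1 - pr.a) ^ d)⁻¹
  set κ := (pr.a ^ d)⁻¹
  have hR : (R.card : ℝ) * b ≤ Fintype.card N * b :=
    mul_le_mul_of_nonneg_right (by exact_mod_cast Finset.card_le_univ R) hb
  have hnb : 0 ≤ Fintype.card N * b := by positivity
  have l1 := h.ledger hw hC hp hβ hb R subset_rfl
  rw [Finset.union_comm, Finset.union_compl] at l1
  have l2 := pot_sub_compl_le_sum (P := P₀) hw hC R
  have l3 : ∑ i ∈ R, devCost w C P₀ i (P₀ i) ≤ ∑ i ∈ R, devCost w C P₀ i (P i) + R.card * b := by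
    rw [← nsmul_eq_mul, ← Finset.sum_const, ← Finset.sum_add_distrib]
    exact Finset.sum_le_sum fun i hi =>
      h0 i (Finset.disjoint_left.1 h.disjoint hi) _ (h.mem i hi)
  have l4 := sum_devCost_le_smooth hw hC pr.a_pos pr.a_lt_one h.agree
  have l5 : pot w C P Rᶜ = pot w C P₀ Rᶜ := pot_congr fun i hi => h.agree i (by simpa using hi)
  change _ ≤ (κ - 1) * _ + lam * _ at l4
  rw [l5] at l1 l4
  have hΦ : 0 ≤ pot w C P₀ Finset.univ - pot w C P₀ Rᶜ :=
    sub_nonneg.2 (pot_mono hw hC (Finset.subset_univ _))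
  obtain ⟨Φ₀, hΦ₀⟩ : ∃ Φ₀, Φ₀ = pot w C P₀ Finset.univ - pot w C P₀ Rᶜ := ⟨_, rfl⟩
  obtain ⟨Φ₁, hΦ₁⟩ : ∃ Φ₁, Φ₁ = pot w C P Finset.univ - pot w C P₀ Rᶜ := ⟨_, rfl⟩
  have e : pot w C P₀ Finset.univ - pot w C P Finset.univ = Φ₀ - Φ₁ := by rw [hΦ₀, hΦ₁]; ring
  rw [e] at l1
  rw [← hΦ₀] at hΦ l2 l4 ⊢
  rw [← hΦ₁] at l1 l4
  rw [mul_assoc]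
  generalize (Fintype.card N : ℝ) * b = B at *
  have m1 : pr.p * Φ₁ ≤ pr.p * B + Φ₀ := by
    have := mul_le_mul_of_nonneg_left hR (show 0 ≤ (pr.p : ℝ) - 1 by linarith)
    linarith
  have m2 : (2 - κ) * Φ₀ ≤ lam * Φ₁ + B := by linarith
  have m3 := mul_le_mul_of_nonneg_left m2 (show (0 : ℝ) ≤ pr.p by linarith)
  have m4 := mul_le_mul_of_nonneg_left m1 (show 0 ≤ lam by linarith)
  -- By `le_p`, half of `p * (2 - κ) * Φ₀` absorbs `lam * Φ₀`; by `le_τ`, the multiples of `B` that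
  -- remain fit into the other half.
  have m5 := mul_le_mul_of_nonneg_right hlp hΦ
  have m6 := mul_le_mul_of_nonneg_left (mul_le_mul_of_nonneg_right hlτ hnb)
    (show (0 : ℝ) ≤ pr.p by linarith)
  have m7 : (pr.p * (2 - κ)) * Φ₀ ≤ (pr.p * (2 - κ)) * (pr.τ * B) := by linarith
  exact le_of_mul_le_mul_left m7 (mul_pos (by linarith) (by linarith))

/-- Each move lowers the potential by at least `β`, and no more than the initial potential of the
movers can be lost. -/
theorem Moves.count_le (hw : ∀ i, 0 ≤ w i) (hC : ∀ e, IsCost d (C e)) (pr : Params d)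
    (hβ : 0 < β) (hb : 0 ≤ b) (h : Moves w C 𝒮 F pr.p b β P₀ P R c)
    (h0 : ∀ i ∉ F, ∀ Q ∈ 𝒮 i, devCost w C P₀ i (P₀ i) ≤ devCost w C P₀ i Q + b)
    (hbβ : b ≤ pr.ratio (Fintype.card N) * β) :
    c ≤ pr.τ * Fintype.card N * pr.ratio (Fintype.card N) := by
  have h1 := h.pot_start_le hw hC pr hβ.le hb h0
  have h2 := h.pot_le
  have h3 : pot w C P Rᶜ = pot w C P₀ Rᶜ := pot_congr fun i hi => h.agree i (by simpa using hi)
  have h4 := pot_mono (P := P) hw hC (Finset.subset_univ Rᶜ)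
  have h5 : (pr.τ * Fintype.card N : ℝ) * b
      ≤ pr.τ * Fintype.card N * (pr.ratio (Fintype.card N) * β) :=
    mul_le_mul_of_nonneg_left hbβ (by positivity)
  have h6 : (c : ℝ) * β ≤ (pr.τ * Fintype.card N * pr.ratio (Fintype.card N) : ℝ) * β := by
    linarith
  exact_mod_cast le_of_mul_le_mul_right h6 hβ

/-! ### Fixed players and the invariant of the phases -/

/-- What remains true about a player `i` that was fixed in the outcome `P₀` with threshold `b₀`,
when afterwards the players in `A` have moved and the threshold is `b`. -/
structure FixRecord (w : N → ℝ) (C : E → ℝ → ℝ) (𝒮 : N → Set (Finset E)) (pr : Params d)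
    (P P₀ : N → Finset E) (A : Finset N) (b b₀ : ℝ) (i : N) : Prop where
  agree : ∀ j ∉ A, P j = P₀ j
  notMem : i ∉ A
  nonneg : 0 ≤ b₀
  le_cost : b₀ ≤ devCost w C P₀ i (P₀ i)
  cost_le : ∀ Q ∈ 𝒮 i, devCost w C P₀ i (P₀ i)
    ≤ pr.p * devCost w C P₀ i Q + b₀ / pr.ratio (Fintype.card N)
  pot_le : pot w C P Finset.univ ≤ pot w C P₀ Finset.univ
  -- The first term is the potential in `P₀` of those who have moved since; the second is a reserve
  -- for the coming phases. Thresholds at least halve, so the bounds `τ n b` of all coming phases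
  -- sum to at most twice the first of them.
  budget : pr.ratio (Fintype.card N) * (pot w C P₀ Finset.univ - pot w C P₀ Aᶜ)
    + 2 * pr.ratio (Fintype.card N) * (pr.τ * Fintype.card N * b)
      ≤ 2 * (pr.τ * Fintype.card N * b₀)

/-- The invariant of the algorithm at the start of the phase with threshold `b`. -/
structure PhaseInv (w : N → ℝ) (C : E → ℝ → ℝ) (𝒮 : N → Set (Finset E)) (pr : Params d)
    (P : N → Finset E) (F : Finset N) (b : ℝ) : Prop where
  mem : ∀ i, P i ∈ 𝒮 i
  free : ∀ i ∉ F, ∀ Q ∈ 𝒮 i, devCost w C P i (P i) ≤ devCost w C P i Q + b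
  fixed : ∀ i ∈ F, ∃ P₀ A b₀, FixRecord w C 𝒮 pr P P₀ A b b₀ i

/-- The outcomes agree outside `A`, so the new movers `R \ A` may be charged in `P`, and there over
the larger base `Rᶜ`. -/
theorem pot_union_le (hw : ∀ i, 0 ≤ w i) (hC : ∀ e, IsCost d (C e)) {A R : Finset N}
    (h : ∀ j ∉ A, P j = P₀ j) : pot w C P₀ Finset.univ - pot w C P₀ (A ∪ R)ᶜ
      ≤ (pot w C P₀ Finset.univ - pot w C P₀ Aᶜ) + (pot w C P Finset.univ - pot w C P Rᶜ) := by
  have h1 : pot w C P₀ Aᶜ = pot w C P Aᶜ := pot_congr fun j hj => (h j (by simpa using hj)).symm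
  have h2 : pot w C P₀ (A ∪ R)ᶜ = pot w C P (A ∪ R)ᶜ := pot_congr fun j hj => by
    rw [Finset.mem_compl, Finset.mem_union, not_or] at hj
    exact (h j hj.1).symm
  have h3 := pot_supermodular (P := P) hw hC (S := (A ∪ R)ᶜ) (T := Rᶜ) (J := R \ A)
    (Finset.compl_subset_compl.2 Finset.subset_union_right)
    (Finset.disjoint_left.2 fun j hj hj' => by simp_all)
  have h4 : (A ∪ R)ᶜ ∪ R \ A = Aᶜ := by
    ext j; by_cases j ∈ A <;> by_cases j ∈ R <;> simp_all
  have h5 := pot_mono (P := P) hw hC (Finset.subset_univ (Rᶜ ∪ R \ A))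
  rw [h4] at h3
  linarith

/-- Hypothesis `hint` expresses integrality of the costs, with `β = b' + 1` in mind. An old record
absorbs the movers of this phase, paying from the reserve in `budget`; a newly fixed player opens a
record in which nobody has moved yet. -/
theorem PhaseInv.next (hw : ∀ i, 0 ≤ w i) (hC : ∀ e, IsCost d (C e)) {pr : Params d}
    {b' : ℝ} {F' : Finset N} (hβ : 0 ≤ β) (hb : 0 ≤ b) (hb' : 0 ≤ b')
    (hbb' : pr.ratio (Fintype.card N) * b' ≤ b)
    (h : PhaseInv w C 𝒮 pr P₀ F b) (hm : Moves w C 𝒮 F pr.p b β P₀ P R c)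
    (hstable : ∀ i, ∀ Q ∈ 𝒮 i, ¬ Allowed w C F pr.p b β P i Q)
    (hint : ∀ i, ∀ Q ∈ 𝒮 i, devCost w C P i (P i) < devCost w C P i Q + β →
      devCost w C P i (P i) ≤ devCost w C P i Q + b')
    (hF' : ∀ i, i ∈ F' ↔ i ∈ F ∨ b ≤ devCost w C P i (P i)) :
    PhaseInv w C 𝒮 pr P F' b' := by
  have hg : (2 : ℝ) ≤ pr.ratio (Fintype.card N) := by
    unfold Params.ratio; push_cast
    have : (0 : ℝ) ≤ pr.K * Fintype.card N := by positivity
    linarith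
  have hp : (1 : ℝ) ≤ pr.p := by exact_mod_cast pr.one_le_p
  have hstart := hm.pot_start_le hw hC pr hβ hb h.free
  have hT : (0 : ℝ) ≤ pr.τ * Fintype.card N := by positivity
  have hb'g : b' ≤ b / pr.ratio (Fintype.card N) := by
    rw [le_div_iff₀ (by linarith)]; linarith
  refine ⟨hm.mem_all h.mem, fun i hi Q hQ => ?_, fun i hi => ?_⟩
  · rw [hF', not_or, not_le] at hi
    refine hint i Q hQ (not_le.1 fun hle => hstable i Q hQ ⟨hi.1, hle, Or.inl hi.2⟩)
  · by_cases hiF : i ∈ F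
    · obtain ⟨P₁, A, b₀, r⟩ := h.fixed i hiF
      refine ⟨P₁, A ∪ R, b₀, ⟨fun j hj => ?_, fun hiA => ?_, r.nonneg, r.le_cost, r.cost_le, ?_, ?_⟩⟩
      · rw [Finset.mem_union, not_or] at hj
        rw [hm.agree j hj.2, r.agree j hj.1]
      · rcases Finset.mem_union.1 hiA with hiA | hiR
        · exact r.notMem hiA
        · exact Finset.disjoint_left.1 hm.disjoint hiR hiF
      · have := hm.pot_le
        have : 0 ≤ (c : ℝ) * β := by positivity
        linarith [r.pot_le]
      · have h1 := pot_union_le (R := R) hw hC r.agree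
        have h2 := r.budget
        have h3 := mul_le_mul_of_nonneg_left (h1.trans (add_le_add_right hstart _))
          (show (0 : ℝ) ≤ pr.ratio (Fintype.card N) by linarith)
        -- Half of the reserve pays for this phase; the other half suffices for the rest.
        have h4 : 2 * b' ≤ b := by nlinarith
        have h5 := mul_le_mul_of_nonneg_left h4
          (show (0 : ℝ) ≤ pr.ratio (Fintype.card N) * (pr.τ * Fintype.card N) by positivity)
        linarith
    · have hbi : b ≤ devCost w C P i (P i) := ((hF' i).1 hi).resolve_left hiF
      refine ⟨P, ∅, b, ⟨fun j _ => rfl, by simp, hb, hbi, fun Q hQ => ?_, le_rfl, ?_⟩⟩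
      · have hQ0 := devCost_nonneg (P := P) hw hC i Q
        -- A forbidden deviation of a free player of cost at least `b` fails to improve by `β`,
        -- which gives the additive error, or by the factor `p`.
        by_cases h1 : devCost w C P i Q + β ≤ devCost w C P i (P i)
        · have h2 : ¬ pr.p * devCost w C P i Q < devCost w C P i (P i) := fun h2 =>
            hstable i Q hQ ⟨hiF, h1, Or.inr h2⟩
          have : 0 ≤ b / pr.ratio (Fintype.card N) := by positivity
          linarith
        · have := hint i Q hQ (not_le.1 h1)
          nlinarith
      · rw [Finset.compl_empty, sub_self, mul_zero, zero_add]
        have := mul_le_mul_of_nonneg_left hbb' hT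
        linarith

/-- Over the load of the players outside `A`, which is common to both outcomes, `smooth` separates
the weight of `i` from the load of `A`. The first part is a marginal cost in `P` at most; the second
is bounded by the potential of `A` in `P₀`. -/
theorem devCost_le_of_agree (hw : ∀ i, 0 ≤ w i) (hC : ∀ e, IsCost d (C e)) {a : ℝ}
    (ha : 0 < a) (ha1 : a < 1) {A : Finset N} {i : N} (hi : i ∉ A) (h : ∀ j ∉ A, P j = P₀ j)
    (Q : Finset E) :
    devCost w C P₀ i Q ≤ (a ^ d)⁻¹ * devCost w C P i Q
      + ((1 - a) ^ d)⁻¹ * (pot w C P₀ Finset.univ - pot w C P₀ Aᶜ) := by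
  have hU : ∀ e, load w P₀ (Finset.univ.erase i) e
      = load w P₀ (Aᶜ.erase i) e + load w P₀ A e := fun e => by
    have hd : Disjoint (Aᶜ.erase i) A := disjoint_compl_left.mono_left (Finset.erase_subset _ _)
    rw [← load_union hd]
    congr 1
    ext j
    rcases eq_or_ne j i with rfl | hj
    · simp [hi]
    · by_cases j ∈ A <;> simp_all
  have hY : ∀ e, load w P₀ Finset.univ e = load w P₀ Aᶜ e + load w P₀ A e := fun e => by
    rw [← load_union disjoint_compl_left, Finset.union_comm, Finset.union_compl]
  have hV : ∀ e, load w P₀ (Aᶜ.erase i) e = load w P (Aᶜ.erase i) e := fun e =>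
    load_congr (fun j hj => (h j (by simp_all)).symm) e
  have hlam : 0 ≤ ((1 - a) ^ d)⁻¹ := inv_nonneg.2 (pow_nonneg (by linarith) _)
  have hκ : 0 ≤ (a ^ d)⁻¹ := inv_nonneg.2 (pow_nonneg ha.le _)
  have hsub : ∑ e ∈ Q, (C e (load w P₀ Finset.univ e) - C e (load w P₀ Aᶜ e))
      ≤ pot w C P₀ Finset.univ - pot w C P₀ Aᶜ := by
    rw [pot, pot, ← Finset.sum_sub_distrib]
    exact Finset.sum_le_sum_of_subset_of_nonneg (Finset.subset_univ Q) fun e _ _ =>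
      sub_nonneg.2 ((hC e).le (load_nonneg hw _ e) (load_mono hw (Finset.subset_univ _) e))
  refine le_trans ?_ (add_le_add_right (mul_le_mul_of_nonneg_left hsub hlam) _)
  rw [devCost_eq_sum, devCost_eq_sum, Finset.mul_sum, Finset.mul_sum, ← Finset.sum_add_distrib]
  refine Finset.sum_le_sum fun e _ => ?_
  have u0 := load_nonneg (P := P₀) hw (Aᶜ.erase i) e
  have u1 := load_nonneg (P := P₀) hw A e
  rw [hU, hY]
  have h1 := (hC e).smooth ha ha1 u0 (hw i) u1
  have h2 := (hC e).le u0 (show _ ≤ load w P₀ (Aᶜ.erase i) e + load w P₀ A e by linarith)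
  have h3 := (hC e).diff_mono (y := load w P (Finset.univ.erase i) e) u0
    (by rw [hV]; exact load_mono hw (Finset.erase_subset_erase _ (Finset.subset_univ _)) e) (hw i)
  have h4 := (hC e).diff_mono u0 (load_mono (P := P₀) hw (Finset.erase_subset i Aᶜ) e) u1
  have h5 := mul_le_mul_of_nonneg_left h3 hκ
  have h6 := mul_le_mul_of_nonneg_left h4 hlam
  rw [add_right_comm]
  linarith

/-- Adding `i` to the other players outside `A` costs at most as much as in `P₀`; adding the players
of `A` afterwards accounts for the second term. -/
theorem devCost_self_le (hw : ∀ i, 0 ≤ w i) (hC : ∀ e, IsCost d (C e)) {A : Finset N} {i : N}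
    (hi : i ∉ A) (h : ∀ j ∉ A, P j = P₀ j) :
    devCost w C P i (P i)
      ≤ devCost w C P₀ i (P₀ i) + (pot w C P Finset.univ - pot w C P Aᶜ) := by
  have e1 : Aᶜ = insert i (Aᶜ.erase i) := (Finset.insert_erase (by simpa using hi)).symm
  have h1 := pot_mono (P := P) hw hC (S := Aᶜ.erase i) (T := Finset.univ.erase i)
    (Finset.erase_subset_erase _ (Finset.subset_univ _))
  have h2 : pot w C P Aᶜ - pot w C P (Aᶜ.erase i) ≤ devCost w C P₀ i (P₀ i) := by
    rw [pot_congr (P := P) (P' := P₀) fun j hj => h j (by simpa using hj),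
      pot_congr (P := P) (P' := P₀) (S := Aᶜ.erase i) fun j hj => h j (by simp_all), devCost_self]
    have := pot_supermodular_insert (P := P₀) (i := i) hw hC (S := Aᶜ.erase i)
      (T := Finset.univ.erase i) (Finset.erase_subset_erase _ (Finset.subset_univ _)) (by simp)
    rwa [← e1, Finset.insert_erase (Finset.mem_univ i)] at this
  rw [devCost_self]
  linarith

/-- When the threshold has reached `0`, the outcome is an approximate equilibrium with respect to
marginal costs. -/
theorem PhaseInv.approx (hw : ∀ i, 0 ≤ w i) (hC : ∀ e, IsCost d (C e)) {pr : Params d}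
    (h : PhaseInv w C 𝒮 pr P F 0) (i : N) {Q : Finset E} (hQ : Q ∈ 𝒮 i) :
    devCost w C P i (P i) ≤ 8 * pr.p * devCost w C P i Q := by
  have hp : (1 : ℝ) ≤ pr.p := by exact_mod_cast pr.one_le_p
  have hX := devCost_nonneg (P := P) hw hC i Q
  by_cases hi : i ∈ F
  · obtain ⟨P₀, A, b₀, r⟩ := h.fixed i hi
    have h1 := devCost_le_of_agree hw hC pr.a_pos pr.a_lt_one r.notMem r.agree Q
    have h2 := devCost_self_le hw hC r.notMem r.agree
    have h3 : pot w C P Aᶜ = pot w C P₀ Aᶜ := pot_congr fun j hj => r.agree j (by simpa using hj)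
    have h4 := r.budget
    have h5 := r.cost_le Q hQ
    have h6 := r.le_cost
    have h7 := r.pot_le
    have h8 := r.nonneg
    have hlam := pr.one_le_lam
    have hl2 := pr.lt_two
    have hK := pr.le_K
    rw [h3] at h2
    have hg : (pr.ratio (Fintype.card N) : ℝ) = pr.K * Fintype.card N + 2 := by
      unfold Params.ratio; push_cast; ring
    have hg2 : (2 : ℝ) ≤ pr.ratio (Fintype.card N) := by
      have : (0 : ℝ) ≤ pr.K * Fintype.card N := by positivity
      linarith
    generalize (pr.ratio (Fintype.card N) : ℝ) = g at *
    have hgb : g * (b₀ / g) = b₀ := mul_div_cancel₀ _ (by linarith)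
    generalize b₀ / g = q at *
    obtain ⟨Φ, hΦ⟩ : ∃ Φ, Φ = pot w C P₀ Finset.univ - pot w C P₀ Aᶜ := ⟨_, rfl⟩
    have h2' : devCost w C P i (P i) ≤ devCost w C P₀ i (P₀ i) + Φ := by linarith
    rw [← hΦ] at h1 h4
    generalize ((1 - pr.a) ^ d)⁻¹ = lam at *
    generalize (pr.a ^ d)⁻¹ = κ at *
    have h4' : g * Φ ≤ 2 * (pr.τ * Fintype.card N * b₀) := by linarith
    have hn : (0 : ℝ) ≤ Fintype.card N * b₀ := by positivity
    have k1 := mul_le_mul_of_nonneg_right hK hn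
    have hD : devCost w C P₀ i Q ≤ 2 * devCost w C P i Q + lam * Φ := by
      have := mul_le_mul_of_nonneg_right hl2.le hX
      linarith
    have k2 := mul_le_mul_of_nonneg_left hD (show (0 : ℝ) ≤ g * pr.p by positivity)
    have hlp : 1 ≤ lam * pr.p := one_le_mul_of_one_le_of_one_le hlam hp
    have k3 := mul_le_mul_of_nonneg_left h4' (show (0 : ℝ) ≤ lam * pr.p by positivity)
    have k4 := mul_le_mul_of_nonneg_left h5 (show (0 : ℝ) ≤ g by linarith)
    -- By `le_K` the error `p * lam * Φ + q` is at most `b₀ / 2`, hence at most half the cost in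
    -- `P₀`; solving for that cost turns the factor `2 p` into `4 p`.
    have k5 : g * devCost w C P₀ i (P₀ i) ≤ g * (4 * pr.p * devCost w C P i Q) := by
      have := mul_le_mul_of_nonneg_left h6 (show (0 : ℝ) ≤ g by linarith)
      subst hg
      linarith
    have k6 := le_of_mul_le_mul_left k5 (by linarith)
    -- The later moves raise the cost by at most `Φ ≤ b₀`, which contributes another `4 p`.
    have k7 : g * Φ ≤ g * b₀ := by
      have hτ : (0 : ℝ) ≤ pr.τ * (Fintype.card N * b₀) := by positivity
      have := mul_le_mul_of_nonneg_right hlp hτ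
      subst hg
      linarith
    have k8 := le_of_mul_le_mul_left k7 (by linarith)
    linarith
  · have := h.free i hi Q hQ
    nlinarith

end Moves

/-! ### The constants -/

/-- For `a = 2 ^ (-1 / (d + 1))` one has `a ^ (-d) = 2 * a`, below two by at least `1 / (2 * (d +
1))`. Moreover `1 - a` is at least `a * log 2 / (d + 1)`, so `(1 - a) ^ (-d)` is at most twice `((d
+ 1) / log 2) ^ d`; the bound `(1 + 1 / d) ^ d ≤ e < 3` replaces `d + 1` by `d`. -/
theorem Params.exists_le (d : ℕ) :
    ∃ pr : Params d, (pr.p : ℝ) ≤ 25 * (d + 1) * (d / Real.log 2) ^ d := by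
  have hl0 : 0 < Real.log 2 := Real.log_pos one_lt_two
  have hl1 : Real.log 2 < 1 := by linarith [Real.log_two_lt_d9]
  have hl2 : 1 / 2 < Real.log 2 := by linarith [Real.log_two_gt_d9]
  set x : ℝ := Real.log 2 / (d + 1) with hx
  have hd1 : (0 : ℝ) < d + 1 := by positivity
  have hx0 : 0 < x := by positivity
  set a : ℝ := Real.exp (-x) with ha
  have ha0 : 0 < a := Real.exp_pos _
  have ha1 : a < 1 := Real.exp_lt_one_iff.2 (by linarith)
  have hxa : x * a ≤ 1 - a := by
    have h1 := Real.add_one_le_exp x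
    have h2 : a * Real.exp x = 1 := by rw [ha, ← Real.exp_add, neg_add_cancel, Real.exp_zero]
    nlinarith
  have hpow : a ^ (d + 1) = 1 / 2 := by
    rw [ha, ← Real.exp_nat_mul, hx]
    push_cast
    rw [mul_neg, mul_div_cancel₀ _ hd1.ne', Real.exp_neg, Real.exp_log two_pos]
    norm_num
  have hκ : (a ^ d)⁻¹ = 2 * a := by
    rw [pow_succ] at hpow
    field_simp
    linarith
  have ha2 : 1 / 2 ≤ a := hpow ▸ pow_le_of_le_one ha0.le ha1.le (Nat.succ_ne_zero d)
  have hbase : 1 ≤ ((d : ℝ) / Real.log 2) ^ d := by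
    rcases Nat.eq_zero_or_pos d with rfl | hd
    · simp
    · have : (1 : ℝ) ≤ d := by exact_mod_cast hd
      exact one_le_pow₀ ((one_le_div hl0).2 (by linarith))
  have hexp : ((d : ℝ) + 1) ^ d ≤ 3 * (d : ℝ) ^ d := by
    rcases Nat.eq_zero_or_pos d with rfl | hd
    · norm_num
    · have hd' : (0 : ℝ) < d := by exact_mod_cast hd
      have h1 : (d : ℝ) + 1 ≤ d * Real.exp (1 / d) := by
        have := mul_le_mul_of_nonneg_left (Real.add_one_le_exp (1 / (d : ℝ))) hd'.le
        rw [mul_add, mul_one_div_cancel hd'.ne'] at this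
        linarith
      calc ((d : ℝ) + 1) ^ d ≤ (d * Real.exp (1 / d)) ^ d := by gcongr
        _ = d ^ d * Real.exp 1 := by
          rw [mul_pow, ← Real.exp_nat_mul, mul_one_div_cancel hd'.ne']
        _ ≤ 3 * (d : ℝ) ^ d := by
          rw [mul_comm]
          gcongr
          linarith [Real.exp_one_lt_d9]
  have hlam : ((1 - a) ^ d)⁻¹ ≤ 6 * (d / Real.log 2) ^ d := by
    calc ((1 - a) ^ d)⁻¹ ≤ ((x * a) ^ d)⁻¹ := by gcongr
      _ = ((d + 1) ^ d / Real.log 2 ^ d) * (a ^ d)⁻¹ := by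
        rw [mul_pow, mul_inv, hx, div_pow, inv_div]
      _ ≤ (3 * (d : ℝ) ^ d / Real.log 2 ^ d) * 2 := by
        rw [hκ]
        gcongr
        linarith
      _ = _ := by rw [div_pow]; ring
  -- `2 - 2 * a ≥ 2 * x * a ≥ x`, because `a ≥ 1 / 2`.
  have hgap : 1 / (2 * (d + 1)) ≤ 2 - (a ^ d)⁻¹ := by
    rw [hκ]
    have h1 : 1 / (2 * ((d : ℝ) + 1)) ≤ x := by
      rw [hx, ← div_div]
      gcongr
    nlinarith
  have hgap0 : 0 < 2 - (a ^ d)⁻¹ := lt_of_lt_of_le (by positivity) hgap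
  have hlam0 : 0 < ((1 - a) ^ d)⁻¹ := inv_pos.2 (pow_pos (by linarith) _)
  set lam := ((1 - a) ^ d)⁻¹
  -- The constant is `2 * 6 * 2`; rounding up to an integer later makes it `25`.
  have hpb : 2 * lam / (2 - (a ^ d)⁻¹) ≤ 24 * (d + 1) * (d / Real.log 2) ^ d := by
    rw [div_le_iff₀ hgap0]
    have h1 := mul_le_mul_of_nonneg_left hgap
      (show 0 ≤ 24 * (d + 1) * (d / Real.log 2) ^ d by positivity)
    have h2 : 24 * ((d : ℝ) + 1) * (d / Real.log 2) ^ d * (1 / (2 * (d + 1)))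
        = 12 * (d / Real.log 2) ^ d := by field_simp; ring
    linarith
  refine ⟨{ a := a, p := ⌈2 * lam / (2 - (a ^ d)⁻¹)⌉₊,
            τ := ⌈2 * (lam + 1) / (2 - (a ^ d)⁻¹)⌉₊,
            K := ⌈4 * lam * ⌈2 * lam / (2 - (a ^ d)⁻¹)⌉₊ * ⌈2 * (lam + 1) / (2 - (a ^ d)⁻¹)⌉₊⌉₊,
            a_pos := ha0, a_lt_one := ha1, lt_two := by linarith,
            one_le_p := Nat.ceil_pos.2 (by positivity),
            le_p := ?_, le_τ := ?_, le_K := Nat.le_ceil _ }, ?_⟩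
  · rw [mul_comm, ← div_le_iff₀' hgap0, mul_comm]
    exact Nat.le_ceil _
  · rw [← div_le_iff₀' hgap0]
    exact Nat.le_ceil _
  · have h1 := Nat.ceil_lt_add_one (show 0 ≤ 2 * lam / (2 - (a ^ d)⁻¹) by positivity)
    have h2 : (1 : ℝ) ≤ (d + 1) * (d / Real.log 2) ^ d :=
      one_le_mul_of_one_le_of_one_le (by linarith [(Nat.cast_nonneg d : (0 : ℝ) ≤ d)]) hbase
    dsimp only
    linarith

/-! ### Shapley shares and marginal costs -/

section Shapley

variable {α : Type} [DecidableEq α]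

/-- The ordering that extends `π` by putting `k` last. -/
def Equiv.putLast {n : ℕ} (k : α) (π : {j // j ≠ k} ≃ Fin n) : α ≃ Fin (n + 1) :=
  (Equiv.optionSubtypeNe k).symm.trans ((Equiv.optionCongr π).trans finSuccEquivLast.symm)

theorem Equiv.putLast_self {n : ℕ} (k : α) (π : {j // j ≠ k} ≃ Fin n) :
    Equiv.putLast k π k = Fin.last n := by
  simp [Equiv.putLast]

theorem Equiv.putLast_of_ne {n : ℕ} (k : α) (π : {j // j ≠ k} ≃ Fin n) {j : α} (h : j ≠ k) :
    Equiv.putLast k π j = (π ⟨j, h⟩).castSucc := by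
  simp [Equiv.putLast, Equiv.optionSubtypeNe_symm_of_ne h]

variable [Fintype α]

/-- An ordering amounts to a last element and an ordering of the others. Bijectivity follows from
injectivity and equal cardinalities. -/
theorem Equiv.sum_putLast {n : ℕ} (h : Fintype.card α = n + 1) (f : (α ≃ Fin (n + 1)) → ℝ) :
    ∑ π, f π = ∑ k, ∑ π : {j // j ≠ k} ≃ Fin n, f (Equiv.putLast k π) := by
  rw [← Fintype.sum_sigma (fun x : (k : α) × ({j // j ≠ k} ≃ Fin n) => f (Equiv.putLast x.1 x.2))]
  refine (Fintype.sum_bijective (fun x : (k : α) × ({j // j ≠ k} ≃ Fin n) =>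
    Equiv.putLast x.1 x.2) ?_ _ _ fun _ => rfl).symm
  rw [Fintype.bijective_iff_injective_and_card]
  constructor
  · rintro ⟨k, π⟩ ⟨k', π'⟩ hk
    dsimp only at hk
    have h1 : k = k' := by
      by_contra hne
      have h2 := Equiv.putLast_of_ne k' π' hne
      rw [← hk, Equiv.putLast_self] at h2
      exact (Fin.castSucc_lt_last _).ne h2.symm
    subst h1
    congr 1
    ext j
    have h2 := Equiv.putLast_of_ne k π' j.2
    rw [← hk, Equiv.putLast_of_ne k π j.2] at h2
    exact congrArg Fin.val (Fin.castSucc_injective _ h2)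
  · have hc : ∀ k : α, Fintype.card {j // j ≠ k} = n := fun k => by
      rw [Fintype.card_subtype_compl, h]; simp
    rw [Fintype.card_sigma, Fintype.card_equiv (Fintype.equivFinOfCardEq h), h,
      Finset.sum_congr rfl fun k _ => by
        rw [Fintype.card_equiv (Fintype.equivFinOfCardEq (hc k)), hc k]]
    simp [h, Nat.factorial_succ]

variable {d : ℕ} {C : ℝ → ℝ}

/-- Only other players can precede `i`, so by convexity coming last is the most expensive position.
-/
theorem sum_marginal_le (hC : IsCost d C) {n : ℕ} (h : Fintype.card α = n) {w : α → ℝ}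
    (hw : ∀ j, 0 < w j) (i : α) :
    ∑ π : α ≃ Fin n, (C (∑ j with π j < π i, w j + w i) - C (∑ j with π j < π i, w j))
      ≤ n.factorial * (C (∑ j ∈ Finset.univ.erase i, w j + w i)
        - C (∑ j ∈ Finset.univ.erase i, w j)) := by
  have hcard : (Finset.univ : Finset (α ≃ Fin n)).card = n.factorial := by
    rw [Finset.card_univ, Fintype.card_equiv (Fintype.equivFinOfCardEq h), h]
  rw [← hcard, ← nsmul_eq_mul, ← Finset.sum_const]
  refine Finset.sum_le_sum fun π _ => hC.diff_mono (Finset.sum_nonneg fun j _ => (hw j).le) ?_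
    (hw i).le
  refine Finset.sum_le_sum_of_subset_of_nonneg (fun j hj => ?_) fun j _ _ => (hw j).le
  rw [Finset.mem_erase]
  refine ⟨?_, Finset.mem_univ _⟩
  rintro rfl
  simp at hj

/-- Condition on who comes last. If it is `i`, her marginal is the full `M`. If it is `k`, induction
applies to the others, whose load without `i` has shrunk from `X` by the factor `1 - w k / X`;
`marginal_scale` and Bernoulli's inequality leave at least `(1 - d * w k / X) * M`. These factors
sum to at least `n - d`, and `(d + 1) + (n - d) = n + 1`. The player type is quantified inside so
that induction can pass to a subtype. -/
theorem le_sum_marginal (hC : IsCost d C) {n : ℕ} : ∀ {α : Type} [Fintype α] [DecidableEq α]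
    (_ : Fintype.card α = n) {w : α → ℝ} (_ : ∀ j, 0 < w j) (i : α),
    n.factorial * (C (∑ j ∈ Finset.univ.erase i, w j + w i)
        - C (∑ j ∈ Finset.univ.erase i, w j))
      ≤ (d + 1) * ∑ π : α ≃ Fin n,
        (C (∑ j with π j < π i, w j + w i) - C (∑ j with π j < π i, w j)) := by
  induction n with
  | zero =>
    intro α _ _ h w hw i
    exact ((Fintype.card_eq_zero_iff.1 h).false i).elim
  | succ n ih =>
    intro α _ _ h w hw i
    have hc : ∀ k : α, Fintype.card {j // j ≠ k} = n := fun k => by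
      rw [Fintype.card_subtype_compl, h]; simp
    set X := ∑ j ∈ Finset.univ.erase i, w j with hX
    have hX0 : 0 ≤ X := Finset.sum_nonneg fun j _ => (hw j).le
    have hM : 0 ≤ C (X + w i) - C X := sub_nonneg.2 (hC.le hX0 (by linarith [hw i]))
    set M := C (X + w i) - C X
    rw [Equiv.sum_putLast h, ← Finset.add_sum_erase _ _ (Finset.mem_univ i)]
    have h1 : ∑ π : {j // j ≠ i} ≃ Fin n,
        (C (∑ j with Equiv.putLast i π j < Equiv.putLast i π i, w j + w i)
          - C (∑ j with Equiv.putLast i π j < Equiv.putLast i π i, w j)) = n.factorial * M := by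
      have hs : ∀ π : {j // j ≠ i} ≃ Fin n,
          ∑ j with Equiv.putLast i π j < Equiv.putLast i π i, w j = X := by
        intro π
        rw [hX]
        refine Finset.sum_congr ?_ fun _ _ => rfl
        ext j
        rcases eq_or_ne j i with rfl | hj
        · simp
        · simp [Equiv.putLast_self, Equiv.putLast_of_ne i π hj, hj, Fin.castSucc_lt_last]
      simp only [hs, Finset.sum_const, nsmul_eq_mul]
      rw [Finset.card_univ, Fintype.card_equiv (Fintype.equivFinOfCardEq (hc i)), hc i]
    have h2 : ∀ k ∈ Finset.univ.erase i, n.factorial * ((1 - d * (w k / X)) * M)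
        ≤ (d + 1) * ∑ π : {j // j ≠ k} ≃ Fin n,
        (C (∑ j with Equiv.putLast k π j < Equiv.putLast k π i, w j + w i)
          - C (∑ j with Equiv.putLast k π j < Equiv.putLast k π i, w j)) := by
      intro k hk
      have hki : i ≠ k := (Finset.ne_of_mem_erase hk).symm
      have hs : ∀ π : {j // j ≠ k} ≃ Fin n,
          ∑ j with Equiv.putLast k π j < Equiv.putLast k π i, w j
            = ∑ j : {j // j ≠ k} with π j < π ⟨i, hki⟩, w j := by
        intro π
        rw [Finset.sum_filter, Finset.sum_filter, ← Finset.add_sum_erase _ _ (Finset.mem_univ k),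
          Equiv.putLast_self, Equiv.putLast_of_ne k π hki, if_neg (Fin.castSucc_lt_last _).not_gt,
          zero_add, Finset.sum_subtype (p := fun j => j ≠ k) _ (by simp)]
        refine Finset.sum_congr rfl fun j _ => ?_
        rw [Equiv.putLast_of_ne k π j.2]
        simp
      simp only [hs]
      have h3 := ih (hc k) (w := fun j : {j // j ≠ k} => w j) (fun j => hw j) ⟨i, hki⟩
      have hwk : w k ≤ X := Finset.single_le_sum (fun j _ => (hw j).le) hk
      have hXpos : 0 < X := (hw k).trans_le hwk
      have h4 : ∑ j ∈ Finset.univ.erase (⟨i, hki⟩ : {j // j ≠ k}), w j = (1 - w k / X) * X := by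
        have h5 := Finset.add_sum_erase Finset.univ (fun j : {j // j ≠ k} => w j)
          (Finset.mem_univ ⟨i, hki⟩)
        have h6 : ∑ j ∈ Finset.univ.erase k, w j = ∑ j : {j // j ≠ k}, w j :=
          Finset.sum_subtype _ (by simp) w
        have h7 := Finset.add_sum_erase Finset.univ w (Finset.mem_univ k)
        have h8 := Finset.add_sum_erase Finset.univ w (Finset.mem_univ i)
        rw [sub_mul, one_mul, div_mul_cancel₀ _ hXpos.ne']
        dsimp only at h5
        linarith
      rw [h4] at h3
      refine le_trans ?_ h3
      have ht : 0 ≤ 1 - w k / X := sub_nonneg.2 ((div_le_one hXpos).2 hwk)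
      have h5 := hC.marginal_scale ht (by linarith [div_pos (hw k) hXpos]) hX0 (hw i).le
      have h6 : 1 - d * (w k / X) ≤ (1 - w k / X) ^ d := by
        have := one_add_mul_le_pow (a := -(w k / X)) (by linarith) d
        rw [← sub_eq_add_neg] at this
        linarith
      gcongr
      exact (mul_le_mul_of_nonneg_right h6 hM).trans h5
    have h3 := Finset.sum_le_sum h2
    rw [← Finset.mul_sum, ← Finset.mul_sum, ← Finset.sum_mul] at h3
    rw [h1, mul_add]
    refine le_trans ?_ (add_le_add_right h3 _)
    -- Using `X / X ≤ 1` also covers `X = 0`, where `i` is alone.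
    have h4 : (n : ℝ) - d ≤ ∑ k ∈ Finset.univ.erase i, (1 - d * (w k / X)) := by
      rw [Finset.sum_sub_distrib, Finset.sum_const, ← Finset.mul_sum, ← Finset.sum_div, ← hX,
        Finset.card_erase_of_mem (Finset.mem_univ i), Finset.card_univ, h]
      have := mul_le_mul_of_nonneg_left (div_self_le_one X) (Nat.cast_nonneg (α := ℝ) d)
      simp only [Nat.add_sub_cancel, nsmul_eq_mul, mul_one]
      linarith
    have h5 := mul_le_mul_of_nonneg_left (mul_le_mul_of_nonneg_right h4 hM)
      (Nat.cast_nonneg (α := ℝ) n.factorial)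
    rw [Nat.factorial_succ]
    push_cast
    linarith

end Shapley

/-! ### Shapley costs of a game against marginal costs -/

namespace CongestionGame

variable {N E : Type} {d : ℕ} [DecidableEq E] (G : CongestionGame N E d)

omit [DecidableEq E] in
theorem jointCost_eq (e : E) (x : ℝ) :
    G.jointCost e x = ∑ k ∈ Finset.range (d + 1), (G.cost e).coeff k * x ^ (k + 1) := by
  rw [jointCost, Polynomial.eval_eq_sum_range' (Nat.lt_succ_iff.2 (G.cost_degree e)),
    Finset.mul_sum]
  exact Finset.sum_congr rfl fun k _ => by ring

omit [DecidableEq E] in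
theorem isCost_jointCost (e : E) : IsCost d (G.jointCost e) := by
  have := IsCost.polynomial (d := d) (fun k => (G.cost e).coeff k) (G.cost_coeff_nonneg e)
  convert this using 1
  exact funext (G.jointCost_eq e)

variable [DecidableEq N]

omit [DecidableEq E] in
theorem sum_erase_subtype {A : Finset N} {i : N} (hi : i ∈ A) :
    ∑ j ∈ Finset.univ.erase (⟨i, hi⟩ : {j // j ∈ A}), G.weight j
      = ∑ j ∈ A.erase i, G.weight j := by
  have h1 := Finset.add_sum_erase Finset.univ (fun j : {j // j ∈ A} => G.weight j)
    (Finset.mem_univ ⟨i, hi⟩)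
  have h2 := Finset.add_sum_erase A G.weight hi
  have h3 := Finset.sum_coe_sort A G.weight
  dsimp only at h1
  linarith

omit [DecidableEq E] in
theorem shapleyShare_le (e : E) {A : Finset N} {i : N} (hi : i ∈ A) :
    G.shapleyShare e i A ≤ G.jointCost e (∑ j ∈ A.erase i, G.weight j + G.weight i)
      - G.jointCost e (∑ j ∈ A.erase i, G.weight j) := by
  have h := sum_marginal_le (G.isCost_jointCost e) (Fintype.card_coe A)
    (w := fun j : {j // j ∈ A} => G.weight j) (fun j => G.weight_pos j) ⟨i, hi⟩
  rw [shapleyShare, dif_pos hi, div_le_iff₀ (by positivity), mul_comm, ← G.sum_erase_subtype hi]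
  exact h

omit [DecidableEq E] in
theorem le_shapleyShare (e : E) {A : Finset N} {i : N} (hi : i ∈ A) :
    G.jointCost e (∑ j ∈ A.erase i, G.weight j + G.weight i)
      - G.jointCost e (∑ j ∈ A.erase i, G.weight j) ≤ (d + 1) * G.shapleyShare e i A := by
  have h := le_sum_marginal (G.isCost_jointCost e) (Fintype.card_coe A)
    (w := fun j : {j // j ∈ A} => G.weight j) (fun j => G.weight_pos j) ⟨i, hi⟩
  rw [shapleyShare, dif_pos hi, ← mul_div_assoc, le_div_iff₀ (by positivity), mul_comm,
    ← G.sum_erase_subtype hi]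
  exact h

variable [Fintype N]

omit [DecidableEq N] [Fintype N] in
theorem load_eq (P : N → Finset E) (S : Finset N) (e : E) :
    load G.weight P S e = ∑ j ∈ S with e ∈ P j, G.weight j := by
  rw [load, Finset.sum_filter]

theorem sum_users_erase (P : N → Finset E) (i : N) (Q : Finset E) (e : E) :
    ∑ j ∈ (users (Function.update P i Q) e).erase i, G.weight j
      = load G.weight P (Finset.univ.erase i) e := by
  rw [load_eq]
  refine Finset.sum_congr ?_ fun _ _ => rfl
  ext j
  rcases eq_or_ne j i with rfl | hj
  · simp
  · simp [users, hj]

variable [Fintype E]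

theorem playerCost_update_le (P : N → Finset E) (i : N) (Q : Finset E) :
    G.playerCost (Function.update P i Q) i ≤ devCost G.weight G.jointCost P i Q := by
  rw [playerCost, Function.update_self, devCost_eq_sum]
  refine Finset.sum_le_sum fun e he => ?_
  have := G.shapleyShare_le e (A := users (Function.update P i Q) e) (i := i) (by simp [users, he])
  rwa [sum_users_erase] at this

theorem devCost_le_playerCost_update (P : N → Finset E) (i : N) (Q : Finset E) :
    devCost G.weight G.jointCost P i Q
      ≤ (d + 1) * G.playerCost (Function.update P i Q) i := by
  rw [playerCost, Function.update_self, devCost_eq_sum, Finset.mul_sum]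
  refine Finset.sum_le_sum fun e he => ?_
  have := G.le_shapleyShare e (A := users (Function.update P i Q) e) (i := i) (by simp [users, he])
  rwa [sum_users_erase] at this

/-- Only the deviation loses the factor `d + 1`; the current Shapley cost is below the marginal cost
anyway. -/
theorem isApproxPNE_of_devCost {P : N → Finset E} (hP : ∀ i, P i ∈ G.strategies i) {ρ : ℝ}
    (hρ : 0 ≤ ρ) (h : ∀ i, ∀ Q ∈ G.strategies i, devCost G.weight G.jointCost P i (P i)
      ≤ ρ * devCost G.weight G.jointCost P i Q) :
    G.IsApproxPNE ((d + 1) * ρ) P := by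
  refine ⟨hP, fun i Q hQ => ?_⟩
  have h1 := G.playerCost_update_le P i (P i)
  rw [Function.update_eq_self] at h1
  have h2 := mul_le_mul_of_nonneg_left (G.devCost_le_playerCost_update P i Q) hρ
  linarith [h i Q hQ]

end CongestionGame

/-! ### Running times of programs with bounded memory contents -/

/-- All memory cells hold numbers of absolute value at most `V`. -/
def Bdd (V : ℕ) (σ : Mem) : Prop := 2 ≤ V ∧ ∀ a i, (σ a i).natAbs ≤ V

theorem bitLength_le {V w : ℕ} {z : ℤ} (hw : 1 ≤ w) (h : z.natAbs ≤ V ^ w) :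
    bitLength z ≤ w * (Nat.size V + 1) := by
  have h1 : Nat.size z.natAbs ≤ w * Nat.size V := by
    rw [Nat.size_le, mul_comm, pow_mul]
    exact h.trans_lt (Nat.pow_lt_pow_left (Nat.lt_size_self V) (by omega))
  rw [bitLength, mul_add, mul_one]
  omega

namespace Expr

/-- The value of `e` is at most `V ^ e.width` if all memory cells are bounded by `V ≥ 2`. -/
def width : Expr → ℕ
  | const z => z.natAbs + 1
  | read _ _ => 1
  | add e f => e.width + f.width
  | sub e f => e.width + f.width
  | mul e f => e.width + f.width
  | div e f => e.width + f.width

/-- The cost of evaluating `e`, in units of the maximal number of bits of a memory cell. -/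
def time : Expr → ℕ
  | const z => z.natAbs + 1
  | read _ i => i.time + i.width + 1
  | add e f => e.time + f.time + e.width + f.width
  | sub e f => e.time + f.time + e.width + f.width
  | mul e f => e.time + f.time + e.width + f.width
  | div e f => e.time + f.time + e.width + f.width

theorem one_le_width (e : Expr) : 1 ≤ e.width := by
  induction e <;> simp only [width] <;> omega

/-- Every bound `V ^ width` is at least two, so sums are dominated by products and widths add up for
all operations. This is the purpose of `2 ≤ V` in `Bdd`. -/
theorem natAbs_eval_le {V : ℕ} {σ : Mem} (h : Bdd V σ) (e : Expr) :
    (e.eval σ).natAbs ≤ V ^ e.width := by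
  have hV := h.1
  have two_le : ∀ e : Expr, 2 ≤ V ^ e.width := fun e =>
    hV.trans (Nat.le_self_pow (by have := e.one_le_width; omega) V)
  induction e with
  | const z =>
    calc z.natAbs ≤ 2 ^ z.natAbs := Nat.lt_two_pow_self.le
      _ ≤ V ^ z.natAbs := Nat.pow_le_pow_left hV _
      _ ≤ V ^ (z.natAbs + 1) := Nat.pow_le_pow_right (by omega) (Nat.le_succ _)
  | read a i => simpa [width, eval] using h.2 a (i.eval σ)
  | add e f he hf =>
    calc (e.eval σ + f.eval σ).natAbs ≤ V ^ e.width + V ^ f.width :=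
          (Int.natAbs_add_le _ _).trans (add_le_add he hf)
      _ ≤ V ^ e.width * V ^ f.width := Nat.add_le_mul (two_le e) (two_le f)
      _ = _ := (pow_add _ _ _).symm
  | sub e f he hf =>
    calc (e.eval σ - f.eval σ).natAbs ≤ V ^ e.width + V ^ f.width :=
          (Int.natAbs_sub_le _ _).trans (add_le_add he hf)
      _ ≤ V ^ e.width * V ^ f.width := Nat.add_le_mul (two_le e) (two_le f)
      _ = _ := (pow_add _ _ _).symm
  | mul e f he hf =>
    calc (e.eval σ * f.eval σ).natAbs ≤ V ^ e.width * V ^ f.width := by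
          rw [Int.natAbs_mul]; exact Nat.mul_le_mul he hf
      _ = _ := (pow_add _ _ _).symm
  | div e f he hf =>
    calc (e.eval σ / f.eval σ).natAbs ≤ V ^ e.width :=
          (Int.natAbs_ediv_le_natAbs _ _).trans he
      _ ≤ _ := Nat.pow_le_pow_right (by omega) (Nat.le_add_right _ _)

theorem bitLength_eval_le {V : ℕ} {σ : Mem} (h : Bdd V σ) (e : Expr) :
    bitLength (e.eval σ) ≤ e.width * (Nat.size V + 1) :=
  bitLength_le e.one_le_width (e.natAbs_eval_le h)

theorem evalCost_le {V : ℕ} {σ : Mem} (h : Bdd V σ) (e : Expr) :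
    e.evalCost σ ≤ e.time * (Nat.size V + 1) := by
  induction e with
  | const z => exact bitLength_eval_le h (const z)
  | read a i ih =>
    have h1 := bitLength_eval_le h i
    have h2 := bitLength_eval_le h (read a i)
    simp only [evalCost, time, add_mul]
    simp only [eval, width] at h2
    omega
  | add e f he hf | sub e f he hf | mul e f he hf | div e f he hf =>
    have h1 := bitLength_eval_le h e
    have h2 := bitLength_eval_le h f
    simp only [evalCost, time, add_mul]
    omega

/-- The scalar variable stored in cell `0` of array `a`. -/
def var (a : ℕ) : Expr := read a (const 0)

@[simp] theorem eval_var (σ : Mem) (a : ℕ) : (var a).eval σ = σ a 0 := rfl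
@[simp] theorem eval_const (σ : Mem) (z : ℤ) : (const z).eval σ = z := rfl
@[simp] theorem eval_read (σ : Mem) (a : ℕ) (i : Expr) : (read a i).eval σ = σ a (i.eval σ) := rfl
@[simp] theorem eval_add (σ : Mem) (e f : Expr) : (add e f).eval σ = e.eval σ + f.eval σ := rfl
@[simp] theorem eval_sub (σ : Mem) (e f : Expr) : (sub e f).eval σ = e.eval σ - f.eval σ := rfl
@[simp] theorem eval_mul (σ : Mem) (e f : Expr) : (mul e f).eval σ = e.eval σ * f.eval σ := rfl
@[simp] theorem eval_div (σ : Mem) (e f : Expr) : (div e f).eval σ = e.eval σ / f.eval σ := rfl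

end Expr

namespace Mem

theorem write_self (σ : Mem) (a : ℕ) (i z : ℤ) : σ.write a i z a i = z := by simp [write]

theorem write_of_ne {σ : Mem} {a b : ℕ} (h : b ≠ a) (i z : ℤ) : σ.write a i z b = σ b := by
  simp [write, h]

theorem write_apply (σ : Mem) (a : ℕ) (i z j : ℤ) :
    σ.write a i z a j = if j = i then z else σ a j := by
  simp [write, Function.update_apply]

end Mem

theorem Bdd.write {V : ℕ} {σ : Mem} (h : Bdd V σ) {z : ℤ} (hz : z.natAbs ≤ V) (a : ℕ) (i : ℤ) :
    Bdd V (σ.write a i z) := by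
  refine ⟨h.1, fun b j => ?_⟩
  by_cases hb : b = a
  · subst hb
    rw [Mem.write_apply]
    split_ifs
    · exact hz
    · exact h.2 _ _
  · rw [Mem.write_of_ne hb]
    exact h.2 _ _

namespace Program

/-- A bound for the running time, in units of the maximal number of bits of a memory cell, if every
loop is iterated at most `N` times. -/
def time (N : ℕ) : Program → ℕ
  | skip => 1
  | assign _ i e => 1 + i.time + e.time + i.width + e.width
  | flip _ i => 1 + i.time + i.width
  | seq p q => p.time N + q.time N
  | ite e p q => 1 + e.time + e.width + p.time N + q.time N
  | loop e p => (N + 1) * (1 + e.time + e.width + p.time N)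

/-- The nesting depth of the loops. -/
def depth : Program → ℕ
  | skip => 0
  | assign _ _ _ => 0
  | flip _ _ => 0
  | seq p q => max p.depth q.depth
  | ite _ p q => max p.depth q.depth
  | loop _ p => p.depth + 1

/-- Each level of loop nesting contributes one factor `N + 1`. -/
theorem time_le (p : Program) : ∃ c, ∀ N, p.time N ≤ c * (N + 1) ^ p.depth := by
  have mono : ∀ {c x a b : ℕ}, a ≤ b → c * (x + 1) ^ a ≤ c * (x + 1) ^ b := fun h =>
    Nat.mul_le_mul_left _ (Nat.pow_le_pow_right (Nat.succ_pos _) h)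
  induction p with
  | skip => exact ⟨1, by simp [time, depth]⟩
  | assign a i e => exact ⟨1 + i.time + e.time + i.width + e.width, by simp [time, depth]⟩
  | flip a i => exact ⟨1 + i.time + i.width, by simp [time, depth]⟩
  | seq p q hp hq =>
    obtain ⟨c, hc⟩ := hp
    obtain ⟨c', hc'⟩ := hq
    refine ⟨c + c', fun N => ?_⟩
    rw [time, depth, add_mul]
    exact add_le_add ((hc N).trans (mono (le_max_left _ _))) ((hc' N).trans (mono (le_max_right _ _)))
  | ite e p q hp hq =>
    obtain ⟨c, hc⟩ := hp
    obtain ⟨c', hc'⟩ := hq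
    refine ⟨1 + e.time + e.width + c + c', fun N => ?_⟩
    rw [time, depth, add_mul, add_mul]
    refine add_le_add (add_le_add ?_ ((hc N).trans (mono (le_max_left _ _))))
      ((hc' N).trans (mono (le_max_right _ _)))
    exact Nat.le_mul_of_pos_right _ (pow_pos (Nat.succ_pos _) _)
  | loop e p hp =>
    obtain ⟨c, hc⟩ := hp
    refine ⟨1 + e.time + e.width + c, fun N => ?_⟩
    rw [time, depth, pow_succ, ← mul_assoc, mul_comm (N + 1)]
    refine Nat.mul_le_mul_right _ ?_
    rw [add_mul]
    exact add_le_add (Nat.le_mul_of_pos_right _ (pow_pos (Nat.succ_pos _) _)) (hc N)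

end Program

/-! ### A program logic -/

/-- Started in the memory `σ`, the program `p` tosses no coins, keeps all memory cells bounded by `V`,
halts within the time given by `Program.time`, and establishes `Q`. -/
def Spec (V N : ℕ) (p : Program) (σ : Mem) (Q : Mem → Prop) : Prop :=
  Bdd V σ → ∃ t ≤ p.time N * (Nat.size V + 1), ∃ σ', (∀ r, Exec p σ r t σ' r) ∧ Bdd V σ' ∧ Q σ'

namespace Spec

open Program

variable {V N : ℕ} {p q : Program} {σ : Mem} {Q R : Mem → Prop}

theorem mono (h : Spec V N p σ R) (hQ : ∀ σ', R σ' → Q σ') : Spec V N p σ Q := fun hb => by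
  obtain ⟨t, ht, σ', he, hb', hR⟩ := h hb
  exact ⟨t, ht, σ', he, hb', hQ σ' hR⟩

theorem skip (h : Q σ) : Spec V N .skip σ Q := fun hb =>
  ⟨1, by simp [time], σ, fun r => .skip σ r, hb, h⟩

theorem assign {a : ℕ} {i e : Expr} (hz : (e.eval σ).natAbs ≤ V)
    (h : Q (σ.write a (i.eval σ) (e.eval σ))) : Spec V N (.assign a i e) σ Q := fun hb => by
  refine ⟨_, ?_, _, fun r => .assign a i e σ r, hb.write hz _ _, h⟩
  have h1 := i.evalCost_le hb
  have h2 := e.evalCost_le hb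
  have h3 := i.bitLength_eval_le hb
  have h4 := e.bitLength_eval_le hb
  simp only [time, add_mul]
  omega

theorem seq (h : Spec V N p σ fun σ' => Spec V N q σ' Q) : Spec V N (.seq p q) σ Q := fun hb => by
  obtain ⟨t, ht, σ', he, hb', h'⟩ := h hb
  obtain ⟨t', ht', σ'', he', hb'', hQ⟩ := h' hb'
  refine ⟨t + t', ?_, σ'', fun r => .seq (he r) (he' r), hb'', hQ⟩
  simp only [time, add_mul]
  omega

theorem ite {e : Expr} (ht : 0 < e.eval σ → Spec V N p σ Q) (hf : ¬ 0 < e.eval σ → Spec V N q σ Q) :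
    Spec V N (.ite e p q) σ Q := fun hb => by
  have h1 := e.evalCost_le hb
  have h2 := e.bitLength_eval_le hb
  by_cases h : 0 < e.eval σ
  · obtain ⟨t, ht, σ', he, hb', hQ⟩ := ht h hb
    refine ⟨_, ?_, σ', fun r => .ite_true h (he r), hb', hQ⟩
    simp only [time, add_mul]
    omega
  · obtain ⟨t, ht, σ', he, hb', hQ⟩ := hf h hb
    refine ⟨_, ?_, σ', fun r => .ite_false h (he r), hb', hQ⟩
    simp only [time, add_mul]
    omega

/-- A loop with invariant `I`, indexed by a bound for the number of remaining iterations. -/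
theorem loop {e : Expr} {I : ℕ → Mem → Prop} {k : ℕ} (hk : k ≤ N) (h0 : I k σ)
    (hend : ∀ σ', I 0 σ' → ¬ 0 < e.eval σ')
    (hstep : ∀ k σ', I (k + 1) σ' → 0 < e.eval σ' → Spec V N p σ' (I k))
    (hQ : ∀ k σ', I k σ' → ¬ 0 < e.eval σ' → Q σ') : Spec V N (.loop e p) σ Q := by
  suffices key : ∀ k σ, I k σ → Bdd V σ →
      ∃ t ≤ (k + 1) * ((1 + e.time + e.width + p.time N) * (Nat.size V + 1)), ∃ σ',
        (∀ r, Exec (.loop e p) σ r t σ' r) ∧ Bdd V σ' ∧ Q σ' by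
    intro hb
    obtain ⟨t, ht, h⟩ := key k σ h0 hb
    refine ⟨t, ht.trans ?_, h⟩
    rw [time, mul_assoc]
    exact Nat.mul_le_mul_right _ (by omega)
  have hexit : ∀ k σ, I k σ → ¬ 0 < e.eval σ → Bdd V σ →
      ∃ t ≤ (k + 1) * ((1 + e.time + e.width + p.time N) * (Nat.size V + 1)), ∃ σ',
        (∀ r, Exec (.loop e p) σ r t σ' r) ∧ Bdd V σ' ∧ Q σ' := by
    intro k σ hI h hb
    refine ⟨_, ?_, σ, fun r => .loop_false h, hb, hQ k σ hI h⟩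
    have h1 := e.evalCost_le hb
    have h2 := e.bitLength_eval_le hb
    refine le_trans ?_ (Nat.le_mul_of_pos_left _ (Nat.succ_pos k))
    simp only [add_mul]
    omega
  intro k
  induction k with
  | zero => exact fun σ hI hb => hexit 0 σ hI (hend σ hI) hb
  | succ k ih =>
    intro σ hI hb
    by_cases h : 0 < e.eval σ
    · obtain ⟨t, ht, σ', he, hb', hI'⟩ := hstep k σ hI h hb
      obtain ⟨t', ht', σ'', he', hb'', hQ'⟩ := ih σ' hI' hb'
      refine ⟨_, ?_, σ'', fun r => .loop_true h (he r) (he' r), hb'', hQ'⟩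
      have h1 := e.evalCost_le hb
      have h2 := e.bitLength_eval_le hb
      rw [add_mul (k + 1), one_mul]
      simp only [add_mul] at ht' ⊢
      omega
    · exact hexit _ σ hI h hb

end Spec

/-- `for v = 0, …, bound - 1 do p`; the expression `bound` is evaluated before every iteration. -/
def Program.forTo (v : ℕ) (bound : Expr) (p : Program) : Program :=
  .seq (.assign v (.const 0) (.const 0))
    (.loop (.sub bound (.var v))
      (.seq p (.assign v (.const 0) (.add (.var v) (.const 1)))))

/-- The bound is evaluated anew in each round, so its value must follow from the invariant. The body
has to leave the counter unchanged, and `J (k + 1)` is required only after the increment. -/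
theorem Spec.forTo {V N v n : ℕ} {bound : Expr} {p : Program} {σ : Mem} {Q : Mem → Prop}
    (J : ℕ → Mem → Prop) (hN : n ≤ N) (hV : n ≤ V) (h0 : J 0 (σ.write v 0 0))
    (hbound : ∀ k σ', J k σ' → σ' v 0 = k → bound.eval σ' = n)
    (hstep : ∀ k σ', k < n → J k σ' → σ' v 0 = k →
      Spec V N p σ' fun σ'' => σ'' v 0 = k ∧ J (k + 1) (σ''.write v 0 ((k + 1 : ℕ) : ℤ)))
    (hQ : ∀ σ', J n σ' → Q σ') : Spec V N (.forTo v bound p) σ Q := by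
  refine Spec.seq (Spec.assign (by simp) ?_)
  -- Here `l` counts the rounds left and `k` the rounds done.
  refine Spec.loop (I := fun l σ' => ∃ k, k + l = n ∧ J k σ' ∧ σ' v 0 = k) hN
    ⟨0, by simp, h0, Mem.write_self _ _ _ _⟩ ?_ ?_ ?_
  · rintro σ' ⟨k, hk, hJ, hv⟩
    rw [Expr.eval_sub, hbound k σ' hJ hv, Expr.eval_var, hv]
    omega
  · rintro l σ' ⟨k, hk, hJ, hv⟩ -
    refine Spec.seq ((hstep k σ' (by omega) hJ hv).mono ?_)
    rintro σ'' ⟨hv', hJ'⟩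
    have he : (Expr.add (.var v) (.const 1)).eval σ'' = ((k + 1 : ℕ) : ℤ) := by
      rw [Expr.eval_add, Expr.eval_var, hv', Expr.eval_const]
      push_cast
      ring
    refine Spec.assign ?_ ⟨k + 1, by omega, ?_⟩
    · rw [he, Int.natAbs_natCast]
      omega
    · rw [he]
      exact ⟨hJ', Mem.write_self _ _ _ _⟩
  · rintro l σ' ⟨k, hk, hJ, hv⟩ hn
    rw [Expr.eval_sub, hbound k σ' hJ hv, Expr.eval_var, hv] at hn
    obtain rfl : k = n := by omega
    exact hQ σ' hJ

/-! ### Reading the input -/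

theorem List.getElem?_flatMap_take {α β : Type*} {l : List α} {f : α → List β} {i r : ℕ}
    (hi : i < l.length) (hr : r < (f l[i]).length) :
    (l.flatMap f)[((l.take i).flatMap f).length + r]? = (f l[i])[r]? := by
  have h : l.flatMap f = (l.take i).flatMap f ++ (f l[i] ++ (l.drop (i + 1)).flatMap f) := by
    conv_lhs => rw [← List.take_append_drop i l, List.drop_eq_getElem_cons hi]
    rw [List.flatMap_append, List.flatMap_cons]
  rw [h, List.getElem?_append_right (Nat.le_add_right _ _), Nat.add_sub_cancel_left,
    List.getElem?_append_left hr]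

theorem List.length_flatMap_take_of_const {α β : Type*} {l : List α} {f : α → List β} {c : ℕ}
    (h : ∀ x, (f x).length = c) {i : ℕ} (hi : i ≤ l.length) :
    ((l.take i).flatMap f).length = i * c := by
  rw [List.length_flatMap, List.map_congr_left (g := fun _ => c) (fun x _ => h x)]
  simp [hi]

namespace GameInstance

variable {d : ℕ} (G : GameInstance d)

def strategyBlock (i : Fin G.n) (s : Fin (G.numStrategies i)) : List ℤ :=
  (List.finRange G.m).map fun e => if e ∈ G.strategy i s then (1 : ℤ) else 0

def playerBlock (i : Fin G.n) : List ℤ :=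
  [(G.weight i).num, ((G.weight i).den : ℤ), (G.numStrategies i : ℤ)]
    ++ (List.finRange (G.numStrategies i)).flatMap (G.strategyBlock i)

def coeffBlock (e : Fin G.m) : List ℤ :=
  (List.finRange (d + 1)).flatMap fun k => [(G.coeff e k).num, ((G.coeff e k).den : ℤ)]

theorem encode_eq : G.encode = [(G.n : ℤ), (G.m : ℤ)]
    ++ ((List.finRange G.n).flatMap G.playerBlock ++ (List.finRange G.m).flatMap G.coeffBlock) :=
  List.append_assoc _ _ _

/-- The position in the input of the data of player `i`; the position of the coefficients for
`i = n`. -/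
def off (i : ℕ) : ℕ := 2 + (((List.finRange G.n).take i).flatMap G.playerBlock).length

theorem length_strategyBlock (i : Fin G.n) (s : Fin (G.numStrategies i)) :
    (G.strategyBlock i s).length = G.m := by simp [strategyBlock]

theorem length_playerBlock (i : Fin G.n) :
    (G.playerBlock i).length = 3 + G.numStrategies i * G.m := by
  have h := List.length_flatMap_take_of_const (l := List.finRange (G.numStrategies i))
    (G.length_strategyBlock i) le_rfl
  rw [List.take_length, List.length_finRange] at h
  rw [playerBlock, List.length_append, h]
  rfl

theorem length_coeffBlock (e : Fin G.m) : (G.coeffBlock e).length = (d + 1) * 2 := by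
  have h := List.length_flatMap_take_of_const (l := List.finRange (d + 1))
    (f := fun k => [(G.coeff e k).num, ((G.coeff e k).den : ℤ)]) (c := 2) (fun _ => rfl) le_rfl
  rw [List.take_length, List.length_finRange] at h
  exact h

theorem off_zero : G.off 0 = 2 := rfl

theorem off_succ (i : Fin G.n) : G.off (i + 1) = G.off i + (3 + G.numStrategies i * G.m) := by
  have hi : (i : ℕ) < (List.finRange G.n).length := by simp
  rw [off, off, List.take_succ_eq_append_getElem hi, List.flatMap_append, List.length_append,
    ← G.length_playerBlock i, add_assoc]
  simp

theorem length_encode : G.encode.length = G.off G.n + G.m * ((d + 1) * 2) := by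
  have h := List.length_flatMap_take_of_const (l := List.finRange G.m) G.length_coeffBlock le_rfl
  rw [List.take_length, List.length_finRange] at h
  have h2 : (List.finRange G.n).take G.n = List.finRange G.n := by
    rw [List.take_of_length_le (by simp)]
  rw [encode_eq, List.length_append, List.length_append, h, off, h2]
  simp only [List.length_cons, List.length_nil]
  omega

/-- Cell `j` of the input. -/
def input (j : ℕ) : ℤ := G.encode.getD j 0

theorem inputMem_natCast (j : ℕ) : inputMem G.encode 0 (j : ℤ) = G.input j := by
  simp [inputMem, input]

theorem input_player (i : Fin G.n) {r : ℕ} (hr : r < 3 + G.numStrategies i * G.m) :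
    G.input (G.off i + r) = (G.playerBlock i).getD r 0 := by
  have hi : (i : ℕ) < (List.finRange G.n).length := by simp
  have h := List.getElem?_flatMap_take (f := G.playerBlock) (r := r) hi
    (by simpa [length_playerBlock] using hr)
  have hlt : (((List.finRange G.n).take i).flatMap G.playerBlock).length + r
      < ((List.finRange G.n).flatMap G.playerBlock).length := by
    by_contra hc
    rw [List.getElem?_eq_none (not_lt.1 hc), eq_comm, List.getElem?_eq_none_iff] at h
    simp [length_playerBlock] at h
    omega
  rw [input, encode_eq, List.getD_eq_getElem?_getD, List.getD_eq_getElem?_getD,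
    List.getElem?_append_right (by simp [off]; omega), List.getElem?_append_left]
  · rw [off]
    simp only [List.length_cons, List.length_nil]
    rw [show 2 + (((List.finRange G.n).take i).flatMap G.playerBlock).length + r - (0 + 1 + 1)
      = (((List.finRange G.n).take i).flatMap G.playerBlock).length + r by omega, h]
    simp
  · rw [off]
    simp only [List.length_cons, List.length_nil]
    omega

theorem input_weight_num (i : Fin G.n) : G.input (G.off i) = (G.weight i).num :=
  G.input_player i (r := 0) (by omega)

theorem input_weight_den (i : Fin G.n) : G.input (G.off i + 1) = (G.weight i).den :=
  G.input_player i (r := 1) (by omega)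

theorem input_numStrategies (i : Fin G.n) : G.input (G.off i + 2) = G.numStrategies i :=
  G.input_player i (r := 2) (by omega)

theorem input_strategy (i : Fin G.n) (s : Fin (G.numStrategies i)) (e : Fin G.m) :
    G.input (G.off i + 3 + s * G.m + e) = if e ∈ G.strategy i s then 1 else 0 := by
  have h1 : (s : ℕ) * G.m + e < G.numStrategies i * G.m := by
    calc (s : ℕ) * G.m + e < s * G.m + G.m := by omega
      _ = (s + 1) * G.m := by ring
      _ ≤ _ := Nat.mul_le_mul_right _ s.2
  have hs : (s : ℕ) < (List.finRange (G.numStrategies i)).length := by simp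
  have h := List.getElem?_flatMap_take (f := G.strategyBlock i) (r := e) hs
    (by simp [length_strategyBlock])
  rw [List.length_flatMap_take_of_const (G.length_strategyBlock i) hs.le] at h
  rw [add_assoc, add_assoc, G.input_player i (by omega), playerBlock,
    List.getD_eq_getElem?_getD, List.getElem?_append_right (by simp)]
  simp only [List.length_cons, List.length_nil]
  rw [show 3 + (s * G.m + e) - (0 + 1 + 1 + 1) = (s : ℕ) * G.m + e by omega, h]
  simp [strategyBlock]

/-- All coefficient blocks have equal length, so a flat index locates them; the player blocks vary
in length and need a table of positions. -/
theorem input_coeff (e : Fin G.m) (k : Fin (d + 1)) {r : ℕ} (hr : r < 2) :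
    G.input (G.off G.n + (2 * (e * (d + 1) + k) + r))
      = [(G.coeff e k).num, ((G.coeff e k).den : ℤ)].getD r 0 := by
  have he : (e : ℕ) < (List.finRange G.m).length := by simp
  have hk : (k : ℕ) < (List.finRange (d + 1)).length := by
    rw [List.length_finRange]; exact k.2
  have h1 := List.getElem?_flatMap_take (f := G.coeffBlock) (r := k * 2 + r) he
    (by rw [length_coeffBlock]; omega)
  have h2 := List.getElem?_flatMap_take
    (f := fun k => [(G.coeff e k).num, ((G.coeff e k).den : ℤ)]) (r := r) hk (by simpa using hr)
  rw [List.length_flatMap_take_of_const (c := 2) (fun _ => rfl) hk.le] at h2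
  rw [List.length_flatMap_take_of_const G.length_coeffBlock he.le] at h1
  have ho : G.off G.n = 2 + ((List.finRange G.n).flatMap G.playerBlock).length := by
    rw [off, List.take_of_length_le (by simp)]
  rw [input, encode_eq, ho, List.getD_eq_getElem?_getD, List.getD_eq_getElem?_getD,
    List.getElem?_append_right (by simp; omega), List.getElem?_append_right (by simp; omega)]
  simp only [List.length_cons, List.length_nil]
  rw [show 2 + ((List.finRange G.n).flatMap G.playerBlock).length + (2 * (e * (d + 1) + k) + r)
      - (0 + 1 + 1) - ((List.finRange G.n).flatMap G.playerBlock).length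
      = e * ((d + 1) * 2) + (k * 2 + r) by
    rw [show (e : ℕ) * ((d + 1) * 2) = 2 * (e * (d + 1)) by ring]; omega, h1]
  simp only [List.getElem_finRange, Fin.cast_mk, Fin.eta] at h2 ⊢
  rw [coeffBlock, h2]

/-! ### The size of the input -/

theorem length_le_size : G.encode.length ≤ G.size := by
  rw [size, ← List.length_map (f := bitLength)]
  refine List.length_le_sum_of_one_le _ fun z hz => ?_
  obtain ⟨x, -, rfl⟩ := List.mem_map.1 hz
  exact Nat.le_add_left 1 _

theorem natAbs_input_lt (j : ℕ) : (G.input j).natAbs < 2 ^ G.size := by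
  rw [input]
  rcases lt_or_ge j G.encode.length with hj | hj
  · rw [List.getD_eq_getElem _ _ hj]
    have h1 : bitLength G.encode[j] ≤ G.size :=
      List.single_le_sum (by simp) _ (List.mem_map_of_mem (List.getElem_mem hj))
    refine (Nat.lt_size_self _).trans_le (Nat.pow_le_pow_right two_pos ?_)
    rw [bitLength] at h1
    omega
  · rw [List.getD_eq_default _ _ hj]
    simp

end GameInstance

/-! ### Scaling to integers -/

namespace GameInstance

variable {d : ℕ} (G : GameInstance d)

/-- The common denominator of the weights. -/
def weightDen : ℕ := ∏ i, (G.weight i).den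

/-- The common denominator of the coefficients. -/
def coeffDen : ℕ := ∏ q : Fin (G.m * (d + 1)), (G.coeff q.divNat q.modNat).den

def intWeight (i : Fin G.n) : ℤ := (G.weight i).num * ((G.weightDen : ℤ) / (G.weight i).den)

def intCoeff (e : Fin G.m) (k : Fin (d + 1)) : ℤ :=
  (G.coeff e k).num * ((G.coeffDen : ℤ) / (G.coeff e k).den)

/-- The power `d - k` of `weightDen` makes all monomials scale by the same factor when the weights
are multiplied by `weightDen`. -/
def intCost (e : Fin G.m) (x : ℤ) : ℤ :=
  ∑ k : Fin (d + 1), G.intCoeff e k * (G.weightDen : ℤ) ^ (d - k) * x ^ ((k : ℕ) + 1)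

def intLoad (P : Fin G.n → Finset (Fin G.m)) (S : Finset (Fin G.n)) (e : Fin G.m) : ℤ :=
  ∑ j ∈ S, if e ∈ P j then G.intWeight j else 0

/-- The scaled marginal cost of player `i` if she plays `Q` against `P`. -/
def intDevCost (P : Fin G.n → Finset (Fin G.m)) (i : Fin G.n) (Q : Finset (Fin G.m)) : ℤ :=
  ∑ e, (if e ∈ Q then 1 else 0) * (G.intCost e (G.intLoad P (Finset.univ.erase i) e + G.intWeight i)
    - G.intCost e (G.intLoad P (Finset.univ.erase i) e))

/-- The scaled weights and joint cost functions as real numbers and functions. -/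
def realWeight (i : Fin G.n) : ℝ := G.intWeight i

noncomputable def realCost (e : Fin G.m) (x : ℝ) : ℝ :=
  ∑ k : Fin (d + 1), (G.intCoeff e k : ℝ) * (G.weightDen : ℝ) ^ (d - k) * x ^ ((k : ℕ) + 1)

theorem weightDen_pos : 0 < G.weightDen := Finset.prod_pos fun i _ => (G.weight i).den_pos

theorem coeffDen_pos : 0 < G.coeffDen := Finset.prod_pos fun _ _ => Rat.den_pos _

theorem den_dvd_weightDen (i : Fin G.n) : (G.weight i).den ∣ G.weightDen :=
  Finset.dvd_prod_of_mem (fun i => (G.weight i).den) (Finset.mem_univ i)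

theorem den_dvd_coeffDen (e : Fin G.m) (k : Fin (d + 1)) : (G.coeff e k).den ∣ G.coeffDen := by
  have h := Finset.dvd_prod_of_mem
    (fun q : Fin (G.m * (d + 1)) => (G.coeff q.divNat q.modNat).den)
    (Finset.mem_univ (finProdFinEquiv (e, k)))
  have h2 := finProdFinEquiv.symm_apply_apply (e, k)
  rw [finProdFinEquiv_symm_apply, Prod.mk.injEq] at h2
  rwa [h2.1, h2.2] at h

theorem rat_scale (q : ℚ) {D : ℕ} (h : q.den ∣ D) :
    ((q.num * ((D : ℤ) / q.den) : ℤ) : ℝ) = D * q := by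
  have hd : (q.den : ℝ) ≠ 0 := by exact_mod_cast q.den_nz
  rw [Int.cast_mul, Int.cast_div (by exact_mod_cast h) (by exact_mod_cast q.den_nz)]
  push_cast
  rw [mul_div_left_comm, Rat.cast_def q]

theorem realWeight_eq (i : Fin G.n) : G.realWeight i = G.weightDen * (G.weight i : ℝ) :=
  rat_scale _ (G.den_dvd_weightDen i)

theorem intCoeff_cast (e : Fin G.m) (k : Fin (d + 1)) :
    (G.intCoeff e k : ℝ) = G.coeffDen * (G.coeff e k : ℝ) :=
  rat_scale _ (G.den_dvd_coeffDen e k)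

theorem realWeight_pos (i : Fin G.n) : 0 < G.realWeight i := by
  rw [realWeight_eq]
  exact mul_pos (by exact_mod_cast G.weightDen_pos) (by exact_mod_cast G.weight_pos i)

theorem intWeight_pos (i : Fin G.n) : 0 < G.intWeight i := by
  exact Int.cast_pos.1 (G.realWeight_pos i)

theorem intCoeff_nonneg (e : Fin G.m) (k : Fin (d + 1)) : 0 ≤ G.intCoeff e k := by
  have : (0 : ℝ) ≤ G.intCoeff e k := by
    rw [intCoeff_cast]
    exact mul_nonneg (Nat.cast_nonneg _) (by exact_mod_cast G.coeff_nonneg e k)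
  exact_mod_cast this

theorem isCost_realCost (e : Fin G.m) : IsCost d (G.realCost e) :=
  IsCost.sum _ fun k _ => IsCost.monomial (Nat.lt_succ_iff.1 k.2)
    (mul_nonneg (by exact_mod_cast G.intCoeff_nonneg e k) (by positivity))

theorem jointCost_toGame (e : Fin G.m) (x : ℝ) :
    G.toGame.jointCost e x = ∑ k : Fin (d + 1), (G.coeff e k : ℝ) * x ^ ((k : ℕ) + 1) := by
  simp only [CongestionGame.jointCost, toGame, Polynomial.eval_finsetSum, Polynomial.eval_monomial,
    Finset.mul_sum]
  exact Finset.sum_congr rfl fun k _ => by ring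

theorem realCost_scale (e : Fin G.m) (x : ℝ) :
    G.realCost e (G.weightDen * x)
      = G.coeffDen * (G.weightDen : ℝ) ^ (d + 1) * G.toGame.jointCost e x := by
  rw [jointCost_toGame, realCost, Finset.mul_sum]
  refine Finset.sum_congr rfl fun k _ => ?_
  have hk : (G.weightDen : ℝ) ^ (d + 1) = G.weightDen ^ (d - k) * G.weightDen ^ ((k : ℕ) + 1) := by
    rw [← pow_add]
    congr 1
    have := k.2
    omega
  rw [intCoeff_cast, mul_pow, hk]
  ring

theorem intCost_cast (e : Fin G.m) (x : ℤ) : (G.intCost e x : ℝ) = G.realCost e x := by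
  simp [intCost, realCost]

theorem intLoad_cast (P : Fin G.n → Finset (Fin G.m)) (S : Finset (Fin G.n)) (e : Fin G.m) :
    (G.intLoad P S e : ℝ) = load G.realWeight P S e := by
  simp only [intLoad, load, Int.cast_sum]
  exact Finset.sum_congr rfl fun j _ => by split_ifs <;> simp [realWeight]

theorem intDevCost_cast (P : Fin G.n → Finset (Fin G.m)) (i : Fin G.n) (Q : Finset (Fin G.m)) :
    (G.intDevCost P i Q : ℝ) = devCost G.realWeight G.realCost P i Q := by
  rw [devCost_eq_sum, intDevCost, Int.cast_sum, ← Finset.sum_filter_add_sum_filter_not _ (· ∈ Q),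
    Finset.sum_eq_zero (s := Finset.univ.filter (· ∉ Q)), add_zero]
  · refine Finset.sum_congr (by ext; simp) fun e he => ?_
    rw [if_pos (by simpa using he)]
    push_cast
    rw [intCost_cast, intCost_cast, Int.cast_add, intLoad_cast, one_mul, realWeight]
  · intro e he
    rw [if_neg (by simpa using he)]
    simp

theorem devCost_scale (P : Fin G.n → Finset (Fin G.m)) (i : Fin G.n) (Q : Finset (Fin G.m)) :
    devCost G.realWeight G.realCost P i Q
      = G.coeffDen * (G.weightDen : ℝ) ^ (d + 1)
        * devCost G.toGame.weight G.toGame.jointCost P i Q := by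
  have hl : ∀ S e, load G.realWeight P S e = G.weightDen * load G.toGame.weight P S e := by
    intro S e
    rw [load, load, Finset.mul_sum]
    refine Finset.sum_congr rfl fun j _ => ?_
    split_ifs
    · exact G.realWeight_eq j
    · simp
  have hw : G.realWeight i = G.weightDen * G.toGame.weight i := G.realWeight_eq i
  rw [devCost_eq_sum, devCost_eq_sum, Finset.mul_sum]
  refine Finset.sum_congr rfl fun e _ => ?_
  rw [hl, hw, ← mul_add, realCost_scale, realCost_scale]
  ring

/-- The strategies of player `i` as a set. -/
def strategySet (i : Fin G.n) : Set (Finset (Fin G.m)) := Set.range (G.strategy i)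

/-- Scaling multiplies all marginal costs by one positive factor, which cancels from the equilibrium
condition. -/
theorem isApproxPNE_of_phaseInv {pr : Params d} {P : Fin G.n → Finset (Fin G.m)}
    {F : Finset (Fin G.n)}
    (h : PhaseInv G.realWeight G.realCost G.strategySet pr P F 0) :
    G.toGame.IsApproxPNE ((d + 1) * (8 * pr.p)) P := by
  have hmem : ∀ i Q, Q ∈ G.toGame.strategies i ↔ Q ∈ G.strategySet i := fun i Q => by
    simp [toGame, strategySet]
  refine G.toGame.isApproxPNE_of_devCost (fun i => (hmem i _).2 (h.mem i)) (by positivity) ?_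
  intro i Q hQ
  have h1 := h.approx (fun i => (G.realWeight_pos i).le) G.isCost_realCost i ((hmem i Q).1 hQ)
  rw [devCost_scale, devCost_scale] at h1
  have hs : (0 : ℝ) < G.coeffDen * (G.weightDen : ℝ) ^ (d + 1) :=
    mul_pos (by exact_mod_cast G.coeffDen_pos) (pow_pos (by exact_mod_cast G.weightDen_pos) _)
  refine le_of_mul_le_mul_left ?_ hs
  linarith

/-! ### Bounds for the numbers that occur -/

def numeratorSum : ℤ := ∑ i, (G.weight i).num

def coeffNumeratorSum : ℤ := ∑ q : Fin (G.m * (d + 1)), (G.coeff q.divNat q.modNat).num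

/-- The first threshold, an upper bound for all costs. -/
def initialBound : ℤ :=
  G.coeffNumeratorSum * G.coeffDen * (G.weightDen : ℤ) ^ d
    * (G.numeratorSum * G.weightDen) ^ (d + 1)

theorem intCost_nonneg (e : Fin G.m) {x : ℤ} (hx : 0 ≤ x) : 0 ≤ G.intCost e x :=
  Finset.sum_nonneg fun k _ => mul_nonneg
    (mul_nonneg (G.intCoeff_nonneg e k) (by positivity)) (by positivity)

theorem intCost_mono (e : Fin G.m) {x y : ℤ} (hx : 0 ≤ x) (hxy : x ≤ y) :
    G.intCost e x ≤ G.intCost e y :=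
  Finset.sum_le_sum fun k _ => mul_le_mul_of_nonneg_left (pow_le_pow_left₀ hx hxy _)
    (mul_nonneg (G.intCoeff_nonneg e k) (by positivity))

theorem mul_div_den_le (q : ℚ) (hq : 0 ≤ q) (D : ℕ) : q.num * ((D : ℤ) / q.den) ≤ q.num * D :=
  mul_le_mul_of_nonneg_left (Int.ediv_le_self _ (Int.natCast_nonneg _)) (Rat.num_nonneg.2 hq)

theorem sum_intWeight_le : ∑ i, G.intWeight i ≤ G.numeratorSum * G.weightDen := by
  rw [numeratorSum, Finset.sum_mul]
  exact Finset.sum_le_sum fun i _ => mul_div_den_le _ (G.weight_pos i).le _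

theorem intLoad_nonneg (P : Fin G.n → Finset (Fin G.m)) (S : Finset (Fin G.n)) (e : Fin G.m) :
    0 ≤ G.intLoad P S e :=
  Finset.sum_nonneg fun j _ => by split_ifs <;> simp [(G.intWeight_pos j).le]

theorem intLoad_add_le (P : Fin G.n → Finset (Fin G.m)) (i : Fin G.n) (e : Fin G.m) :
    G.intLoad P (Finset.univ.erase i) e + G.intWeight i ≤ G.numeratorSum * G.weightDen := by
  refine le_trans ?_ G.sum_intWeight_le
  rw [← Finset.sum_erase_add _ _ (Finset.mem_univ i)]
  refine add_le_add_left (Finset.sum_le_sum fun j _ => ?_) _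
  split_ifs <;> simp [(G.intWeight_pos j).le]

theorem intDiff_nonneg (P : Fin G.n → Finset (Fin G.m)) (i : Fin G.n) (e : Fin G.m) :
    0 ≤ G.intCost e (G.intLoad P (Finset.univ.erase i) e + G.intWeight i)
      - G.intCost e (G.intLoad P (Finset.univ.erase i) e) :=
  sub_nonneg.2 (G.intCost_mono e (G.intLoad_nonneg _ _ _) (by linarith [G.intWeight_pos i]))

/-- The subtracted terms are dropped and loads are bounded by `W`. Since `W` and `weightDen` are at
least one, all exponents may be raised to their maxima. -/
theorem sum_intDiff_le (P : Fin G.n → Finset (Fin G.m)) (i : Fin G.n) :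
    ∑ e, (G.intCost e (G.intLoad P (Finset.univ.erase i) e + G.intWeight i)
      - G.intCost e (G.intLoad P (Finset.univ.erase i) e)) ≤ G.initialBound := by
  set W := G.numeratorSum * G.weightDen with hW
  have hW1 : 1 ≤ W := by
    have h1 := G.intWeight_pos i
    have h2 := Finset.single_le_sum (fun j _ => (G.intWeight_pos j).le) (Finset.mem_univ i)
    have h3 := G.sum_intWeight_le
    omega
  have hD1 : (1 : ℤ) ≤ G.weightDen := by exact_mod_cast G.weightDen_pos
  have h1 : ∀ e, G.intCost e (G.intLoad P (Finset.univ.erase i) e + G.intWeight i)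
      - G.intCost e (G.intLoad P (Finset.univ.erase i) e)
      ≤ ∑ k : Fin (d + 1), (G.coeff e k).num * (G.coeffDen * (G.weightDen : ℤ) ^ d * W ^ (d + 1)) := by
    intro e
    refine (sub_le_self _ (G.intCost_nonneg e (G.intLoad_nonneg _ _ _))).trans ?_
    refine (G.intCost_mono e (add_nonneg (G.intLoad_nonneg _ _ _) (G.intWeight_pos i).le)
      (G.intLoad_add_le P i e)).trans ?_
    refine Finset.sum_le_sum fun k _ => ?_
    have hk := k.2
    have a1 := mul_div_den_le _ (G.coeff_nonneg e k) G.coeffDen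
    have a2 : (G.weightDen : ℤ) ^ (d - k) ≤ (G.weightDen : ℤ) ^ d :=
      pow_le_pow_right₀ hD1 (Nat.sub_le _ _)
    have a3 : W ^ ((k : ℕ) + 1) ≤ W ^ (d + 1) := pow_le_pow_right₀ hW1 (by omega)
    have a0 : 0 ≤ (G.coeff e k).num := Rat.num_nonneg.2 (G.coeff_nonneg e k)
    have a4 : 0 ≤ W ^ ((k : ℕ) + 1) := by positivity
    calc _ ≤ (G.coeff e k).num * G.coeffDen * (G.weightDen : ℤ) ^ d * W ^ (d + 1) := by
          gcongr
          exact a1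
      _ = _ := by ring
  refine (Finset.sum_le_sum fun e _ => h1 e).trans_eq ?_
  simp only [← Finset.sum_mul]
  rw [initialBound, coeffNumeratorSum]
  have h2 : ∑ q : Fin (G.m * (d + 1)), (G.coeff q.divNat q.modNat).num
      = ∑ e, ∑ k, (G.coeff e k).num := by
    rw [← Fintype.sum_prod_type' (fun e k => (G.coeff e k).num)]
    exact Fintype.sum_equiv finProdFinEquiv.symm _ _ fun q => rfl
  rw [h2]
  ring

end GameInstance

/-! ### The program -/

namespace EquilibriumProgram

open Expr Program

/- Arrays: `0` input, `1` positions of the current strategies, `2` marks of the fixed players,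
`3` positions of the data of the players. Variables: `4` and `5` common denominators of weights and
coefficients, `6` position of the coefficients, `7` and `8` sums of the numerators of weights and
coefficients, `9` threshold, `10` sweep, `11` player, `12` strategy, `13` resource, `14` player on
that resource, `15` load, `16` cost of the current strategy, `17` cost of the new strategy,
`18` marginal cost on a resource. -/

def playersE : Expr := read 0 (const 0)

def resourcesE : Expr := read 0 (const 1)

def weightE (j : Expr) : Expr :=
  mul (read 0 (read 3 j)) (div (var 4) (read 0 (add (read 3 j) (const 1))))

def numStrategiesE (i : Expr) : Expr := read 0 (add (read 3 i) (const 2))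

def bitE (i s e : Expr) : Expr :=
  read 0 (add (add (add (read 3 i) (const 3)) (mul s resourcesE)) e)

def coeffPosE (q : Expr) : Expr := add (var 6) (mul (const 2) q)

def coeffE (q : Expr) : Expr :=
  mul (read 0 (coeffPosE q)) (div (var 5) (read 0 (add (coeffPosE q) (const 1))))

def powE (x : Expr) : ℕ → Expr
  | 0 => const 1
  | k + 1 => mul (powE x k) x

def sumE (f : ℕ → Expr) : ℕ → Expr
  | 0 => const 0
  | k + 1 => add (sumE f k) (f k)

def costE (d : ℕ) (e x : Expr) : Expr :=
  sumE (fun k => mul (mul (coeffE (add (mul e (const (d + 1 : ℕ))) (const k)))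
    (powE (var 4) (d - k))) (powE x (k + 1))) (d + 1)

/-- The load of resource `13` without player `11`. -/
def loadP : Program :=
  .seq (.assign 15 (const 0) (sub (const 0)
      (mul (weightE (var 11)) (bitE (var 11) (read 1 (var 11)) (var 13)))))
    (.forTo 14 playersE (.assign 15 (const 0) (add (var 15)
      (mul (weightE (var 14)) (bitE (var 14) (read 1 (var 14)) (var 13))))))

/-- The costs of player `11` for her current strategy and for strategy `12`. -/
def costP (d : ℕ) : Program :=
  .seq (.assign 16 (const 0) (const 0)) (.seq (.assign 17 (const 0) (const 0))
    (.forTo 13 resourcesE (.seq loadP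
      (.seq (.assign 18 (const 0) (sub (costE d (var 13) (add (var 15) (weightE (var 11))))
          (costE d (var 13) (var 15))))
        (.seq (.assign 16 (const 0) (add (var 16)
            (mul (bitE (var 11) (read 1 (var 11)) (var 13)) (var 18))))
          (.assign 17 (const 0) (add (var 17)
            (mul (bitE (var 11) (var 12) (var 13)) (var 18)))))))))

variable {d : ℕ}

def ratioE (pr : Params d) : Expr := add (mul (const pr.K) playersE) (const 2)

def nextE (pr : Params d) : Expr := div (var 9) (ratioE pr)

/-- Player `11` moves to strategy `12` if this is allowed. -/
def moveP (pr : Params d) : Program :=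
  .seq (costP d) (.ite (sub (const 1) (read 2 (var 11)))
    (.ite (sub (sub (var 16) (var 17)) (nextE pr))
      (.ite (sub (var 9) (var 16)) (.assign 1 (var 11) (var 12))
        (.ite (sub (var 16) (mul (const pr.p) (var 17))) (.assign 1 (var 11) (var 12)) .skip))
      .skip) .skip)

def sweepP (pr : Params d) : Program :=
  .forTo 11 playersE (.forTo 12 (numStrategiesE (var 11)) (moveP pr))

/-- Strategy `0` only provides `costP` with a valid position; just the cost of the current strategy
is used. -/
def fixP (d : ℕ) : Program :=
  .forTo 11 playersE (.seq (.assign 12 (const 0) (const 0)) (.seq (costP d)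
    (.ite (add (sub (var 16) (var 9)) (const 1)) (.assign 2 (var 11) (const 1)) .skip)))

/-- One more than the number of moves permitted by `Moves.count_le`. -/
def sweepsE (pr : Params d) : Expr :=
  add (mul (mul (const pr.τ) playersE) (ratioE pr)) (const 1)

def phaseP (pr : Params d) : Program :=
  .seq (.forTo 10 (sweepsE pr) (sweepP pr))
    (.seq (fixP d) (.assign 9 (const 0) (nextE pr)))

def preparePlayersP : Program :=
  .seq (.assign 6 (const 0) (const 2)) (.seq (.assign 4 (const 0) (const 1))
    (.forTo 11 playersE (.seq (.assign 3 (var 11) (var 6))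
      (.seq (.assign 4 (const 0) (mul (var 4) (read 0 (add (var 6) (const 1)))))
        (.seq (.assign 7 (const 0) (add (var 7) (read 0 (var 6))))
          (.assign 6 (const 0) (add (var 6)
            (add (const 3) (mul (read 0 (add (var 6) (const 2))) resourcesE)))))))))

def prepareCoeffsP (d : ℕ) : Program :=
  .seq (.assign 5 (const 0) (const 1))
    (.forTo 11 (mul resourcesE (const (d + 1 : ℕ)))
      (.seq (.assign 5 (const 0) (mul (var 5) (read 0 (add (coeffPosE (var 11)) (const 1)))))
        (.assign 8 (const 0) (add (var 8) (read 0 (coeffPosE (var 11)))))))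

def initialE (d : ℕ) : Expr :=
  mul (mul (mul (var 8) (var 5)) (powE (var 4) d)) (powE (mul (var 7) (var 4)) (d + 1))

/-- Memory starts at zero outside the input, so initially everyone plays her first strategy, nobody
is marked as fixed, and the sums in `7` and `8` are empty. -/
def mainP (pr : Params d) : Program :=
  .seq preparePlayersP (.seq (prepareCoeffsP d)
    (.seq (.assign 9 (const 0) (initialE d)) (.loop (var 9) (phaseP pr))))

/-- Phases, sweeps, players, strategies, resources, players on a resource. -/
theorem depth_mainP (pr : Params d) : (mainP pr).depth = 6 := rfl

/-! ### Correctness of the parts -/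

theorem eval_powE (σ : Mem) (x : Expr) (k : ℕ) : (powE x k).eval σ = x.eval σ ^ k := by
  induction k with
  | zero => simp [powE]
  | succ k ih => rw [powE, eval_mul, ih, pow_succ]

theorem eval_sumE (σ : Mem) (f : ℕ → Expr) (k : ℕ) :
    (sumE f k).eval σ = ∑ j ∈ Finset.range k, (f j).eval σ := by
  induction k with
  | zero => simp [sumE]
  | succ k ih => rw [sumE, eval_add, ih, Finset.sum_range_succ]

theorem sum_filter_val_lt_succ {M : Type*} [AddCommMonoid M] {n k : ℕ} (hk : k < n)
    (f : Fin n → M) : ∑ j with j.val < k + 1, f j = ∑ j with j.val < k, f j + f ⟨k, hk⟩ := by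
  have h : (Finset.univ.filter fun j : Fin n => j.val < k + 1)
      = insert ⟨k, hk⟩ (Finset.univ.filter fun j : Fin n => j.val < k) := by
    ext j
    simp only [Finset.mem_filter, Finset.mem_univ, true_and, Finset.mem_insert, Fin.ext_iff]
    omega
  rw [h, Finset.sum_insert (by simp), add_comm]

theorem prod_filter_val_lt_succ {M : Type*} [CommMonoid M] {n k : ℕ} (hk : k < n)
    (f : Fin n → M) : ∏ j with j.val < k + 1, f j = (∏ j with j.val < k, f j) * f ⟨k, hk⟩ :=
  sum_filter_val_lt_succ (M := Additive M) hk f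

theorem filter_val_lt_self (n : ℕ) :
    (Finset.univ.filter fun j : Fin n => j.val < n) = Finset.univ :=
  Finset.filter_true_of_mem fun j _ => j.2

/-- The memories `σ` and `σ'` differ at most in the arrays in `S`. -/
def AgreeOff (S : List ℕ) (σ σ' : Mem) : Prop := ∀ a, a ∉ S → σ' a = σ a

theorem AgreeOff.refl (S : List ℕ) (σ : Mem) : AgreeOff S σ σ := fun _ _ => rfl

theorem AgreeOff.write {S : List ℕ} {σ σ' : Mem} (h : AgreeOff S σ σ') {a : ℕ} (ha : a ∈ S)
    (i z : ℤ) : AgreeOff S σ (σ'.write a i z) := fun b hb => by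
  rw [Mem.write_of_ne (ne_of_mem_of_not_mem ha hb).symm, h b hb]

theorem AgreeOff.mono {S T : List ℕ} {σ σ' : Mem} (h : AgreeOff S σ σ') (hS : S ⊆ T) :
    AgreeOff T σ σ' := fun a ha => h a fun hm => ha (hS hm)

theorem AgreeOff.trans {S T : List ℕ} {σ σ' σ'' : Mem} (h : AgreeOff S σ σ')
    (h' : AgreeOff T σ' σ'') (hT : T ⊆ S) : AgreeOff S σ σ'' := fun a ha => by
  rw [h' a fun hm => ha (hT hm), h a ha]

/-- The memory after the preparations. -/
structure Ready (G : GameInstance d) (σ : Mem) : Prop where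
  input : ∀ j : ℕ, σ 0 j = G.input j
  off : ∀ i : Fin G.n, σ 3 (i : ℕ) = G.off i
  weightDen : σ 4 0 = G.weightDen
  coeffDen : σ 5 0 = G.coeffDen
  coeffPos : σ 6 0 = G.off G.n

/-- The memory holds the strategies `s`. -/
def Holds (G : GameInstance d) (s : (i : Fin G.n) → Fin (G.numStrategies i)) (σ : Mem) : Prop :=
  ∀ i : Fin G.n, σ 1 (i : ℕ) = (s i : ℕ)

/-- The outcome given by positions in the lists of strategies. -/
abbrev outcome (G : GameInstance d) (s : (i : Fin G.n) → Fin (G.numStrategies i)) :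
    Fin G.n → Finset (Fin G.m) := fun i => G.strategy i (s i)

/-- The memory bound `V` and the bound `N` for the number of iterations are large enough. -/
structure Fits (G : GameInstance d) (pr : Params d) (V N : ℕ) : Prop where
  two_le : 2 ≤ V
  N_le : N ≤ V
  input_le : ∀ j, (G.input j).natAbs ≤ V
  off_le : G.off G.n ≤ V
  weightDen_le : G.weightDen ≤ V
  coeffDen_le : G.coeffDen ≤ V
  coeffNumeratorSum_le : G.coeffNumeratorSum ≤ V
  numeratorSum_le : G.numeratorSum * G.weightDen ≤ V
  initialBound_le : G.initialBound ≤ V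
  players_le : G.n ≤ N
  coeffs_le : G.m * (d + 1) ≤ N
  numStrategies_le : 0 < G.m → ∀ i, G.numStrategies i ≤ N
  sweeps_le : pr.τ * G.n * pr.ratio G.n + 1 ≤ N
  size_le : Nat.size G.initialBound.natAbs ≤ N

namespace Ready

variable {G : GameInstance d} {σ σ' : Mem}

theorem congr (h : Ready G σ) {S : List ℕ} (hσ : AgreeOff S σ σ')
    (hS : 0 ∉ S ∧ 3 ∉ S ∧ 4 ∉ S ∧ 5 ∉ S ∧ 6 ∉ S) : Ready G σ' where
  input j := by rw [hσ 0 hS.1, h.input]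
  off i := by rw [hσ 3 hS.2.1, h.off]
  weightDen := by rw [hσ 4 hS.2.2.1, h.weightDen]
  coeffDen := by rw [hσ 5 hS.2.2.2.1, h.coeffDen]
  coeffPos := by rw [hσ 6 hS.2.2.2.2, h.coeffPos]

theorem eval_playersE (h : Ready G σ) : playersE.eval σ = G.n := h.input 0

theorem eval_resourcesE (h : Ready G σ) : resourcesE.eval σ = G.m := h.input 1

theorem eval_weightE (h : Ready G σ) {j : Expr} {i : Fin G.n} (hj : j.eval σ = (i : ℕ)) :
    (weightE j).eval σ = G.intWeight i := by
  have h1 := h.input (G.off i + 1)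
  push_cast at h1
  simp only [weightE, eval_mul, eval_div, eval_read, eval_add, eval_const, eval_var, hj, h.off,
    h.input, h1, h.weightDen, G.input_weight_num, G.input_weight_den, GameInstance.intWeight]

theorem eval_numStrategiesE (h : Ready G σ) {j : Expr} {i : Fin G.n} (hj : j.eval σ = (i : ℕ)) :
    (numStrategiesE j).eval σ = G.numStrategies i := by
  have h1 := h.input (G.off i + 2)
  push_cast at h1
  simp only [numStrategiesE, eval_read, eval_add, eval_const, hj, h.off, h1, G.input_numStrategies]

theorem eval_bitE (h : Ready G σ) {i' s' e' : Expr} {i : Fin G.n} {s : Fin (G.numStrategies i)}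
    {e : Fin G.m} (hi : i'.eval σ = (i : ℕ)) (hs : s'.eval σ = (s : ℕ)) (he : e'.eval σ = (e : ℕ)) :
    (bitE i' s' e').eval σ = if e ∈ G.strategy i s then 1 else 0 := by
  have h1 := h.input (G.off i + 3 + s * G.m + e)
  push_cast at h1
  simp only [bitE, eval_read, eval_add, eval_mul, eval_const, hi, hs, he, h.off, h.eval_resourcesE,
    h1, G.input_strategy]

theorem eval_coeffE (h : Ready G σ) {q : Expr} {e : Fin G.m} {k : Fin (d + 1)}
    (hq : q.eval σ = ((e * (d + 1) + k : ℕ) : ℤ)) :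
    (coeffE q).eval σ = G.intCoeff e k := by
  have h1 := h.input (G.off G.n + (2 * (e * (d + 1) + k) + 0))
  have h2 := h.input (G.off G.n + (2 * (e * (d + 1) + k) + 1))
  rw [G.input_coeff e k (by omega)] at h1 h2
  simp only [coeffE, coeffPosE, eval_mul, eval_div, eval_read, eval_add, eval_const, eval_var, hq,
    h.coeffDen, h.coeffPos, GameInstance.intCoeff]
  push_cast at h1 h2 ⊢
  rw [add_zero] at h1
  rw [← add_assoc] at h2
  rw [h1, h2]
  rfl

theorem eval_costE (h : Ready G σ) {e' x : Expr} {e : Fin G.m} (he : e'.eval σ = (e : ℕ)) :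
    (costE d e' x).eval σ = G.intCost e (x.eval σ) := by
  rw [costE, eval_sumE, Finset.sum_range, GameInstance.intCost]
  refine Finset.sum_congr rfl fun k _ => ?_
  rw [eval_mul, eval_mul, eval_powE, eval_powE, eval_var, h.weightDen,
    h.eval_coeffE (e := e) (k := k) (by simp [he])]

end Ready

section

variable {G : GameInstance d} {pr : Params d} {V N : ℕ} {σ : Mem}
  {s : (i : Fin G.n) → Fin (G.numStrategies i)} {i : Fin G.n}

theorem spec_loadP (hf : Fits G pr V N) (hr : Ready G σ) (hs : Holds G s σ)
    (hi : σ 11 0 = (i : ℕ)) {e : Fin G.m} (he : σ 13 0 = (e : ℕ)) :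
    Spec V N loadP σ fun σ' => σ' 15 0 = G.intLoad (outcome G s) (Finset.univ.erase i) e
      ∧ AgreeOff [14, 15] σ σ' := by
  set f : Fin G.n → ℤ := fun j => if e ∈ outcome G s j then G.intWeight j else 0 with hfdef
  have hf0 : ∀ j, 0 ≤ f j := fun j => by
    rw [hfdef]; dsimp only; split_ifs <;> simp [(G.intWeight_pos j).le]
  have hsum : ∀ S : Finset (Fin G.n), ∑ j ∈ S, f j ≤ V := fun S =>
    calc ∑ j ∈ S, f j ≤ ∑ j, G.intWeight j := by
          refine (Finset.sum_le_sum_of_subset_of_nonneg (Finset.subset_univ S)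
            fun j _ _ => hf0 j).trans (Finset.sum_le_sum fun j _ => ?_)
          rw [hfdef]; dsimp only; split_ifs <;> simp [(G.intWeight_pos j).le]
      _ ≤ V := G.sum_intWeight_le.trans hf.numeratorSum_le
  have hi1 : f i ≤ V := by simpa using hsum {i}
  have hterm : ∀ {σ' : Mem} {v : ℕ} {j : Fin G.n}, AgreeOff [14, 15] σ σ' → σ' v 0 = (j : ℕ) →
      (mul (weightE (var v)) (bitE (var v) (read 1 (var v)) (var 13))).eval σ' = f j := by
    intro σ' v j hσ' hv
    have hr' := hr.congr hσ' (by decide)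
    have h1 : (read 1 (var v)).eval σ' = (s j : ℕ) := by
      rw [eval_read, eval_var, hv, hσ' 1 (by decide), hs j]
    have h2 : (var 13).eval σ' = (e : ℕ) := by rw [eval_var, hσ' 13 (by decide), he]
    rw [eval_mul, hr'.eval_weightE (j := var v) (i := j) hv,
      hr'.eval_bitE (i' := var v) (i := j) hv h1 h2, hfdef]
    simp
  refine Spec.seq (Spec.assign ?_ ?_)
  · rw [eval_sub, hterm (AgreeOff.refl _ _) hi, eval_const]
    have := hf0 i
    omega
  rw [eval_sub, hterm (AgreeOff.refl _ _) hi]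
  -- Starting from `-f i` excludes player `i` from the sum over everyone without a test in the loop.
  refine Spec.forTo (n := G.n)
    (fun k σ' => AgreeOff [14, 15] σ σ' ∧ σ' 15 0 = ∑ j with j.val < k, f j - f i)
    hf.players_le (hf.players_le.trans hf.N_le) ⟨?_, ?_⟩ ?_ ?_ ?_
  · exact ((AgreeOff.refl _ _).write (by decide) _ _).write (by decide) _ _
  · rw [Mem.write_of_ne (by decide), eval_const, Mem.write_self]
    simp
  · rintro k σ' ⟨hσ', -⟩ -
    exact (hr.congr hσ' (by decide)).eval_playersE
  · rintro k σ' hk ⟨hσ', h15⟩ hv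
    have hval : (add (var 15) (mul (weightE (var 14))
        (bitE (var 14) (read 1 (var 14)) (var 13)))).eval σ'
        = ∑ j with j.val < k + 1, f j - f i := by
      rw [eval_add, hterm (j := ⟨k, hk⟩) hσ' hv, eval_var, h15, sum_filter_val_lt_succ hk]
      ring
    refine Spec.assign ?_ ⟨?_, ?_, ?_⟩
    · rw [hval]
      have h1 := hsum (Finset.univ.filter fun j => j.val < k + 1)
      have h2 : 0 ≤ ∑ j with j.val < k + 1, f j := Finset.sum_nonneg fun j _ => hf0 j
      have h3 := hf0 i
      omega
    · rw [Mem.write_of_ne (by decide), hv]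
    · exact (hσ'.write (by decide) _ _).write (by decide) _ _
    · rw [Mem.write_of_ne (by decide), eval_const, Mem.write_self, hval]
  · rintro σ' ⟨hσ', h15⟩
    refine ⟨?_, hσ'⟩
    rw [h15, filter_val_lt_self, GameInstance.intLoad,
      ← Finset.sum_erase_add _ _ (Finset.mem_univ i), add_sub_cancel_right]

theorem spec_costP (hf : Fits G pr V N) (hr : Ready G σ) (hs : Holds G s σ)
    (hi : σ 11 0 = (i : ℕ)) {q : Fin (G.numStrategies i)} (hq : σ 12 0 = (q : ℕ)) :
    Spec V N (costP d) σ fun σ' => σ' 16 0 = G.intDevCost (outcome G s) i (outcome G s i)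
      ∧ σ' 17 0 = G.intDevCost (outcome G s) i (G.strategy i q)
      ∧ AgreeOff [13, 14, 15, 16, 17, 18] σ σ' := by
  set δ : Fin G.m → ℤ := fun e =>
    G.intCost e (G.intLoad (outcome G s) (Finset.univ.erase i) e + G.intWeight i)
      - G.intCost e (G.intLoad (outcome G s) (Finset.univ.erase i) e) with hδ
  have hδ0 : ∀ e, 0 ≤ δ e := G.intDiff_nonneg (outcome G s) i
  have hδ1 : ∑ e, δ e ≤ V := (G.sum_intDiff_le (outcome G s) i).trans hf.initialBound_le
  have hδe : ∀ e, δ e ≤ V := fun e =>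
    (Finset.single_le_sum (fun e _ => hδ0 e) (Finset.mem_univ e)).trans hδ1
  -- Partial sums of nonnegative increments stay below the total, so no intermediate value exceeds
  -- `V`.
  have hpart : ∀ (Q : Finset (Fin G.m)) (S : Finset (Fin G.m)),
      (∑ e ∈ S, (if e ∈ Q then 1 else 0) * δ e).natAbs ≤ V := by
    intro Q S
    have h0 : ∀ e, 0 ≤ (if e ∈ Q then 1 else 0) * δ e := fun e => by
      split_ifs <;> simp [hδ0 e]
    have h1 : ∑ e ∈ S, (if e ∈ Q then 1 else 0) * δ e ≤ ∑ e, δ e := by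
      refine (Finset.sum_le_sum_of_subset_of_nonneg (Finset.subset_univ S)
        fun e _ _ => h0 e).trans (Finset.sum_le_sum fun e _ => ?_)
      split_ifs <;> simp [hδ0 e]
    have h2 : 0 ≤ ∑ e ∈ S, (if e ∈ Q then 1 else 0) * δ e := Finset.sum_nonneg fun e _ => h0 e
    omega
  have hmN : G.m ≤ N := (Nat.le_mul_of_pos_right _ (Nat.succ_pos d)).trans hf.coeffs_le
  refine Spec.seq (Spec.assign (by simp) (Spec.seq (Spec.assign (by simp) ?_)))
  refine Spec.forTo (n := G.m)
    (fun k σ' => AgreeOff [13, 14, 15, 16, 17, 18] σ σ'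
      ∧ σ' 16 0 = ∑ e with e.val < k, (if e ∈ outcome G s i then 1 else 0) * δ e
      ∧ σ' 17 0 = ∑ e with e.val < k, (if e ∈ G.strategy i q then 1 else 0) * δ e)
    hmN (hmN.trans hf.N_le) ⟨?_, ?_, ?_⟩ ?_ ?_ ?_
  · exact (((AgreeOff.refl _ _).write (by decide) _ _).write (by decide) _ _).write (by decide) _ _
  · rw [Mem.write_of_ne (by decide), Mem.write_of_ne (by decide), eval_const, Mem.write_self]
    simp
  · rw [Mem.write_of_ne (by decide), eval_const, eval_const, Mem.write_self]
    simp
  · rintro k σ' ⟨hσ', -⟩ -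
    exact (hr.congr hσ' (by decide)).eval_resourcesE
  · rintro k σ₁ hk ⟨hσ₁, h16, h17⟩ hv
    have hi₁ : σ₁ 11 0 = (i : ℕ) := by rw [hσ₁ 11 (by decide), hi]
    have hs₁ : Holds G s σ₁ := fun j => by rw [hσ₁ 1 (by decide), hs j]
    refine Spec.seq ((spec_loadP hf (hr.congr hσ₁ (by decide)) hs₁ hi₁ (e := ⟨k, hk⟩) hv).mono ?_)
    rintro σ₂ ⟨h15, hσ₂'⟩
    have hσ₂ := hσ₁.trans hσ₂' (by decide)
    have hr₂ := hr.congr hσ₂ (by decide)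
    have hv₂ : σ₂ 13 0 = ((⟨k, hk⟩ : Fin G.m) : ℕ) := by rw [hσ₂' 13 (by decide), hv]
    have hi₂ : σ₂ 11 0 = (i : ℕ) := by rw [hσ₂ 11 (by decide), hi]
    have hδk : (sub (costE d (var 13) (add (var 15) (weightE (var 11))))
        (costE d (var 13) (var 15))).eval σ₂ = δ ⟨k, hk⟩ := by
      rw [eval_sub, hr₂.eval_costE (e' := var 13) (e := ⟨k, hk⟩) hv₂,
        hr₂.eval_costE (e' := var 13) (e := ⟨k, hk⟩) hv₂, eval_add, eval_var, h15,
        hr₂.eval_weightE (j := var 11) (i := i) hi₂]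
    have hbit : ∀ {σ' : Mem} {x : Expr} {t : Fin (G.numStrategies i)},
        AgreeOff [16, 17, 18] σ₂ σ' → x.eval σ' = (t : ℕ) →
        (bitE (var 11) x (var 13)).eval σ' = if (⟨k, hk⟩ : Fin G.m) ∈ G.strategy i t then 1 else 0 := by
      intro σ' x t hσ' hx
      refine (hr₂.congr hσ' (by decide)).eval_bitE ?_ hx ?_
      · rw [eval_var, hσ' 11 (by decide), hi₂]
      · rw [eval_var, hσ' 13 (by decide), hv₂]
    refine Spec.seq (Spec.assign ?_ ?_)
    · rw [hδk]
      have := hδ0 ⟨k, hk⟩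
      have := hδe ⟨k, hk⟩
      omega
    rw [hδk, eval_const]
    have hw₃ : AgreeOff [16, 17, 18] σ₂ (σ₂.write 18 0 (δ ⟨k, hk⟩)) :=
      (AgreeOff.refl _ _).write (by decide) _ _
    have h3 : (add (var 16) (mul (bitE (var 11) (read 1 (var 11)) (var 13)) (var 18))).eval
        (σ₂.write 18 0 (δ ⟨k, hk⟩))
        = ∑ e with e.val < k + 1, (if e ∈ outcome G s i then 1 else 0) * δ e := by
      rw [eval_add, eval_mul, hbit (t := s i) hw₃, eval_var, eval_var, Mem.write_self,
        Mem.write_of_ne (by decide), hσ₂' 16 (by decide), h16, sum_filter_val_lt_succ hk]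
      rw [eval_read, eval_var, Mem.write_of_ne (by decide), Mem.write_of_ne (by decide), hi₂,
        hσ₂ 1 (by decide), hs i]
    refine Spec.seq (Spec.assign ?_ ?_)
    · rw [h3]; exact hpart _ _
    rw [h3, eval_const]
    generalize hX : ∑ e with e.val < k + 1, (if e ∈ outcome G s i then 1 else 0) * δ e = X
    have hw₄ : AgreeOff [16, 17, 18] σ₂ ((σ₂.write 18 0 (δ ⟨k, hk⟩)).write 16 0 X) :=
      hw₃.write (by decide) _ _
    have h4 : (add (var 17) (mul (bitE (var 11) (var 12) (var 13)) (var 18))).eval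
        ((σ₂.write 18 0 (δ ⟨k, hk⟩)).write 16 0 X)
        = ∑ e with e.val < k + 1, (if e ∈ G.strategy i q then 1 else 0) * δ e := by
      rw [eval_add, eval_mul, hbit (t := q) hw₄, eval_var, eval_var, Mem.write_of_ne (by decide),
        Mem.write_of_ne (by decide), Mem.write_of_ne (by decide), Mem.write_self,
        hσ₂' 17 (by decide), h17, sum_filter_val_lt_succ hk]
      rw [eval_var, Mem.write_of_ne (by decide), Mem.write_of_ne (by decide), hσ₂ 12 (by decide), hq]
    refine Spec.assign ?_ ?_
    · rw [h4]; exact hpart _ _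
    rw [h4, eval_const]
    refine ⟨?_, ?_, ?_, ?_⟩
    · rw [Mem.write_of_ne (by decide), Mem.write_of_ne (by decide), Mem.write_of_ne (by decide), hv₂]
    · exact ((((hσ₂.write (by decide) _ _).write (by decide) _ _).write (by decide) _ _).write
        (by decide) _ _)
    · rw [Mem.write_of_ne (by decide), Mem.write_of_ne (by decide), Mem.write_self]
    · rw [Mem.write_of_ne (by decide), Mem.write_self]
  · rintro σ' ⟨hσ', h16, h17⟩
    rw [filter_val_lt_self] at h16 h17
    exact ⟨h16, h17, hσ'⟩

end

end EquilibriumProgram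

/-! ### Correctness of a phase -/

namespace EquilibriumProgram

open Expr Program

variable {d : ℕ} {G : GameInstance d} {pr : Params d} {V N : ℕ} {σ : Mem}
  {s s₀ : (i : Fin G.n) → Fin (G.numStrategies i)} {F : Finset (Fin G.n)} {b : ℤ} {i : Fin G.n}

/-- The memory during a phase. -/
structure State (G : GameInstance d) (s : (i : Fin G.n) → Fin (G.numStrategies i))
    (F : Finset (Fin G.n)) (b : ℤ) (σ : Mem) : Prop where
  ready : Ready G σ
  holds : Holds G s σ
  fixed : ∀ i : Fin G.n, σ 2 (i : ℕ) = if i ∈ F then 1 else 0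
  threshold : σ 9 0 = b

theorem State.congr {σ' : Mem} (h : State G s F b σ) {S : List ℕ} (hσ : AgreeOff S σ σ')
    (hS : (0 ∉ S ∧ 3 ∉ S ∧ 4 ∉ S ∧ 5 ∉ S ∧ 6 ∉ S) ∧ 1 ∉ S ∧ 2 ∉ S ∧ 9 ∉ S) :
    State G s F b σ' where
  ready := h.ready.congr hσ hS.1
  holds i := by rw [hσ 1 hS.2.1, h.holds]
  fixed i := by rw [hσ 2 hS.2.2.1, h.fixed]
  threshold := by rw [hσ 9 hS.2.2.2, h.threshold]

/-- The threshold of the next phase. -/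
def next (pr : Params d) (n : ℕ) (b : ℤ) : ℤ := b / pr.ratio n

/-- The demanded improvement `next + 1` is positive even when the next threshold is `0`, and for
integral costs to improve by less means to improve by at most `next`. -/
abbrev CanMove (G : GameInstance d) (pr : Params d) (F : Finset (Fin G.n)) (b : ℤ)
    (s : (i : Fin G.n) → Fin (G.numStrategies i)) (i : Fin G.n) (q : Fin (G.numStrategies i)) :
    Prop :=
  Allowed G.realWeight G.realCost F pr.p b (next pr G.n b + 1 : ℤ) (outcome G s) i (G.strategy i q)

abbrev Reaches (G : GameInstance d) (pr : Params d) (F : Finset (Fin G.n)) (b : ℤ)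
    (s₀ s : (i : Fin G.n) → Fin (G.numStrategies i)) (c : ℕ) : Prop :=
  ∃ R, Moves G.realWeight G.realCost G.strategySet F pr.p b (next pr G.n b + 1 : ℤ)
    (outcome G s₀) (outcome G s) R c

theorem canMove_iff {q : Fin (G.numStrategies i)} : CanMove G pr F b s i q ↔
    i ∉ F ∧ G.intDevCost (outcome G s) i (G.strategy i q) + (next pr G.n b + 1)
        ≤ G.intDevCost (outcome G s) i (outcome G s i) ∧
      (G.intDevCost (outcome G s) i (outcome G s i) < b ∨
        pr.p * G.intDevCost (outcome G s) i (G.strategy i q)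
          < G.intDevCost (outcome G s) i (outcome G s i)) := by
  simp only [CanMove, Allowed, ← G.intDevCost_cast]
  norm_cast

theorem outcome_update (q : Fin (G.numStrategies i)) :
    outcome G (Function.update s i q) = Function.update (outcome G s) i (G.strategy i q) := by
  funext j
  rcases eq_or_ne j i with rfl | hj
  · simp [outcome]
  · simp [outcome, hj]

theorem Reaches.step {c : ℕ} {q : Fin (G.numStrategies i)} (h : Reaches G pr F b s₀ s c)
    (hc : CanMove G pr F b s i q) : Reaches G pr F b s₀ (Function.update s i q) (c + 1) := by
  obtain ⟨R, hR⟩ := h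
  rw [Reaches, outcome_update]
  exact ⟨_, hR.step ⟨q, rfl⟩ hc⟩

theorem Ready.eval_ratioE (h : Ready G σ) : (ratioE pr).eval σ = pr.ratio G.n := by
  rw [ratioE, eval_add, eval_mul, h.eval_playersE, Params.ratio]
  push_cast
  rfl

theorem State.eval_nextE (h : State G s F b σ) : (nextE pr).eval σ = next pr G.n b := by
  rw [nextE, eval_div, h.ready.eval_ratioE, eval_var, h.threshold, next]

theorem Holds.update {q : Fin (G.numStrategies i)} (h : Holds G s σ) :
    Holds G (Function.update s i q) (σ.write 1 (i : ℕ) (q : ℕ)) := fun j => by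
  rw [Mem.write_apply]
  rcases eq_or_ne j i with rfl | hj
  · simp
  · rw [if_neg (by simpa [Fin.ext_iff] using hj), Function.update_of_ne hj, h j]

theorem Ready.write (h : Ready G σ) {a : ℕ} (ha : a ∉ [0, 3, 4, 5, 6]) (j z : ℤ) :
    Ready G (σ.write a j z) :=
  h.congr (S := [a]) ((AgreeOff.refl _ _).write (by simp) _ _) (by simpa [eq_comm] using ha)

theorem State.move {q : Fin (G.numStrategies i)} (h : State G s F b σ) :
    State G (Function.update s i q) F b (σ.write 1 (i : ℕ) (q : ℕ)) where
  ready := h.ready.write (by decide) _ _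
  holds := h.holds.update
  fixed j := by rw [Mem.write_of_ne (by decide), h.fixed]
  threshold := by rw [Mem.write_of_ne (by decide), h.threshold]

theorem spec_moveP (hf : Fits G pr V N) (hm : 0 < G.m) (h : State G s F b σ)
    (hi : σ 11 0 = (i : ℕ)) {q : Fin (G.numStrategies i)} (hq : σ 12 0 = (q : ℕ)) :
    Spec V N (moveP pr) σ fun σ' => AgreeOff [1, 13, 14, 15, 16, 17, 18] σ σ' ∧
      ((¬ CanMove G pr F b s i q ∧ State G s F b σ') ∨
        (CanMove G pr F b s i q ∧ State G (Function.update s i q) F b σ')) := by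
  refine Spec.seq ((spec_costP hf h.ready h.holds hi hq).mono ?_)
  rintro σ' ⟨h16, h17, hσ'⟩
  have h' := h.congr hσ' (by decide)
  have hi' : σ' 11 0 = (i : ℕ) := by rw [hσ' 11 (by decide), hi]
  have hq' : σ' 12 0 = (q : ℕ) := by rw [hσ' 12 (by decide), hq]
  have hσ : AgreeOff [1, 13, 14, 15, 16, 17, 18] σ σ' :=
    hσ'.mono (List.subset_cons_self _ _)
  have hstay : ¬ CanMove G pr F b s i q → Spec V N .skip σ' fun σ' =>
      AgreeOff [1, 13, 14, 15, 16, 17, 18] σ σ' ∧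
      ((¬ CanMove G pr F b s i q ∧ State G s F b σ') ∨
        (CanMove G pr F b s i q ∧ State G (Function.update s i q) F b σ')) := fun hc =>
    Spec.skip ⟨hσ, Or.inl ⟨hc, h'⟩⟩
  have hmove : CanMove G pr F b s i q → Spec V N (.assign 1 (var 11) (var 12)) σ' fun σ' =>
      AgreeOff [1, 13, 14, 15, 16, 17, 18] σ σ' ∧
      ((¬ CanMove G pr F b s i q ∧ State G s F b σ') ∨
        (CanMove G pr F b s i q ∧ State G (Function.update s i q) F b σ')) := fun hc => by
    have hqV := (q.2.le.trans (hf.numStrategies_le hm i)).trans hf.N_le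
    refine Spec.assign ?_ ⟨hσ.write (by decide) _ _, Or.inr ⟨hc, ?_⟩⟩
    · rw [eval_var, hq', Int.natAbs_natCast]
      exact hqV
    · rw [eval_var, eval_var, hi', hq']
      exact h'.move
  -- The tests in order: not fixed, improvement above `next`, cost below `b`, improvement by the
  -- factor `p`.
  refine Spec.ite (fun t1 => Spec.ite (fun t2 => Spec.ite (fun t3 => hmove (canMove_iff.2 ?_))
    fun t3 => Spec.ite (fun t4 => hmove (canMove_iff.2 ?_)) fun t4 => hstay (mt canMove_iff.1 ?_))
    fun t2 => hstay (mt canMove_iff.1 ?_)) fun t1 => hstay (mt canMove_iff.1 ?_)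
  all_goals
    simp only [eval_sub, eval_const, eval_var, eval_read, eval_mul, h'.eval_nextE, hi', h'.fixed,
      h16, h17, h'.threshold, sub_pos, not_lt] at *
  · refine ⟨fun hF => ?_, by linarith, Or.inl t3⟩
    simp [hF] at t1
  · refine ⟨fun hF => ?_, by linarith, Or.inr t4⟩
    simp [hF] at t1
  · rintro ⟨-, -, h1 | h1⟩ <;> linarith
  · rintro ⟨-, h1, -⟩
    linarith
  · rintro ⟨hF, -⟩
    simp [hF] at t1

/-- In the sweep after `k` sweeps, when the strategies in `Z` have been tried: either more than `k`
moves were made, or none of the strategies in `Z` is an allowed move. -/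
def Progress (G : GameInstance d) (pr : Params d) (F : Finset (Fin G.n)) (b : ℤ)
    (s₀ : (i : Fin G.n) → Fin (G.numStrategies i)) (k : ℕ)
    (Z : (i : Fin G.n) → Fin (G.numStrategies i) → Prop)
    (s : (i : Fin G.n) → Fin (G.numStrategies i)) : Prop :=
  ∃ c, Reaches G pr F b s₀ s c ∧ (k + 1 ≤ c ∨
    (k ≤ c ∨ ∀ i q, ¬ CanMove G pr F b s i q) ∧ ∀ i q, Z i q → ¬ CanMove G pr F b s i q)

theorem Progress.stay {k : ℕ} {Z Z' : (i : Fin G.n) → Fin (G.numStrategies i) → Prop}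
    (h : Progress G pr F b s₀ k Z s)
    (hZ : ∀ i q, Z' i q → Z i q ∨ ¬ CanMove G pr F b s i q) : Progress G pr F b s₀ k Z' s := by
  obtain ⟨c, hc, h | ⟨h1, h2⟩⟩ := h
  · exact ⟨c, hc, Or.inl h⟩
  · exact ⟨c, hc, Or.inr ⟨h1, fun i q hq => (hZ i q hq).elim (h2 i q) id⟩⟩

/-- A possible move rules out the stable alternative, so at least `k` moves came before and the new
one exceeds `k`; earlier tests of strategies then no longer matter. -/
theorem Progress.move {k : ℕ} {Z Z' : (i : Fin G.n) → Fin (G.numStrategies i) → Prop}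
    {q : Fin (G.numStrategies i)} (h : Progress G pr F b s₀ k Z s)
    (hc : CanMove G pr F b s i q) : Progress G pr F b s₀ k Z' (Function.update s i q) := by
  obtain ⟨c, hR, h⟩ := h
  refine ⟨c + 1, hR.step hc, Or.inl ?_⟩
  rcases h with h | ⟨h | h, -⟩
  · omega
  · omega
  · exact absurd hc (h i q)

theorem spec_sweepP (hf : Fits G pr V N) (hm : 0 < G.m) {k : ℕ} (h : State G s F b σ)
    (hp : Progress G pr F b s₀ k (fun _ _ => False) s) :
    Spec V N (sweepP pr) σ fun σ' => σ' 10 0 = σ 10 0 ∧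
      ∃ s', State G s' F b σ' ∧ Progress G pr F b s₀ k (fun _ _ => True) s' := by
  refine Spec.forTo (n := G.n) (fun l σ' => σ' 10 0 = σ 10 0 ∧ ∃ s', State G s' F b σ' ∧
    Progress G pr F b s₀ k (fun i _ => i.val < l) s') hf.players_le
    (hf.players_le.trans hf.N_le) ⟨?_, s, ?_, ?_⟩ ?_ ?_ ?_
  · rw [Mem.write_of_ne (by decide)]
  · exact h.congr (S := [11]) ((AgreeOff.refl _ _).write (by decide) _ _) (by decide)
  · exact hp.stay fun i q hq => by omega
  · rintro l σ' ⟨-, s', hs', -⟩ -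
    exact hs'.ready.eval_playersE
  · rintro l σ₁ hl ⟨h10, s₁, hs₁, hp₁⟩ hv
    have hnV := (hf.numStrategies_le hm ⟨l, hl⟩)
    refine Spec.forTo (n := G.numStrategies ⟨l, hl⟩) (fun r σ' => σ' 10 0 = σ 10 0 ∧ σ' 11 0 = l ∧
      ∃ s', State G s' F b σ' ∧ Progress G pr F b s₀ k
        (fun i q => i.val < l ∨ i.val = l ∧ q.val < r) s') hnV (hnV.trans hf.N_le)
      ⟨?_, ?_, s₁, ?_, ?_⟩ ?_ ?_ ?_
    · rw [Mem.write_of_ne (by decide), h10]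
    · rw [Mem.write_of_ne (by decide), hv]
    · exact hs₁.congr (S := [12]) ((AgreeOff.refl _ _).write (by decide) _ _) (by decide)
    · exact hp₁.stay fun i q hq => Or.inl (by omega)
    · rintro r σ' ⟨-, h11, s', hs', -⟩ -
      exact hs'.ready.eval_numStrategiesE (j := var 11) (i := ⟨l, hl⟩) h11
    · rintro r σ₂ hr ⟨h10', h11, s₂, hs₂, hp₂⟩ hv₂
      refine (spec_moveP hf hm hs₂ (i := ⟨l, hl⟩) (q := ⟨r, hr⟩) h11 hv₂).mono ?_
      rintro σ₃ ⟨hσ₃, h3⟩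
      have hw : AgreeOff [12] σ₃ (σ₃.write 12 0 ((r + 1 : ℕ) : ℤ)) :=
        (AgreeOff.refl _ _).write (by decide) _ _
      refine ⟨by rw [hσ₃ 12 (by decide), hv₂], ?_, ?_, ?_⟩
      · rw [hw 10 (by decide), hσ₃ 10 (by decide), h10']
      · rw [hw 11 (by decide), hσ₃ 11 (by decide), h11]
      rcases h3 with ⟨hc, hs₃⟩ | ⟨hc, hs₃⟩
      · refine ⟨s₂, hs₃.congr hw (by decide), hp₂.stay fun i q hq => ?_⟩
        by_cases hZ : i.val < l ∨ i.val = l ∧ q.val < r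
        · exact Or.inl hZ
        · right
          obtain rfl : i = ⟨l, hl⟩ := Fin.ext (by simp only; omega)
          obtain rfl : q = ⟨r, hr⟩ := Fin.ext (by simp only; omega)
          exact hc
      · exact ⟨_, hs₃.congr hw (by decide), hp₂.move hc⟩
    · rintro σ' ⟨h10', h11, s', hs', hp'⟩
      have hw : AgreeOff [11] σ' (σ'.write 11 0 ((l + 1 : ℕ) : ℤ)) :=
        (AgreeOff.refl _ _).write (by decide) _ _
      refine ⟨h11, by rw [hw 10 (by decide), h10'], s', hs'.congr hw (by decide),
        hp'.stay fun i q hq => Or.inl ?_⟩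
      by_cases hil : i.val = l
      · obtain rfl : i = ⟨l, hl⟩ := Fin.ext hil
        exact Or.inr ⟨rfl, q.2⟩
      · exact Or.inl (by omega)
  · rintro σ' ⟨h10, s', hs', hp'⟩
    exact ⟨h10, s', hs', hp'.stay fun i q _ => Or.inl i.2⟩

theorem Ready.eval_sweepsE (h : Ready G σ) :
    (sweepsE pr).eval σ = ((pr.τ * G.n * pr.ratio G.n + 1 : ℕ) : ℤ) := by
  rw [sweepsE, eval_add, eval_mul, eval_mul, h.eval_ratioE, h.eval_playersE]
  push_cast
  rfl

/-- As long as stability is not reached, the moves keep up with the sweeps. There are more sweeps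
than the phase can have moves, so the last state is stable. -/
theorem spec_sweeps (hf : Fits G pr V N) (hm : 0 < G.m) (hb : 0 ≤ b) (h : State G s F b σ)
    (hinv : PhaseInv G.realWeight G.realCost G.strategySet pr (outcome G s) F b) :
    Spec V N (.forTo 10 (sweepsE pr) (sweepP pr)) σ fun σ' => ∃ s' c, State G s' F b σ' ∧
      Reaches G pr F b s s' c ∧ ∀ i q, ¬ CanMove G pr F b s' i q := by
  refine Spec.forTo (n := pr.τ * G.n * pr.ratio G.n + 1) (fun k σ' => ∃ s' c, State G s' F b σ' ∧
      Reaches G pr F b s s' c ∧ (k ≤ c ∨ ∀ i q, ¬ CanMove G pr F b s' i q)) hf.sweeps_le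
    (hf.sweeps_le.trans hf.N_le) ⟨s, 0, ?_, ⟨_, .refl⟩, Or.inl le_rfl⟩ ?_ ?_ ?_
  · exact h.congr (S := [10]) ((AgreeOff.refl _ _).write (by decide) _ _) (by decide)
  · rintro k σ' ⟨s', c, hs', -⟩ -
    exact hs'.ready.eval_sweepsE
  · rintro k σ₁ hk ⟨s₁, c, hs₁, hR, hc⟩ hv
    refine (spec_sweepP hf hm hs₁ (s₀ := s) (k := k)
      ⟨c, hR, Or.inr ⟨hc, fun _ _ hF => hF.elim⟩⟩).mono ?_
    rintro σ₂ ⟨h10, s₂, hs₂, c', hR', hc'⟩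
    refine ⟨by rw [h10, hv], s₂, c', ?_, hR', ?_⟩
    · exact hs₂.congr (S := [10]) ((AgreeOff.refl _ _).write (by decide) _ _) (by decide)
    · exact hc'.imp id fun h i q => h.2 i q trivial
  · rintro σ' ⟨s', c, hs', ⟨R, hR⟩, hc⟩
    refine ⟨s', c, hs', ⟨R, hR⟩, hc.resolve_left fun hle => ?_⟩
    have hnext : 0 ≤ next pr G.n b := Int.ediv_nonneg hb (Int.natCast_nonneg _)
    have hbβ : b ≤ pr.ratio G.n * (next pr G.n b + 1) := by
      have := Int.lt_ediv_add_one_mul_self b (b := pr.ratio G.n)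
        (by unfold Params.ratio; positivity)
      rw [mul_comm]
      exact this.le
    have := hR.count_le (fun i => (G.realWeight_pos i).le) G.isCost_realCost pr
      (by exact_mod_cast (by omega : 0 < next pr G.n b + 1)) (by exact_mod_cast hb) hinv.free
      (by rw [Fintype.card_fin]; exact_mod_cast hbβ)
    rw [Fintype.card_fin] at this
    omega

theorem spec_fixP (hf : Fits G pr V N) (h : State G s F b σ) :
    Spec V N (fixP d) σ fun σ' => ∃ F', State G s F' b σ' ∧
      ∀ i, i ∈ F' ↔ i ∈ F ∨ b ≤ G.intDevCost (outcome G s) i (outcome G s i) := by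
  refine Spec.forTo (n := G.n) (fun k σ' => ∃ F', State G s F' b σ' ∧ ∀ i, i ∈ F' ↔ i ∈ F ∨
      i.val < k ∧ b ≤ G.intDevCost (outcome G s) i (outcome G s i)) hf.players_le
    (hf.players_le.trans hf.N_le) ⟨F, ?_, by simp⟩ ?_ ?_ ?_
  · exact h.congr (S := [11]) ((AgreeOff.refl _ _).write (by decide) _ _) (by decide)
  · rintro k σ' ⟨F', h', -⟩ -
    exact h'.ready.eval_playersE
  · rintro k σ₁ hk ⟨F₁, h₁, hF₁⟩ hv
    have hw : AgreeOff [12] σ₁ (σ₁.write 12 0 0) := (AgreeOff.refl _ _).write (by decide) _ _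
    have h₂ := h₁.congr hw (by decide)
    have hi₂ : (σ₁.write 12 0 0) 11 0 = ((⟨k, hk⟩ : Fin G.n) : ℕ) := by
      rw [hw 11 (by decide), hv]
    refine Spec.seq (Spec.assign (by simp) (Spec.seq
      ((spec_costP hf h₂.ready h₂.holds hi₂ (q := ⟨0, G.numStrategies_pos _⟩)
        (by rw [Mem.write_self]; rfl)).mono ?_)))
    rintro σ₃ ⟨h16, -, hσ₃⟩
    have h₃ := h₂.congr hσ₃ (by decide)
    have hi₃ : σ₃ 11 0 = ((⟨k, hk⟩ : Fin G.n) : ℕ) := by rw [hσ₃ 11 (by decide), hi₂]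
    have hw' : ∀ σ : Mem, AgreeOff [11] σ (σ.write 11 0 ((k + 1 : ℕ) : ℤ)) := fun σ =>
      (AgreeOff.refl _ _).write (by decide) _ _
    have hsplit : ∀ i : Fin G.n, i.val < k + 1 ↔ i.val < k ∨ i = ⟨k, hk⟩ := fun i => by
      rw [Fin.ext_iff]; simp only; omega
    -- For integers the test `0 < cost - b + 1` means `b ≤ cost`.
    refine Spec.ite (fun ht => ?_) fun ht => ?_
    all_goals
      simp only [eval_add, eval_sub, eval_var, eval_const, h16, h₃.threshold] at ht
    · refine Spec.assign ?_ ⟨?_, insert ⟨k, hk⟩ F₁, State.congr ?_ (hw' _) (by decide), ?_⟩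
      · have := hf.two_le
        simp only [eval_const]
        omega
      · rw [Mem.write_of_ne (by decide), hi₃]
      · rw [eval_var, hi₃]
        refine ⟨h₃.ready.write (by decide) _ _, fun j => ?_, fun j => ?_, ?_⟩
        · rw [Mem.write_of_ne (by decide), h₃.holds]
        · rw [Mem.write_apply, h₃.fixed, eval_const]
          rcases eq_or_ne j ⟨k, hk⟩ with rfl | hj
          · simp
          · have : ¬ (((j : ℕ) : ℤ) = ((⟨k, hk⟩ : Fin G.n) : ℕ)) := by
              simpa [Fin.ext_iff] using hj
            rw [if_neg this]
            simp [hj]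
        · rw [Mem.write_of_ne (by decide), h₃.threshold]
      · intro i
        rw [Finset.mem_insert, hF₁, hsplit]
        constructor
        · rintro (rfl | hi | ⟨hi, hX⟩)
          · exact Or.inr ⟨Or.inr rfl, by omega⟩
          · exact Or.inl hi
          · exact Or.inr ⟨Or.inl hi, hX⟩
        · rintro (hi | ⟨hi | rfl, hX⟩)
          · exact Or.inr (Or.inl hi)
          · exact Or.inr (Or.inr ⟨hi, hX⟩)
          · exact Or.inl rfl
    · refine Spec.skip ⟨hi₃, F₁, h₃.congr (hw' _) (by decide), fun i => ?_⟩
      rw [hF₁, hsplit]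
      constructor
      · rintro (hi | ⟨hi, hX⟩)
        · exact Or.inl hi
        · exact Or.inr ⟨Or.inl hi, hX⟩
      · rintro (hi | ⟨hi | rfl, hX⟩)
        · exact Or.inl hi
        · exact Or.inr ⟨hi, hX⟩
        · omega
  · rintro σ' ⟨F', h', hF'⟩
    exact ⟨F', h', fun i => by rw [hF']; simp⟩

/-- The ratio is at least two, so rounding down at least halves the threshold. -/
theorem next_le (hb : 0 ≤ b) (n : ℕ) : 2 * next pr n b ≤ b ∧ pr.ratio n * next pr n b ≤ b ∧
    0 ≤ next pr n b := by
  have h0 : 0 ≤ next pr n b := Int.ediv_nonneg hb (Int.natCast_nonneg _)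
  have h1 : pr.ratio n * next pr n b ≤ b :=
    Int.mul_ediv_self_le (by unfold Params.ratio; positivity)
  have h2 : (2 : ℤ) ≤ pr.ratio n := by unfold Params.ratio; push_cast; nlinarith
  exact ⟨(mul_le_mul_of_nonneg_right h2 h0).trans h1, h1, h0⟩

theorem spec_phaseP (hf : Fits G pr V N) (hm : 0 < G.m) (hb : 0 ≤ b) (hbV : b ≤ V)
    (h : State G s F b σ)
    (hinv : PhaseInv G.realWeight G.realCost G.strategySet pr (outcome G s) F b) :
    Spec V N (phaseP pr) σ fun σ' => ∃ s' F', State G s' F' (next pr G.n b) σ' ∧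
      PhaseInv G.realWeight G.realCost G.strategySet pr (outcome G s') F' (next pr G.n b) := by
  obtain ⟨hn2, hng, hn0⟩ := next_le (pr := pr) hb G.n
  refine Spec.seq ((spec_sweeps hf hm hb h hinv).mono ?_)
  rintro σ₁ ⟨s₁, c, h₁, ⟨R, hR⟩, hstable⟩
  refine Spec.seq ((spec_fixP hf h₁).mono ?_)
  rintro σ₂ ⟨F', h₂, hF'⟩
  refine Spec.assign ?_ ⟨s₁, F', ?_, ?_⟩
  · rw [h₂.eval_nextE]
    omega
  · rw [h₂.eval_nextE, eval_const]
    refine ⟨h₂.ready.write (by decide) _ _, fun j => ?_, fun j => ?_, Mem.write_self _ _ _ _⟩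
    · rw [Mem.write_of_ne (by decide), h₂.holds]
    · rw [Mem.write_of_ne (by decide), h₂.fixed]
  · refine hinv.next (fun i => (G.realWeight_pos i).le) G.isCost_realCost
      (by exact_mod_cast (by omega : 0 ≤ next pr G.n b + 1)) (by exact_mod_cast hb)
      (by exact_mod_cast hn0) (by rw [Fintype.card_fin]; exact_mod_cast hng) hR ?_ ?_ ?_
    · rintro i _ ⟨q, rfl⟩
      exact hstable i q
    · rintro i Q -
      rw [← G.intDevCost_cast, ← G.intDevCost_cast]
      norm_cast
      intro h
      omega
    · intro i
      rw [hF', ← G.intDevCost_cast, Int.cast_le]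

end EquilibriumProgram

/-! ### Ranges of positions, costs and the first threshold -/

namespace GameInstance

variable {d : ℕ} (G : GameInstance d)

theorem off_mono {i j : ℕ} (hij : i ≤ j) (hj : j ≤ G.n) : G.off i ≤ G.off j := by
  induction j, hij using Nat.le_induction with
  | base => exact le_rfl
  | succ j hij ih =>
    refine (ih (by omega)).trans ?_
    have := G.off_succ ⟨j, hj⟩
    dsimp only at this
    omega

theorem numeratorSum_le : G.numeratorSum ≤ G.numeratorSum * G.weightDen :=
  le_mul_of_one_le_right (Finset.sum_nonneg fun i _ => Rat.num_nonneg.2 (G.weight_pos i).le)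
    (by exact_mod_cast G.weightDen_pos)

theorem intDevCost_nonneg (P : Fin G.n → Finset (Fin G.m)) (i : Fin G.n) (Q : Finset (Fin G.m)) :
    0 ≤ G.intDevCost P i Q :=
  Finset.sum_nonneg fun e _ => mul_nonneg (by split_ifs <;> simp) (G.intDiff_nonneg P i e)

theorem intDevCost_le (P : Fin G.n → Finset (Fin G.m)) (i : Fin G.n) (Q : Finset (Fin G.m)) :
    G.intDevCost P i Q ≤ G.initialBound := by
  refine le_trans (Finset.sum_le_sum fun e _ => ?_) (G.sum_intDiff_le P i)
  refine mul_le_of_le_one_left (G.intDiff_nonneg P i e) ?_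
  split_ifs <;> simp

theorem numeratorSum_nonneg : 0 ≤ G.numeratorSum :=
  Finset.sum_nonneg fun i _ => Rat.num_nonneg.2 (G.weight_pos i).le

theorem coeffNumeratorSum_nonneg : 0 ≤ G.coeffNumeratorSum :=
  Finset.sum_nonneg fun _ _ => Rat.num_nonneg.2 (G.coeff_nonneg _ _)

theorem initialBound_nonneg : 0 ≤ G.initialBound := by
  have := G.numeratorSum_nonneg
  have := G.coeffNumeratorSum_nonneg
  unfold initialBound
  positivity

/-- Without resources no phase is run. This is needed for the running time: characteristic vectors
are then empty, and the number of strategies is not bounded by the length of the input. -/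
theorem initialBound_eq_zero (h : G.m = 0) : G.initialBound = 0 := by
  have : IsEmpty (Fin (G.m * (d + 1))) := by rw [h, zero_mul]; infer_instance
  rw [initialBound, coeffNumeratorSum, Finset.sum_of_isEmpty]
  simp

end GameInstance

/-! ### Correctness of the whole program -/

namespace EquilibriumProgram

open Expr Program

variable {d : ℕ} {G : GameInstance d} {pr : Params d} {V N : ℕ} {σ : Mem}

theorem inputMem_of_ne {x : List ℤ} {a : ℕ} (h : a ≠ 0) (i : ℤ) : inputMem x a i = 0 := by
  simp [inputMem, h]

theorem spec_preparePlayersP (hf : Fits G pr V N) :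
    Spec V N preparePlayersP (inputMem G.encode) fun σ =>
      AgreeOff [3, 4, 6, 7, 11] (inputMem G.encode) σ ∧ (∀ i : Fin G.n, σ 3 (i : ℕ) = G.off i) ∧
        σ 4 0 = G.weightDen ∧ σ 6 0 = G.off G.n ∧ σ 7 0 = G.numeratorSum := by
  have hin : ∀ {σ : Mem}, AgreeOff [3, 4, 6, 7, 11] (inputMem G.encode) σ → ∀ j : ℕ,
      σ 0 j = G.input j := fun h j => by
    rw [h 0 (by decide), G.inputMem_natCast]
  have := hf.two_le
  refine Spec.seq (Spec.assign (by simpa using hf.two_le) (Spec.seq (Spec.assign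
    (by simp only [eval_const]; omega) ?_)))
  -- Variable `6` advances by the length of each player's block and so ends at the coefficients.
  refine Spec.forTo (n := G.n) (fun k σ => AgreeOff [3, 4, 6, 7, 11] (inputMem G.encode) σ ∧
      (∀ i : Fin G.n, i.val < k → σ 3 (i : ℕ) = G.off i) ∧
      σ 4 0 = ((∏ i : Fin G.n with i.val < k, (G.weight i).den : ℕ) : ℤ) ∧ σ 6 0 = G.off k ∧
      σ 7 0 = ∑ i : Fin G.n with i.val < k, (G.weight i).num) hf.players_le
    (hf.players_le.trans hf.N_le) ⟨?_, fun i hi => by omega, ?_, ?_, ?_⟩ ?_ ?_ ?_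
  · exact (((AgreeOff.refl _ _).write (by decide) _ _).write (by decide) _ _).write (by decide) _ _
  · rw [Mem.write_of_ne (by decide), eval_const, eval_const]
    simp [Mem.write_self]
  · rw [Mem.write_of_ne (by decide), Mem.write_of_ne (by decide), eval_const, eval_const,
      Mem.write_self, G.off_zero]
    rfl
  · rw [Mem.write_of_ne (by decide), Mem.write_of_ne (by decide), Mem.write_of_ne (by decide),
      inputMem_of_ne (by decide)]
    simp
  · rintro k σ ⟨hσ, -⟩ -
    exact hin hσ 0
  · rintro k σ hk ⟨hσ, h3, h4, h6, h7⟩ hv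
    have hoff : G.off (k + 1) ≤ G.off G.n := G.off_mono hk le_rfl
    have hoff' : G.off (k + 1) = G.off k + (3 + G.numStrategies ⟨k, hk⟩ * G.m) :=
      G.off_succ ⟨k, hk⟩
    have hV := hf.off_le
    have hnum : G.input (G.off k) = (G.weight ⟨k, hk⟩).num := G.input_weight_num ⟨k, hk⟩
    have hden : G.input (G.off k + 1) = (G.weight ⟨k, hk⟩).den := G.input_weight_den ⟨k, hk⟩
    have hns : G.input (G.off k + 2) = G.numStrategies ⟨k, hk⟩ := G.input_numStrategies ⟨k, hk⟩
    refine Spec.seq (Spec.assign ?_ ?_)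
    · rw [eval_var, h6]
      omega
    rw [eval_var, eval_var, h6, hv]
    set σ₁ := σ.write 3 k (G.off k) with hσ₁
    have g₁ : AgreeOff [3] σ σ₁ := (AgreeOff.refl _ _).write (by decide) _ _
    have i₁ := hin (hσ.trans g₁ (by decide))
    have e₁ : (mul (var 4) (read 0 (add (var 6) (const 1)))).eval σ₁
        = ((∏ i : Fin G.n with i.val < k + 1, (G.weight i).den : ℕ) : ℤ) := by
      have := i₁ (G.off k + 1)
      push_cast at this
      rw [eval_mul, eval_var, eval_read, eval_add, eval_var, eval_const, g₁ 4 (by decide),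
        g₁ 6 (by decide), h4, h6, this, hden, prod_filter_val_lt_succ hk]
      push_cast
      rfl
    refine Spec.seq (Spec.assign ?_ ?_)
    · rw [e₁, Int.natAbs_natCast]
      refine le_trans ?_ hf.weightDen_le
      exact Finset.prod_le_prod_of_subset_of_one_le' (Finset.subset_univ _)
        fun i _ _ => (G.weight i).den_pos
    rw [e₁, eval_const]
    set σ₂ := σ₁.write 4 0 ((∏ i : Fin G.n with i.val < k + 1, (G.weight i).den : ℕ) : ℤ) with hσ₂
    have g₂ : AgreeOff [3, 4] σ σ₂ := (g₁.mono (by decide)).write (by decide) _ _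
    have i₂ := hin (hσ.trans g₂ (by decide))
    have e₂ : (add (var 7) (read 0 (var 6))).eval σ₂
        = ∑ i : Fin G.n with i.val < k + 1, (G.weight i).num := by
      rw [eval_add, eval_var, eval_read, eval_var, g₂ 7 (by decide), g₂ 6 (by decide), h6, h7, i₂,
        hnum, sum_filter_val_lt_succ hk]
    refine Spec.seq (Spec.assign ?_ ?_)
    · rw [e₂]
      have h0 : ∀ i, 0 ≤ (G.weight i).num := fun i => Rat.num_nonneg.2 (G.weight_pos i).le
      have h1 : ∑ i : Fin G.n with i.val < k + 1, (G.weight i).num ≤ G.numeratorSum :=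
        Finset.sum_le_sum_of_subset_of_nonneg (Finset.subset_univ _) fun i _ _ => h0 i
      have h2 : 0 ≤ ∑ i : Fin G.n with i.val < k + 1, (G.weight i).num :=
        Finset.sum_nonneg fun i _ => h0 i
      have h3 := G.numeratorSum_le.trans hf.numeratorSum_le
      omega
    rw [e₂, eval_const]
    set σ₃ := σ₂.write 7 0 (∑ i : Fin G.n with i.val < k + 1, (G.weight i).num) with hσ₃
    have g₃ : AgreeOff [3, 4, 7] σ σ₃ := (g₂.mono (by decide)).write (by decide) _ _
    have i₃ := hin (hσ.trans g₃ (by decide))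
    have e₃ : (add (var 6) (add (const 3)
        (mul (read 0 (add (var 6) (const 2))) resourcesE))).eval σ₃ = G.off (k + 1) := by
      have h2 := i₃ (G.off k + 2)
      have h3 : resourcesE.eval σ₃ = G.m := i₃ 1
      push_cast at h2
      rw [eval_add, eval_add, eval_mul, eval_read, eval_add, eval_var, eval_const, eval_const, h3,
        g₃ 6 (by decide), h6, h2, hns, hoff']
      push_cast
      ring
    refine Spec.assign ?_ ?_
    · rw [e₃]
      omega
    rw [e₃, eval_const]
    refine ⟨?_, ?_, ?_, ?_, ?_, ?_⟩
    · rw [Mem.write_of_ne (by decide), g₃ 11 (by decide), hv]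
    · exact ((hσ.trans g₃ (by decide)).write (by decide) _ _).write (by decide) _ _
    · intro i hi
      rw [Mem.write_of_ne (by decide), Mem.write_of_ne (by decide), hσ₃,
        Mem.write_of_ne (by decide), hσ₂, Mem.write_of_ne (by decide), hσ₁, Mem.write_apply]
      split_ifs with hik
      · rw [Nat.cast_inj] at hik
        rw [hik]
      · exact h3 i (by omega)
    · rw [Mem.write_of_ne (by decide), Mem.write_of_ne (by decide), hσ₃,
        Mem.write_of_ne (by decide), hσ₂, Mem.write_self]
    · rw [Mem.write_of_ne (by decide), Mem.write_self]
    · rw [Mem.write_of_ne (by decide), Mem.write_of_ne (by decide), hσ₃, Mem.write_self]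
  · rintro σ ⟨hσ, h3, h4, h6, h7⟩
    rw [filter_val_lt_self] at h4 h7
    exact ⟨hσ, fun i => h3 i i.2, h4, h6, h7⟩

theorem spec_prepareCoeffsP (hf : Fits G pr V N) (hin : ∀ j : ℕ, σ 0 j = G.input j)
    (h6 : σ 6 0 = G.off G.n) (h8 : σ 8 0 = 0) :
    Spec V N (prepareCoeffsP d) σ fun σ' => AgreeOff [5, 8, 11] σ σ' ∧ σ' 5 0 = G.coeffDen ∧
      σ' 8 0 = G.coeffNumeratorSum := by
  have := hf.two_le
  refine Spec.seq (Spec.assign (by simp only [eval_const]; omega) ?_)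
  set num : Fin (G.m * (d + 1)) → ℤ := fun q => (G.coeff q.divNat q.modNat).num with hnum
  set den : Fin (G.m * (d + 1)) → ℕ := fun q => (G.coeff q.divNat q.modNat).den with hden
  refine Spec.forTo (n := G.m * (d + 1)) (fun k σ' => AgreeOff [5, 8, 11] σ σ' ∧
      σ' 5 0 = ((∏ q with q.val < k, den q : ℕ) : ℤ) ∧ σ' 8 0 = ∑ q with q.val < k, num q)
    hf.coeffs_le (hf.coeffs_le.trans hf.N_le) ⟨?_, ?_, ?_⟩ ?_ ?_ ?_
  · exact ((AgreeOff.refl _ _).write (by decide) _ _).write (by decide) _ _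
  · rw [Mem.write_of_ne (by decide), eval_const, eval_const, Mem.write_self]
    simp
  · rw [Mem.write_of_ne (by decide), Mem.write_of_ne (by decide), h8]
    simp
  · rintro k σ' ⟨hσ', -⟩ -
    have h1 : resourcesE.eval σ' = G.m := by
      rw [resourcesE, eval_read, eval_const, hσ' 0 (by decide)]
      exact hin 1
    rw [eval_mul, h1, eval_const]
    push_cast
    rfl
  · rintro k σ₁ hk ⟨hσ₁, h5, h8⟩ hv
    -- One counter runs through all pairs of resource and exponent; `divNat` and `modNat` recover
    -- the pair.
    have hq : ∀ r < 2, G.input (G.off G.n + (2 * k + r))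
        = [num ⟨k, hk⟩, (den ⟨k, hk⟩ : ℤ)].getD r 0 := by
      intro r hr
      have h1 := G.input_coeff (Fin.divNat ⟨k, hk⟩) (Fin.modNat ⟨k, hk⟩) hr
      rwa [show ((Fin.divNat ⟨k, hk⟩ : Fin G.m) : ℕ) * (d + 1)
        + ((Fin.modNat ⟨k, hk⟩ : Fin (d + 1)) : ℕ) = k from Nat.div_add_mod' k (d + 1)] at h1
    have hcell : ∀ {σ' : Mem}, AgreeOff [5, 8, 11] σ σ' → σ' 11 0 = k →
        (read 0 (coeffPosE (var 11))).eval σ' = num ⟨k, hk⟩ ∧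
        (read 0 (add (coeffPosE (var 11)) (const 1))).eval σ' = (den ⟨k, hk⟩ : ℤ) := by
      intro σ' hσ' hv'
      have q0 := hin (G.off G.n + (2 * k + 0))
      have q1 := hin (G.off G.n + (2 * k + 1))
      rw [hq _ (by omega)] at q0 q1
      push_cast at q0 q1
      rw [add_zero] at q0
      rw [← add_assoc] at q1
      simp only [coeffPosE, eval_read, eval_add, eval_mul, eval_var, eval_const, hv',
        hσ' 0 (by decide), hσ' 6 (by decide), h6, q0, q1]
      exact ⟨rfl, rfl⟩
    have e₁ : (mul (var 5) (read 0 (add (coeffPosE (var 11)) (const 1)))).eval σ₁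
        = ((∏ q with q.val < k + 1, den q : ℕ) : ℤ) := by
      rw [eval_mul, eval_var, (hcell hσ₁ hv).2, h5, prod_filter_val_lt_succ hk]
      push_cast
      rfl
    refine Spec.seq (Spec.assign ?_ ?_)
    · rw [e₁, Int.natAbs_natCast]
      refine le_trans ?_ hf.coeffDen_le
      exact Finset.prod_le_prod_of_subset_of_one_le' (Finset.subset_univ _)
        fun _ _ _ => Rat.den_pos _
    rw [e₁, eval_const]
    set σ₂ := σ₁.write 5 0 ((∏ q with q.val < k + 1, den q : ℕ) : ℤ) with hσ₂
    have g₂ : AgreeOff [5, 8, 11] σ σ₂ := hσ₁.write (by decide) _ _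
    have v₂ : σ₂ 11 0 = k := by rw [hσ₂, Mem.write_of_ne (by decide), hv]
    have e₂ : (add (var 8) (read 0 (coeffPosE (var 11)))).eval σ₂
        = ∑ q with q.val < k + 1, num q := by
      rw [eval_add, eval_var, (hcell g₂ v₂).1, hσ₂, Mem.write_of_ne (by decide), h8,
        sum_filter_val_lt_succ hk]
    refine Spec.assign ?_ ⟨?_, ?_, ?_, ?_⟩
    · rw [e₂]
      have h0 : ∀ q, 0 ≤ num q := fun q => Rat.num_nonneg.2 (G.coeff_nonneg _ _)
      have h1 : ∑ q with q.val < k + 1, num q ≤ G.coeffNumeratorSum :=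
        Finset.sum_le_sum_of_subset_of_nonneg (Finset.subset_univ _) fun q _ _ => h0 q
      have h2 : 0 ≤ ∑ q with q.val < k + 1, num q := Finset.sum_nonneg fun q _ => h0 q
      have h3 := hf.coeffNumeratorSum_le
      omega
    · rw [Mem.write_of_ne (by decide), v₂]
    · exact (g₂.write (by decide) _ _).write (by decide) _ _
    · rw [Mem.write_of_ne (by decide), Mem.write_of_ne (by decide), hσ₂, Mem.write_self]
    · rw [Mem.write_of_ne (by decide), eval_const, Mem.write_self, e₂]
  · rintro σ' ⟨hσ', h5, h8⟩
    rw [filter_val_lt_self] at h5 h8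
    exact ⟨hσ', h5, h8⟩

/-- The number of binary digits of the threshold drops in every phase and so bounds the phases left;
at threshold `0` the invariant is the equilibrium condition. -/
theorem spec_mainP (hf : Fits G pr V N) :
    Spec V N (mainP pr) (inputMem G.encode) (G.OutputsApproxPNE ((d + 1) * (8 * pr.p))) := by
  refine Spec.seq ((spec_preparePlayersP hf).mono ?_)
  rintro σ₁ ⟨hσ₁, h3, h4, h6, h7⟩
  refine Spec.seq ((spec_prepareCoeffsP hf
    (fun j => by rw [hσ₁ 0 (by decide), G.inputMem_natCast]) h6
    (by rw [hσ₁ 8 (by decide), inputMem_of_ne (by decide)])).mono ?_)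
  rintro σ₂ ⟨hσ₂, h5, h8⟩
  have hb : (initialE d).eval σ₂ = G.initialBound := by
    rw [initialE, eval_mul, eval_mul, eval_mul, eval_powE, eval_powE, eval_mul, eval_var, eval_var,
      eval_var, eval_var, h5, h8, hσ₂ 4 (by decide), hσ₂ 7 (by decide), h4, h7,
      GameInstance.initialBound]
  have hb0 := G.initialBound_nonneg
  have hbV := hf.initialBound_le
  refine Spec.seq (Spec.assign (by rw [hb]; omega) ?_)
  rw [hb, eval_const]
  set σ₃ := σ₂.write 9 0 G.initialBound with hσ₃
  set s₀ : (i : Fin G.n) → Fin (G.numStrategies i) := fun i => ⟨0, G.numStrategies_pos i⟩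
  have g₃ : AgreeOff [9] σ₂ σ₃ := (AgreeOff.refl _ _).write (by decide) _ _
  have hstate : State G s₀ ∅ G.initialBound σ₃ := by
    refine ⟨⟨fun j => ?_, fun i => ?_, ?_, ?_, ?_⟩, fun i => ?_, fun i => ?_, Mem.write_self _ _ _ _⟩
    · rw [g₃ 0 (by decide), hσ₂ 0 (by decide), hσ₁ 0 (by decide), G.inputMem_natCast]
    · rw [g₃ 3 (by decide), hσ₂ 3 (by decide), h3]
    · rw [g₃ 4 (by decide), hσ₂ 4 (by decide), h4]
    · rw [g₃ 5 (by decide), h5]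
    · rw [g₃ 6 (by decide), hσ₂ 6 (by decide), h6]
    · rw [g₃ 1 (by decide), hσ₂ 1 (by decide), hσ₁ 1 (by decide), inputMem_of_ne (by decide)]
      rfl
    · rw [g₃ 2 (by decide), hσ₂ 2 (by decide), hσ₁ 2 (by decide), inputMem_of_ne (by decide)]
      simp
  -- All costs lie between `0` and `initialBound`, so no deviation can gain more than the first
  -- threshold.
  have hinv : PhaseInv G.realWeight G.realCost G.strategySet pr (outcome G s₀) ∅
      (G.initialBound : ℤ) := by
    refine ⟨fun i => ⟨s₀ i, rfl⟩, fun i _ Q _ => ?_, by simp⟩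
    rw [← G.intDevCost_cast, ← G.intDevCost_cast]
    norm_cast
    have h1 := G.intDevCost_le (outcome G s₀) i (outcome G s₀ i)
    have h2 := G.intDevCost_nonneg (outcome G s₀) i Q
    omega
  refine Spec.loop (I := fun l σ => ∃ s F, ∃ b : ℤ, State G s F b σ ∧
    PhaseInv G.realWeight G.realCost G.strategySet pr (outcome G s) F b ∧ 0 ≤ b ∧
      b ≤ G.initialBound ∧ Nat.size b.natAbs ≤ l) hf.size_le
    ⟨s₀, ∅, _, hstate, hinv, hb0, le_rfl, le_rfl⟩ ?_ ?_ ?_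
  · rintro σ ⟨s, F, b, hs, -, hb, -, hl⟩
    rw [eval_var, hs.threshold]
    have := Nat.size_eq_zero.1 (Nat.le_zero.1 hl)
    omega
  · rintro l σ ⟨s, F, b, hs, hi, hb, hbi, hl⟩ hpos
    rw [eval_var, hs.threshold] at hpos
    have hm : 0 < G.m := by
      by_contra hm
      have := G.initialBound_eq_zero (by omega)
      omega
    refine (spec_phaseP hf hm hb (hbi.trans hbV) hs hi).mono ?_
    rintro σ' ⟨s', F', hs', hi'⟩
    obtain ⟨hn2, -, hn0⟩ := next_le (pr := pr) hb G.n
    refine ⟨s', F', _, hs', hi', hn0, by omega, ?_⟩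
    rw [Nat.size_le] at hl ⊢
    rw [pow_succ] at hl
    omega
  · rintro l σ ⟨s, F, b, hs, hi, hb, -, -⟩ hpos
    rw [eval_var, hs.threshold] at hpos
    obtain rfl : b = 0 := by omega
    rw [Int.cast_zero] at hi
    exact ⟨s, hs.holds, G.isApproxPNE_of_phaseInv hi⟩

end EquilibriumProgram

/-! ### Bounds in terms of the input length -/

namespace GameInstance

variable {d : ℕ} (G : GameInstance d)

theorem off_add_le_size : G.off G.n + G.m * (d + 1) * 2 ≤ G.size := by
  rw [mul_assoc, ← length_encode]
  exact G.length_le_size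

theorem two_le_size : 2 ≤ G.size :=
  le_trans (Nat.le_add_right 2 _) ((Nat.le_add_right _ _).trans G.off_add_le_size)

theorem n_le_size : G.n ≤ G.size := by
  have h : ∀ i ≤ G.n, i ≤ G.off i := by
    intro i
    induction i with
    | zero => exact fun _ => Nat.zero_le _
    | succ i ih =>
      intro hi
      have h1 : G.off (i + 1) = G.off i + (3 + G.numStrategies ⟨i, hi⟩ * G.m) := G.off_succ ⟨i, hi⟩
      have h2 := ih (by omega)
      omega
  have := h _ le_rfl
  have := G.off_add_le_size
  omega

theorem numStrategies_le_size (hm : 0 < G.m) (i : Fin G.n) : G.numStrategies i ≤ G.size := by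
  have h1 := G.off_succ i
  have h2 := G.off_mono (i := i + 1) (j := G.n) i.2 le_rfl
  have h3 := G.off_add_le_size
  have h4 := Nat.le_mul_of_pos_right (G.numStrategies i) hm
  omega

theorem natAbs_coeff_lt (q : Fin (G.m * (d + 1))) :
    (G.coeff q.divNat q.modNat).num.natAbs < 2 ^ G.size
      ∧ (G.coeff q.divNat q.modNat).den < 2 ^ G.size := by
  have h0 := G.natAbs_input_lt (G.off G.n + (2 * (q.divNat * (d + 1) + q.modNat) + 0))
  have h1 := G.natAbs_input_lt (G.off G.n + (2 * (q.divNat * (d + 1) + q.modNat) + 1))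
  rw [G.input_coeff _ _ (by omega)] at h0 h1
  exact ⟨h0, h1⟩

theorem natAbs_weight_lt (i : Fin G.n) :
    (G.weight i).num.natAbs < 2 ^ G.size ∧ (G.weight i).den < 2 ^ G.size := by
  have h0 := G.natAbs_input_lt (G.off i)
  have h1 := G.natAbs_input_lt (G.off i + 1)
  rw [G.input_weight_num] at h0
  rw [G.input_weight_den] at h1
  exact ⟨h0, h1⟩

theorem prod_le_two_pow {n L : ℕ} (hn : n ≤ L) {f : Fin n → ℕ} (hf : ∀ i, f i < 2 ^ L) :
    ∏ i, f i ≤ 2 ^ L ^ 2 := by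
  calc ∏ i, f i ≤ ∏ _i : Fin n, 2 ^ L := Finset.prod_le_prod' fun i _ => (hf i).le
    _ = 2 ^ (L * n) := by rw [Finset.prod_const, Finset.card_univ, Fintype.card_fin, ← pow_mul]
    _ ≤ 2 ^ L ^ 2 := Nat.pow_le_pow_right two_pos (by rw [sq]; exact Nat.mul_le_mul_left _ hn)

theorem sum_le_two_pow {n L : ℕ} (hn : n ≤ L) (hL : 2 ≤ L) {f : Fin n → ℤ}
    (hf : ∀ i, (f i).natAbs < 2 ^ L) : ∑ i, f i ≤ 2 ^ L ^ 2 := by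
  have h1 : ∀ i, f i ≤ 2 ^ L := fun i => by
    have := hf i
    zify at this
    exact (le_abs_self _).trans this.le
  calc ∑ i, f i ≤ ∑ _i : Fin n, (2 : ℤ) ^ L := Finset.sum_le_sum fun i _ => h1 i
    _ = n * 2 ^ L := by simp
    _ ≤ 2 ^ L * 2 ^ L := by
        have : (n : ℤ) ≤ 2 ^ L := by exact_mod_cast hn.trans Nat.lt_two_pow_self.le
        gcongr
    _ = 2 ^ (L * 2) := by rw [← pow_add, mul_two]
    _ ≤ 2 ^ L ^ 2 := pow_le_pow_right₀ (by norm_num) (by rw [sq]; exact Nat.mul_le_mul_left _ hL)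

theorem coeffs_le_size : G.m * (d + 1) ≤ G.size := by
  have := G.off_add_le_size
  omega

theorem weightDen_le : G.weightDen ≤ 2 ^ G.size ^ 2 :=
  prod_le_two_pow G.n_le_size fun i => (G.natAbs_weight_lt i).2

theorem coeffDen_le : G.coeffDen ≤ 2 ^ G.size ^ 2 :=
  prod_le_two_pow G.coeffs_le_size fun q => (G.natAbs_coeff_lt q).2

theorem numeratorSum_le_two_pow : G.numeratorSum ≤ 2 ^ G.size ^ 2 :=
  sum_le_two_pow G.n_le_size G.two_le_size fun i => (G.natAbs_weight_lt i).1

theorem coeffNumeratorSum_le : G.coeffNumeratorSum ≤ 2 ^ G.size ^ 2 :=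
  sum_le_two_pow G.coeffs_le_size G.two_le_size fun q => (G.natAbs_coeff_lt q).1

theorem numeratorSum_mul_le : G.numeratorSum * G.weightDen ≤ (2 ^ G.size ^ 2) ^ 2 := by
  rw [sq]
  exact mul_le_mul G.numeratorSum_le_two_pow (by exact_mod_cast G.weightDen_le) (by positivity)
    (by positivity)

theorem initialBound_le : G.initialBound ≤ (2 ^ G.size ^ 2) ^ (3 * d + 4) := by
  have h1 := G.coeffNumeratorSum_le
  have h2 : (G.coeffDen : ℤ) ≤ 2 ^ G.size ^ 2 := by exact_mod_cast G.coeffDen_le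
  have h3 : (G.weightDen : ℤ) ≤ 2 ^ G.size ^ 2 := by exact_mod_cast G.weightDen_le
  have h4 := G.numeratorSum_mul_le
  have h5 := mul_nonneg G.numeratorSum_nonneg (Int.natCast_nonneg G.weightDen)
  have h6 := G.coeffNumeratorSum_nonneg
  rw [initialBound]
  generalize (2 : ℤ) ^ G.size ^ 2 = B at *
  have hB : 0 ≤ B := h6.trans h1
  calc _ ≤ B * B * B ^ d * (B ^ 2) ^ (d + 1) := by gcongr
    _ = B ^ (3 * d + 4) := by ring

end GameInstance

namespace EquilibriumProgram

variable {d : ℕ}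

/-- Common denominators and sums of numerators are at most `2 ^ L ^ 2`, where `L` is the input
length, and the threshold is a product of boundedly many of them. So stored numbers have `O(L ^ 2)`
bits, and `O(L ^ 2)` also bounds the sweeps of a phase and the number of phases. -/
theorem exists_fits (pr : Params d) : ∃ c : ℕ, ∀ G : GameInstance d, ∃ V N, Fits G pr V N ∧
    N + 1 ≤ c * G.size ^ 2 ∧ Nat.size V + 1 ≤ c * G.size ^ 2 := by
  -- The first summand covers the sweeps of a phase, the others the digits of `initialBound`, with
  -- some slack.
  set A := pr.τ * (pr.K + 2) + 3 * d + 6 with hA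
  refine ⟨2 * A + 3, fun G => ?_⟩
  have hL := G.two_le_size
  set L := G.size with hLdef
  have hL1 : L ≤ L ^ 2 := Nat.le_self_pow two_ne_zero L
  have hAL : 6 * L ^ 2 ≤ A * L ^ 2 := Nat.mul_le_mul_right _ (by omega)
  have hALd : (3 * d + 6) * L ^ 2 ≤ A * L ^ 2 := Nat.mul_le_mul_right _ (by omega)
  have hLN : L ≤ A * L ^ 2 := by omega
  set X := (3 * d + 4) * L ^ 2 with hX
  have hpow : (2 ^ L ^ 2) ^ (3 * d + 4) = 2 ^ X := by
    rw [← pow_mul, mul_comm, hX]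
  have hV : ∀ {x : ℕ}, x ≤ A * L ^ 2 + X + 1 → 2 ^ x ≤ 2 ^ (A * L ^ 2 + X + 1) := fun h =>
    Nat.pow_le_pow_right two_pos h
  have hb : G.initialBound ≤ 2 ^ X := by
    have := G.initialBound_le
    rw [← pow_mul] at this
    rwa [hX, mul_comm (3 * d + 4)]
  have hL2X : L ^ 2 * 2 ≤ X := by rw [hX, mul_comm]; exact Nat.mul_le_mul_right _ (by omega)
  refine ⟨2 ^ (A * L ^ 2 + X + 1), A * L ^ 2, ?_, ?_, ?_⟩
  · refine
      { two_le := by simpa using hV (x := 1) (by omega)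
        N_le := Nat.lt_two_pow_self.le.trans (hV (by omega))
        input_le := fun j => (G.natAbs_input_lt j).le.trans (hV (by omega))
        off_le := ?_
        weightDen_le := G.weightDen_le.trans (hV (x := L ^ 2) (by omega))
        coeffDen_le := G.coeffDen_le.trans (hV (x := L ^ 2) (by omega))
        coeffNumeratorSum_le := G.coeffNumeratorSum_le.trans
          (by exact_mod_cast hV (x := L ^ 2) (by omega))
        numeratorSum_le := G.numeratorSum_mul_le.trans ?_
        initialBound_le := hb.trans (by exact_mod_cast hV (x := X) (by omega))
        players_le := G.n_le_size.trans hLN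
        coeffs_le := G.coeffs_le_size.trans hLN
        numStrategies_le := fun hm i => (G.numStrategies_le_size hm i).trans hLN
        sweeps_le := ?_
        size_le := ?_ }
    · have := G.off_add_le_size
      exact (show G.off G.n ≤ L by omega).trans (Nat.lt_two_pow_self.le.trans (hV (by omega)))
    · rw [← pow_mul]
      exact_mod_cast hV (x := L ^ 2 * 2) (by omega)
    · have hn := G.n_le_size
      have h1 : pr.ratio G.n ≤ (pr.K + 2) * L := by
        rw [Params.ratio, add_mul]
        exact add_le_add (Nat.mul_le_mul_left _ hn) (by omega)
      calc pr.τ * G.n * pr.ratio G.n + 1 ≤ pr.τ * L * ((pr.K + 2) * L) + 1 := by gcongr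
        _ = pr.τ * (pr.K + 2) * L ^ 2 + 1 := by ring
        _ ≤ A * L ^ 2 := by
          rw [hA, add_assoc, add_mul (pr.τ * (pr.K + 2))]
          exact Nat.add_le_add_left (by nlinarith) _
    · rw [Nat.size_le]
      have h0 := G.initialBound_nonneg
      have h1 : G.initialBound.natAbs ≤ 2 ^ X := by
        zify
        rwa [abs_of_nonneg h0]
      refine h1.trans_lt (Nat.pow_lt_pow_right one_lt_two ?_)
      have : X + 2 * L ^ 2 = (3 * d + 6) * L ^ 2 := by rw [hX]; ring
      omega
  · have : (2 * A + 3) * L ^ 2 = 2 * (A * L ^ 2) + 3 * L ^ 2 := by ring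
    omega
  · have h1 : (2 * A + 3) * L ^ 2 = 2 * (A * L ^ 2) + 3 * L ^ 2 := by ring
    have h2 : X + 2 * L ^ 2 = (3 * d + 6) * L ^ 2 := by rw [hX]; ring
    rw [Nat.size_pow]
    omega

/-- The program computes an approximate equilibrium in polynomial time. -/
theorem exists_time_bound (pr : Params d) : ∃ K : ℕ, ∀ G : GameInstance d, ∀ r,
    HaltsWith (mainP pr) G.encode r (K * G.size ^ 14)
      (G.OutputsApproxPNE ((d + 1) * (8 * pr.p))) := by
  obtain ⟨c, hc⟩ := exists_fits pr
  obtain ⟨c', hc'⟩ := (mainP pr).time_le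
  refine ⟨c' * c ^ 7, fun G r => ?_⟩
  obtain ⟨V, N, hf, hN, hV⟩ := hc G
  obtain ⟨t, ht, σ, he, -, hσ⟩ := spec_mainP hf ⟨hf.two_le, fun a i => by
    by_cases h : a = 0 ∧ 0 ≤ i
    · obtain ⟨rfl, hi⟩ := h
      lift i to ℕ using hi
      rw [G.inputMem_natCast]
      exact hf.input_le i
    · simp [inputMem, h]⟩
  refine ⟨t, ht.trans ?_, σ, r, he r, hσ⟩
  -- Six nested loops of `O(L ^ 2)` rounds and numbers of `O(L ^ 2)` bits give `2 * 6 + 2 = 14`.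
  calc (mainP pr).time N * (Nat.size V + 1)
      ≤ (c' * (c * G.size ^ 2) ^ 6) * (c * G.size ^ 2) := by
        refine Nat.mul_le_mul ((hc' N).trans ?_) hV
        rw [depth_mainP]
        gcongr
    _ = c' * c ^ 7 * G.size ^ 14 := by ring

end EquilibriumProgram

/-! ### The main theorem -/

theorem HaltsWith.imp {p : Program} {x : List ℤ} {r : List Bool} {T : ℕ} {Good Good' : Mem → Prop}
    (h : HaltsWith p x r T Good) (hG : ∀ σ, Good σ → Good' σ) : HaltsWith p x r T Good' := by
  obtain ⟨t, ht, σ, r', he, hσ⟩ := h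
  exact ⟨t, ht, σ, r', he, hG σ hσ⟩

theorem successProb_eq_one {p : Program} {x : List ℤ} {T : ℕ} {Good : Mem → Prop}
    (h : ∀ r, HaltsWith p x r T Good) : successProb p x T Good = 1 := by
  classical
  rw [successProb, Finset.filter_true_of_mem fun r _ => h _, Finset.card_univ, Fintype.card_fun,
    Fintype.card_bool, Fintype.card_fin, Nat.cast_pow, Nat.cast_ofNat, div_self (by positivity)]

theorem mainTheorem2 :
    ∃ (p : Polynomial ℝ) (k : ℕ), ∀ (d : ℕ) (γ : ℝ), 0 < γ →
      ∃ α : ℝ, 1 ≤ α ∧ α ≤ ((d : ℝ) / Real.log 2) ^ d * p.eval (d : ℝ) ∧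
        ∀ c : ℕ, ∃ (prog : Program) (K : ℕ), ∀ G : GameInstance d,
          (∀ r : Fin (K * G.size ^ k) → Bool,
            HaltsWith prog G.encode (List.ofFn r) (K * G.size ^ k) (fun _ => True)) ∧
          1 - 1 / (G.n : ℝ) ^ c ≤
            successProb prog G.encode (K * G.size ^ k) (G.OutputsApproxPNE α) := by
  -- `200 = 8 * 25`; one factor `d + 1` comes from the Shapley shares, the other from the bound for
  -- `p`.
  refine ⟨Polynomial.C 200 * (Polynomial.X + 1) ^ 2, 14, fun d γ _ => ?_⟩
  obtain ⟨pr, hpr⟩ := Params.exists_le d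
  obtain ⟨K, hK⟩ := EquilibriumProgram.exists_time_bound pr
  have hp : (1 : ℝ) ≤ pr.p := by exact_mod_cast pr.one_le_p
  have hd : (0 : ℝ) ≤ d := Nat.cast_nonneg d
  refine ⟨(d + 1) * (8 * pr.p), ?_, ?_, fun c =>
    ⟨EquilibriumProgram.mainP pr, K, fun G => ⟨fun r => (hK G _).imp fun _ _ => trivial, ?_⟩⟩⟩
  · nlinarith
  · simp only [Polynomial.eval_mul, Polynomial.eval_C, Polynomial.eval_pow, Polynomial.eval_add,
      Polynomial.eval_X, Polynomial.eval_one]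
    have := mul_le_mul_of_nonneg_left hpr (show (0 : ℝ) ≤ 8 * (d + 1) by positivity)
    linarith
  · rw [successProb_eq_one (hK G), sub_le_self_iff]
    positivity
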